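/- Let $M$ be a smooth oriented four-dimensional spacetime with metric $g$ of signature $(-,+,+,+)$, Levi-Civita connection $\nabla$ and metric volume element $\eta$. Let $W$ be its Weyl tensor, $*$ the Hodge dual, $(*F)_{\alpha\beta}=\frac12\eta_{\alpha\beta\mu\nu}F^{\mu\nu}$ (acting on the first pair of indices of $W$), and let $\mathcal W=\frac12(W-\mathrm i\,{*W})$ be the self-dual Weyl tensor. Let $\mathcal G=\frac12(G-\mathrm i\,\eta)$ with $G_{\alpha\beta\lambda\mu}=g_{\alpha\lambda}g_{\beta\mu}-g_{\alpha\mu}g_{\beta\lambda}$. For double bivectors put $(AB)_{\alpha\beta\mu\nu}=\frac12A_{\alpha\beta\lambda\rho}B^{\lambda\rho}{}_{\mu\nu}$ and $\operatorname{Tr}A=\frac12A^{\mu\nu}{}_{\mu\nu}$. Suppose that on the domain of a chart the Weyl tensor is of Petrov-Bel type I, that is, at every point the endomorphism $F_{\alpha\beta}\mapsto\frac12\mathcal W_{\alpha\beta\mu\nu}F^{\mu\nu}$ of the three-dimensional complex space of self-dual bivectors ($*F=\mathrm iF$) has three different eigenvalues. A Weyl principal frame on an open set is a smooth orthonormal frame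 $\{e_0,e_1,e_2,e_3\}$ with $g(e_0,e_0)=-1$ and $\eta(e_0,e_1,e_2,e_3)=1$ such that, at every point, $\mathcal W=-\sum_{A=1}^3\alpha_A\,\mathcal U_A\otimes\mathcal U_A$ for some complex $\alpha_A$, where $\mathcal U_A=\frac1{\sqrt2}(U_A-\mathrm i\,{*U_A})$ and $U_A=e_0\wedge e_A$. Such a frame exists in a neighbourhood of every point of the domain. Let $a=\operatorname{Tr}\mathcal W^2$, $b=\operatorname{Tr}\mathcal W^3$ and $\Delta=a^3-6b^2$. Then $\Delta\neq0$ everywhere on the domain. Moreover, for every Weyl principal frame $\{e_a\}$ on an open subset of the domain, with dual basis $\{\theta^a\}$ and connection coefficients defined by $\nabla e_a=\gamma^c_{ab}\,\theta^b\otimes e_c$, the connection tensor $H=\gamma^c_{ab}\,\theta^b\otimes\theta^a\otimes e_c$ (with its last index lowered by $g$) is, at every point of that subset, $$H=\frac1{\sqrt2}\left(\mathcal H+\overline{\mathcal H}\right),\qquad \mathcal H_{\alpha\mu\nu}=\frac1{\sqrt2}\,\mathcal X_{\alpha\lambda\rho}\,\mathcal Y^{\lambda\rho}{}_{\mu\nu},$$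 $$\mathcal X_{\lambda\alpha\rho}=\frac12\,\nabla_\lambda\mathcal W_{\alpha\beta\mu\nu}\,\mathcal W^{\mu\nu\beta}{}_{\rho},\qquad \mathcal Y=\frac1\Delta\left(3a\,\mathcal W^2+6b\,\mathcal W+\frac12a^2\,\mathcal G\right).$$ -/

import Mathlib

open scoped Manifold ContDiff

noncomputable section

namespace Spacetime

/-- The model space of coordinates. -/
abbrev Coord := EuclideanSpace ℝ (Fin 4)

/-- The signature symbol `diag(-1, 1, 1, 1)`. -/
def minkowski (a b : Fin 4) : ℝ := if a = b then (if a = 0 then -1 else 1) else 0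

/-! ## Oriented spacetimes -/

section Manifold

variable {M : Type*} [TopologicalSpace M] [ChartedSpace Coord M]

/-- The coordinate vector `∂_i` of the chart `φ`, at the point with coordinates `y`. -/
def coordVec (φ : OpenPartialHomeomorph M Coord) (y : Coord) (i : Fin 4) :
    TangentSpace (𝓡 4) (φ.symm y) :=
  mfderiv (𝓡 4) (𝓡 4) φ.symm y (EuclideanSpace.single i (1 : ℝ) : Coord)

variable (M) in
/-- A smooth metric of signature `(-,+,+,+)` on `M`, with its metric volume element `vol`
(the choice of `vol` is the choice of an orientation). -/
structure LorentzStructure [IsManifold (𝓡 4) ∞ M] where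
  /-- the metric tensor -/
  metric : ∀ x : M, TangentSpace (𝓡 4) x →L[ℝ] TangentSpace (𝓡 4) x →L[ℝ] ℝ
  symm : ∀ (x : M) (v w : TangentSpace (𝓡 4) x), metric x v w = metric x w v
  signature : ∀ x : M, ∃ e : Fin 4 → TangentSpace (𝓡 4) x,
    ∀ a b, metric x (e a) (e b) = minkowski a b
  metric_smooth : ContMDiff (𝓡 4) ((𝓡 4).prod 𝓘(ℝ, Coord →L[ℝ] Coord →L[ℝ] ℝ)) ∞
    (fun x ↦ Bundle.TotalSpace.mk' (Coord →L[ℝ] Coord →L[ℝ] ℝ) x (metric x))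
  /-- the metric volume element `η` -/
  vol : ∀ x : M, (TangentSpace (𝓡 4) x) [⋀^Fin 4]→ₗ[ℝ] ℝ
  vol_unit : ∀ (x : M) (e : Fin 4 → TangentSpace (𝓡 4) x),
    (∀ a b, metric x (e a) (e b) = minkowski a b) → vol x e = 1 ∨ vol x e = -1
  vol_smooth : ∀ φ ∈ IsManifold.maximalAtlas (𝓡 4) ∞ M,
    ContDiffOn ℝ ∞ (fun y ↦ vol (φ.symm y) (coordVec φ y)) φ.target

variable [IsManifold (𝓡 4) ∞ M]

/-- The components `g_{ij}` of the metric in the chart `φ`, as functions of the coordinates. -/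
def LorentzStructure.metricIn (S : LorentzStructure M) (φ : OpenPartialHomeomorph M Coord)
    (y : Coord) : Matrix (Fin 4) (Fin 4) ℝ :=
  Matrix.of fun i j ↦ S.metric (φ.symm y) (coordVec φ y i) (coordVec φ y j)

/-- The components `η_{ijkl}` of the volume element in the chart `φ`. -/
def LorentzStructure.volIn (S : LorentzStructure M) (φ : OpenPartialHomeomorph M Coord)
    (y : Coord) (i j k l : Fin 4) : ℝ :=
  S.vol (φ.symm y) ![coordVec φ y i, coordVec φ y j, coordVec φ y k, coordVec φ y l]

/-- The coordinate expression of the vector field `v` in the chart `φ`, at the point with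
coordinates `y`. -/
def vecIn (φ : OpenPartialHomeomorph M Coord) (v : ∀ x : M, TangentSpace (𝓡 4) x)
    (y : Coord) : Coord :=
  mfderiv (𝓡 4) (𝓡 4) φ (φ.symm y) (v (φ.symm y))

/-- The components `e_a^i` of a family of four vector fields in the chart `φ`. -/
def frameIn (φ : OpenPartialHomeomorph M Coord)
    (e : Fin 4 → ∀ x : M, TangentSpace (𝓡 4) x) (y : Coord) (a i : Fin 4) : ℝ :=
  vecIn φ (e a) y i

end Manifold

/-! ## Tensor calculus in coordinates

Tensors are given by their covariant components. `g` and `η` are the component functions of the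
metric and of the volume element in a coordinate system. -/

/-- The partial derivative `∂_i f`. -/
def pd {F : Type*} [NormedAddCommGroup F] [NormedSpace ℝ F] (i : Fin 4) (f : Coord → F)
    (y : Coord) : F :=
  fderiv ℝ f y (EuclideanSpace.single i (1 : ℝ))

section Coordinates

variable (g : Coord → Matrix (Fin 4) (Fin 4) ℝ) (η : Coord → Fin 4 → Fin 4 → Fin 4 → Fin 4 → ℝ)

/-- The Christoffel symbol `Γ^k_{ij}` of the Levi-Civita connection. -/
def christoffel (y : Coord) (k i j : Fin 4) : ℝ :=
  (1 / 2) * ∑ l, (g y)⁻¹ k l *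
    (pd i (fun z ↦ g z j l) y + pd j (fun z ↦ g z i l) y - pd l (fun z ↦ g z i j) y)

/-- The Riemann tensor `R^n_{cab}`. -/
def riemannUp (y : Coord) (n c a b : Fin 4) : ℝ :=
  pd a (fun z ↦ christoffel g z n c b) y - pd b (fun z ↦ christoffel g z n c a) y
    + ∑ m, (christoffel g y m c b * christoffel g y n m a
      - christoffel g y m c a * christoffel g y n m b)

/-- The Riemann tensor `R_{ncab}`. -/
def riemann (y : Coord) (n c a b : Fin 4) : ℝ := ∑ m, g y n m * riemannUp g y m c a b

/-- The Ricci tensor `R_{cb} = R^n_{cnb}`. -/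
def ricci (y : Coord) (c b : Fin 4) : ℝ := ∑ n, riemannUp g y n c n b

/-- The scalar curvature. -/
def scalarCurv (y : Coord) : ℝ := ∑ i, ∑ j, (g y)⁻¹ i j * ricci g y i j

/-- The Weyl tensor `W_{ijkl}`. -/
def weyl (y : Coord) (i j k l : Fin 4) : ℝ :=
  riemann g y i j k l
    - (1 / 2) * (g y i k * ricci g y j l - g y i l * ricci g y j k
        + g y j l * ricci g y i k - g y j k * ricci g y i l)
    + (scalarCurv g y / 6) * (g y i k * g y j l - g y i l * g y j k)

/-- The inverse metric `g^{ij}`, as a complex number. -/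
def ginv (y : Coord) (i j : Fin 4) : ℂ := (((g y)⁻¹ i j : ℝ) : ℂ)

/-- The Hodge dual `(*F)_{ij} = (1/2) η_{ijkl} F^{kl}`. -/
def hodge (y : Coord) (F : Fin 4 → Fin 4 → ℂ) (i j : Fin 4) : ℂ :=
  (1 / 2) * ∑ k, ∑ l, ∑ m, ∑ n, (η y i j k l : ℂ) * ginv g y k m * ginv g y l n * F m n

/-- The self-dual Weyl tensor `𝓦 = (1/2) (W - i *W)`. -/
def sdWeyl (y : Coord) (i j k l : Fin 4) : ℂ :=
  (1 / 2) * ((weyl g y i j k l : ℂ)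
    - Complex.I * hodge g η y (fun m n ↦ (weyl g y m n k l : ℂ)) i j)

/-- The metric on self-dual bivectors `𝓖 = (1/2) (G - i η)`,
`G_{ijkl} = g_{ik} g_{jl} - g_{il} g_{jk}`. -/
def sdMetric (y : Coord) (i j k l : Fin 4) : ℂ :=
  (1 / 2) * (((g y i k * g y j l - g y i l * g y j k : ℝ) : ℂ) - Complex.I * (η y i j k l : ℂ))

/-- The product of double bivectors `(A B)_{ijkl} = (1/2) A_{ijmn} B^{mn}_{kl}`. -/
def dblMul (y : Coord) (A B : Fin 4 → Fin 4 → Fin 4 → Fin 4 → ℂ) (i j k l : Fin 4) : ℂ :=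
  (1 / 2) * ∑ m, ∑ n, ∑ p, ∑ q, A i j m n * ginv g y m p * ginv g y n q * B p q k l

/-- The trace of a double bivector `Tr A = (1/2) A^{mn}_{mn}`. -/
def dblTr (y : Coord) (A : Fin 4 → Fin 4 → Fin 4 → Fin 4 → ℂ) : ℂ :=
  (1 / 2) * ∑ m, ∑ n, ∑ p, ∑ q, ginv g y m p * ginv g y n q * A p q m n

/-- The action of a double bivector on a bivector, `A(F)_{ij} = (1/2) A_{ijkl} F^{kl}`. -/
def dblApply (y : Coord) (A : Fin 4 → Fin 4 → Fin 4 → Fin 4 → ℂ) (F : Fin 4 → Fin 4 → ℂ)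
    (i j : Fin 4) : ℂ :=
  (1 / 2) * ∑ k, ∑ l, ∑ m, ∑ n, A i j k l * ginv g y k m * ginv g y l n * F m n

/-- `F` is a self-dual bivector: antisymmetric with `*F = i F`. -/
def IsSelfDual (y : Coord) (F : Fin 4 → Fin 4 → ℂ) : Prop :=
  (∀ i j, F i j = -F j i) ∧ ∀ i j, hodge g η y F i j = Complex.I * F i j

/-- Petrov-Bel type I (algebraically general): on the three-dimensional complex space of self-dual
bivectors, the self-dual Weyl tensor has three different eigenvalues. -/
def IsTypeI (y : Coord) : Prop :=
  ∃ α : Fin 3 → ℂ, Function.Injective α ∧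
    ∀ A, ∃ F : Fin 4 → Fin 4 → ℂ, F ≠ 0 ∧ IsSelfDual g η y F ∧
      ∀ i j, dblApply g y (sdWeyl g η y) F i j = α A * F i j

/-- `𝓦²`. -/
def sdWeyl2 (y : Coord) : Fin 4 → Fin 4 → Fin 4 → Fin 4 → ℂ :=
  dblMul g y (sdWeyl g η y) (sdWeyl g η y)

/-- `𝓦³`. -/
def sdWeyl3 (y : Coord) : Fin 4 → Fin 4 → Fin 4 → Fin 4 → ℂ :=
  dblMul g y (sdWeyl2 g η y) (sdWeyl g η y)

/-- `a = Tr 𝓦²`. -/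
def invA (y : Coord) : ℂ := dblTr g y (sdWeyl2 g η y)

/-- `b = Tr 𝓦³`. -/
def invB (y : Coord) : ℂ := dblTr g y (sdWeyl3 g η y)

/-- `Δ = a³ - 6 b²`. -/
def invDelta (y : Coord) : ℂ := invA g η y ^ 3 - 6 * invB g η y ^ 2

/-- The covariant derivative `∇_m 𝓦_{ijkl}`. -/
def nablaSdWeyl (y : Coord) (m i j k l : Fin 4) : ℂ :=
  pd m (fun z ↦ sdWeyl g η z i j k l) y
    - ∑ s, ((christoffel g y s m i : ℂ) * sdWeyl g η y s j k l
      + (christoffel g y s m j : ℂ) * sdWeyl g η y i s k l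
      + (christoffel g y s m k : ℂ) * sdWeyl g η y i j s l
      + (christoffel g y s m l : ℂ) * sdWeyl g η y i j k s)

/-- `𝓧_{λαρ} = (1/2) ∇_λ 𝓦_{αβμν} 𝓦^{μνβ}_ρ`. -/
def tensorX (y : Coord) (l a r : Fin 4) : ℂ :=
  (1 / 2) * ∑ b, ∑ m, ∑ n, ∑ b', ∑ m', ∑ n',
    nablaSdWeyl g η y l a b m n * ginv g y m m' * ginv g y n n' * ginv g y b b'
      * sdWeyl g η y m' n' b' r

/-- `𝓨 = (3 a 𝓦² + 6 b 𝓦 + (1/2) a² 𝓖) / Δ`. -/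
def tensorY (y : Coord) (i j k l : Fin 4) : ℂ :=
  (3 * invA g η y * sdWeyl2 g η y i j k l + 6 * invB g η y * sdWeyl g η y i j k l
    + (1 / 2) * invA g η y ^ 2 * sdMetric g η y i j k l) / invDelta g η y

/-- `𝓗_{αμν} = (1/√2) 𝓧_{αλρ} 𝓨^{λρ}_{μν}`. -/
def sdConnection (y : Coord) (a m n : Fin 4) : ℂ :=
  (1 / (Real.sqrt 2 : ℂ)) * ∑ l, ∑ r, ∑ l', ∑ r',
    tensorX g η y a l r * ginv g y l l' * ginv g y r r' * tensorY g η y l' r' m n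

/-! ### Frames, `e y a i` being the component `e_a^i` at `y` -/

/-- The components `∇_l e_a^m`. -/
def nablaFrame (e : Coord → Fin 4 → Fin 4 → ℝ) (y : Coord) (a l m : Fin 4) : ℝ :=
  pd l (fun z ↦ e z a m) y + ∑ n, christoffel g y m l n * e y a n

/-- The components `θ^a_i` of the algebraic dual basis, `θ^a_i e_b^i = δ^a_b`. -/
def coframe (e : Coord → Fin 4 → Fin 4 → ℝ) (y : Coord) (a i : Fin 4) : ℝ :=
  (Matrix.of (e y))⁻¹ i a

/-- The connection coefficients `γ^c_{ab}`, defined by `∇ e_a = γ^c_{ab} θ^b ⊗ e_c`. -/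
def connCoeff (e : Coord → Fin 4 → Fin 4 → ℝ) (y : Coord) (c a b : Fin 4) : ℝ :=
  ∑ l, ∑ m, coframe e y c m * e y b l * nablaFrame g e y a l m

/-- The connection tensor `H = γ^c_{ab} θ^b ⊗ θ^a ⊗ e_c` of a frame, last index lowered:
`H_{lnm} = γ^c_{ab} θ^b_l θ^a_n (e_c)_m`. -/
def connectionTensor (e : Coord → Fin 4 → Fin 4 → ℝ) (y : Coord) (l n m : Fin 4) : ℝ :=
  ∑ a, ∑ b, ∑ c, connCoeff g e y c a b * coframe e y b l * coframe e y a n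
    * ∑ s, g y m s * e y c s

/-- The bivector `U_A = e_0 ∧ e_A`, `(U_A)_{ij} = (e_0)_i (e_A)_j - (e_A)_i (e_0)_j`; the index
`A = 1, 2, 3` is coded by `A.succ` with `A : Fin 3`. -/
def frameBivector (e : Coord → Fin 4 → Fin 4 → ℝ) (y : Coord) (A : Fin 3) (i j : Fin 4) : ℝ :=
  (∑ s, g y i s * e y 0 s) * (∑ s, g y j s * e y A.succ s)
    - (∑ s, g y i s * e y A.succ s) * (∑ s, g y j s * e y 0 s)

/-- The self-dual bivector `𝓤_A = (1/√2) (U_A - i *U_A)`. -/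
def sdFrameBivector (e : Coord → Fin 4 → Fin 4 → ℝ) (y : Coord) (A : Fin 3) (i j : Fin 4) : ℂ :=
  (1 / (Real.sqrt 2 : ℂ)) * ((frameBivector g e y A i j : ℂ)
    - Complex.I * hodge g η y (fun m n ↦ (frameBivector g e y A m n : ℂ)) i j)

/-- The bivectors `𝓤_A` of the frame diagonalize the self-dual Weyl tensor:
`𝓦 = - ∑_A α_A 𝓤_A ⊗ 𝓤_A`. -/
def DiagonalizesWeyl (e : Coord → Fin 4 → Fin 4 → ℝ) (y : Coord) : Prop :=
  ∃ α : Fin 3 → ℂ, ∀ i j k l, sdWeyl g η y i j k l =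
    -∑ A, α A * sdFrameBivector g η e y A i j * sdFrameBivector g η e y A k l

end Coordinates

/-- `e` is a Weyl principal frame on the open set `V` of the domain of the chart `φ`: a smooth
oriented orthonormal frame whose associated self-dual bivectors diagonalize the self-dual Weyl
tensor. -/
structure IsWeylPrincipalFrameOn {M : Type*} [TopologicalSpace M] [ChartedSpace Coord M]
    [IsManifold (𝓡 4) ∞ M] (S : LorentzStructure M) (φ : OpenPartialHomeomorph M Coord)
    (V : Set M) (e : Fin 4 → ∀ x : M, TangentSpace (𝓡 4) x) : Prop where
  isOpen : IsOpen V
  subset : V ⊆ φ.source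
  smooth : ∀ a, ContMDiffOn (𝓡 4) (𝓡 4).tangent ∞
    (fun x ↦ (⟨x, e a x⟩ : TangentBundle (𝓡 4) M)) V
  orthonormal : ∀ x ∈ V, ∀ a b, S.metric x (e a x) (e b x) = minkowski a b
  oriented : ∀ x ∈ V, S.vol x (fun a ↦ e a x) = 1
  principal : ∀ x ∈ V, DiagonalizesWeyl (S.metricIn φ) (S.volIn φ) (frameIn φ e) (φ x)

end Spacetime

end

/-! Contracted like matrices, the self-dual bivectors of an oriented orthonormal frame obey the
Pauli relations (`sdBasis_mul_mink_mul`). Hence u_A = √2 𝓤_A is an orthogonal basis of the self-dual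
space, and double bivectors self-dual on both sides become complex 3 × 3 matrices through `dbl`:
product, trace and action on bivectors turn into those of matrices, and 𝓖 into the identity
(`dblMul_dbl`, `dblTr_dbl`, `dblApply_dbl`, `sdMetric_eq`). The symmetries of the Weyl tensor make 𝓦
a symmetric traceless matrix Q (`sdWeyl_eq`). Then a = tr Q², b = tr Q³, and by Newton's identities
Δ is twice the discriminant of the characteristic polynomial x³ - (a/2) x - b/3, that is 2 ∏ (α_A -
α_B)², which type I makes nonzero.

For the connection formula, metric compatibility makes the connection in a direction l a real
bivector, twice the real part of Σ s_A u_A. Self-dual and anti-self-dual bivectors commute, so ∇_l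
rotates the u_A by a matrix R depending on s alone (`nabla_sdBiv`). In a principal frame Q =
diag(α), and ∇_l 𝓦 has diagonal entries ∂_l α_A and off-diagonal entries (α_C - α_B) R_CB
(`nablaSdWeyl_eq_dbl`). After multiplication by 𝓦 and contraction, the diagonal only yields a
multiple of g, which 𝓨 annihilates. The remaining component along u_C is (α_A - α_B)² s_C = (2a -
3α_C²) s_C, with A, B the other two indices. The tensor 𝓨 is the polynomial in 𝓦 that inverts this
factor: (2a - 3x²)(3a x² + 6b x + a²/2) = Δ modulo the characteristic polynomial. So 𝓧 contracted
with 𝓨 returns s (`sdConnection_eq`), and the real part gives H.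

For the existence of principal frames, Gram-Schmidt supplies a smooth oriented frame. Since Δ ≠ 0,
Cardano's formula gives smooth eigenvalues of Q, and the eigenprojections give a smooth complex
orthogonal matrix P of determinant 1 diagonalizing Q (`exists_smooth_specialOrthogonal`). A complex
quaternion q representing P, multiplied by its complex conjugate and normalised, is a real Lorentz
matrix inducing P on self-dual bivectors (`dbl_boostFrame`); it carries the frame to a principal
one. -/

noncomputable section

namespace Spacetime

/-! ### The Levi-Civita symbol and determinants -/

section

open Matrix

/-- The Levi-Civita symbol on four indices. -/
def levi (i j k l : Fin 4) : ℝ :=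
  (((j : ℕ) : ℝ) - (i : ℕ)) * (((k : ℕ) : ℝ) - (i : ℕ)) * (((l : ℕ) : ℝ) - (i : ℕ)) *
    (((k : ℕ) : ℝ) - (j : ℕ)) * (((l : ℕ) : ℝ) - (j : ℕ)) * (((l : ℕ) : ℝ) - (k : ℕ)) / 12

/-- `levi` is a Vandermonde product, hence alternating, and 12 is the value of the numerator at 0,
1, 2, 3. Having it as a polynomial in the indices turns the comparison with the expanded determinant
into a computation. -/
theorem sum_levi_mul (w x y z : Fin 4 → ℝ) :
    ∑ i, ∑ j, ∑ k, ∑ l, levi i j k l * w i * x j * y k * z l =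
      (Matrix.of ![w, x, y, z]).det := by
  simp [Matrix.det_succ_row_zero, Fin.sum_univ_succ, levi, Fin.succAbove]
  ring

theorem levi_eq_det (a b c d : Fin 4) :
    (Matrix.of ![(1 : Matrix (Fin 4) (Fin 4) ℝ) a, (1 : Matrix (Fin 4) (Fin 4) ℝ) b,
      (1 : Matrix (Fin 4) (Fin 4) ℝ) c, (1 : Matrix (Fin 4) (Fin 4) ℝ) d]).det = levi a b c d := by
  rw [← sum_levi_mul]
  simp [Matrix.one_apply]

/-- Selecting four rows of `E` is multiplication on the left by unit rows, and the determinant is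
multiplicative. This is the transformation law of the volume element under a change of frame. -/
theorem sum_levi_mul_row (E : Matrix (Fin 4) (Fin 4) ℝ) (a b c d : Fin 4) :
    ∑ i, ∑ j, ∑ k, ∑ l, levi i j k l * E a i * E b j * E c k * E d l =
      levi a b c d * E.det := by
  rw [sum_levi_mul, ← levi_eq_det, ← Matrix.det_mul]
  congr 1
  ext i j
  fin_cases i <;> simp [Matrix.mul_apply, Matrix.one_apply]

/-! ### Self-dual bivectors in an orthonormal frame -/

/-- The Minkowski matrix over `ℂ`. -/
def mink : Matrix (Fin 4) (Fin 4) ℂ := Matrix.diagonal ![-1, 1, 1, 1]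

theorem mink_apply (a b : Fin 4) : mink a b = (minkowski a b : ℂ) := by
  fin_cases a <;> fin_cases b <;> simp [mink, minkowski, Matrix.diagonal]

theorem mink_mul_mink : mink * mink = 1 := by
  rw [mink, Matrix.diagonal_mul_diagonal, ← Matrix.diagonal_one]
  congr 1; ext i; fin_cases i <;> simp

theorem mink_transpose : minkᵀ = mink := Matrix.diagonal_transpose _

/-- The frame components of `√2` times the self-dual bivectors of an orthonormal frame. -/
def sdBasis : Fin 3 → Matrix (Fin 4) (Fin 4) ℂ :=
  ![!![0, -1, 0, 0; 1, 0, 0, 0; 0, 0, 0, -Complex.I; 0, 0, Complex.I, 0],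
    !![0, 0, -1, 0; 0, 0, 0, Complex.I; 1, 0, 0, 0; 0, -Complex.I, 0, 0],
    !![0, 0, 0, -1; 0, 0, -Complex.I, 0; 0, Complex.I, 0, 0; 1, 0, 0, 0]]

/-- The Levi-Civita symbol on three indices. -/
def levi3 (A B C : Fin 3) : ℂ :=
  (((B : ℕ) : ℂ) - (A : ℕ)) * (((C : ℕ) : ℂ) - (A : ℕ)) * (((C : ℕ) : ℂ) - (B : ℕ)) / 2

theorem sdBasis_transpose (A : Fin 3) : (sdBasis A)ᵀ = -sdBasis A := by
  ext i j; fin_cases A <;> fin_cases i <;> fin_cases j <;> simp [sdBasis]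

/-- The Pauli relations, with an index lowered. Their symmetric part gives the orthogonality of the
basis, their antisymmetric part the commutators that govern both the connection and the contraction
in 𝓧. -/
theorem sdBasis_mul_mink_mul (A B : Fin 3) : sdBasis A * mink * sdBasis B =
    (if A = B then (1 : ℂ) else 0) • mink + Complex.I • ∑ C, levi3 A B C • sdBasis C := by
  have h : ∀ M N : Matrix (Fin 4) (Fin 4) ℂ, ∀ i j, (M * mink * N) i j =
      -(M i 0 * N 0 j) + M i 1 * N 1 j + M i 2 * N 2 j + M i 3 * N 3 j := fun M N i j ↦ by
    simp [Matrix.mul_apply, Fin.sum_univ_four, mink]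
  ext i j
  rw [h]
  simp only [Matrix.add_apply, Matrix.smul_apply, Fin.sum_univ_three, smul_eq_mul]
  fin_cases A <;> fin_cases B <;> simp [sdBasis, levi3, mink] <;> fin_cases i <;>
    fin_cases j <;> norm_num [Matrix.diagonal]

/-- The ε terms contract an antisymmetric matrix with a symmetric one and vanish; the δ term leaves
the trace 4 of the identity, with the sign of the transpose. -/
theorem trace_mul_mink_mul_mink (A B : Fin 3) :
    ((sdBasis A)ᵀ * mink * sdBasis B * mink).trace = if A = B then -4 else 0 := by
  rw [sdBasis_transpose, Matrix.neg_mul, Matrix.neg_mul, Matrix.neg_mul, sdBasis_mul_mink_mul,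
    Matrix.add_mul, Matrix.smul_mul, mink_mul_mink, Matrix.smul_mul, Finset.sum_mul,
    Matrix.trace_neg, Matrix.trace_add, Matrix.trace_smul, Matrix.trace_smul, Matrix.trace_sum]
  have h : ∀ C, (sdBasis C * mink).trace = 0 := fun C ↦ by
    fin_cases C <;> simp [sdBasis, mink, Matrix.trace, Fin.sum_univ_four, Matrix.vecMul_diagonal]
  simp [h]
  split_ifs <;> simp

/-- The Hodge dual in frame components. -/
def hodgeFlat (F : Fin 4 → Fin 4 → ℂ) (a b : Fin 4) : ℂ :=
  (1 / 2) * ∑ c, ∑ d, (levi a b c d : ℂ) * mink c c * mink d d * F c d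

theorem hodgeFlat_explicit (F : Matrix (Fin 4) (Fin 4) ℂ) (hF : Fᵀ = -F) :
    Matrix.of (hodgeFlat F) = !![0, F 2 3, F 3 1, F 1 2; -F 2 3, 0, -F 0 3, F 0 2;
      -F 3 1, F 0 3, 0, -F 0 1; -F 1 2, -F 0 2, F 0 1, 0] := by
  have h : ∀ i j, F j i = -F i j := fun i j ↦ by
    simpa using congrFun (congrFun hF i) j
  have h' : ∀ i, F i i = 0 := fun i ↦ self_eq_neg.mp (h i i)
  ext i j
  simp only [Matrix.of_apply, hodgeFlat, Fin.sum_univ_four]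
  rw [h 0 1, h 0 2, h 0 3, h 1 2, h 1 3, h 2 3, h', h', h', h']
  fin_cases i <;> fin_cases j <;> norm_num [levi, mink] <;> ring_nf <;> simp

end

/-! ### Contractions and the matrix algebra of self-dual double bivectors -/

section

open Matrix

/-- The contraction `(1/2) F_{kl} G^{km} G^{ln} K_{mn}`. -/
def pairing (G F K : Matrix (Fin 4) (Fin 4) ℂ) : ℂ := (1 / 2) * (Fᵀ * G * K * Gᵀ).trace

theorem pairing_eq_sum (G F K : Matrix (Fin 4) (Fin 4) ℂ) :
    pairing G F K = (1 / 2) * ∑ k, ∑ l, ∑ m, ∑ n, F k l * G k m * G l n * K m n := by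
  simp only [pairing, Matrix.trace, Matrix.mul_apply, Matrix.diag_apply, Matrix.transpose_apply,
    Finset.sum_mul]
  congr 1
  rw [Finset.sum_comm' (s := Finset.univ) (t := fun _ ↦ Finset.univ) (t' := Finset.univ)
    (s' := fun _ ↦ Finset.univ) (by simp)]
  calc _ = ∑ l, ∑ n, ∑ m, ∑ k, F k l * G k m * K m n * G l n := by
        rw [Finset.sum_comm]
    _ = ∑ l, ∑ m, ∑ n, ∑ k, F k l * G k m * K m n * G l n :=
        Finset.sum_congr rfl fun l _ ↦ Finset.sum_comm
    _ = ∑ l, ∑ m, ∑ k, ∑ n, F k l * G k m * K m n * G l n :=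
        Finset.sum_congr rfl fun l _ ↦ Finset.sum_congr rfl fun m _ ↦ Finset.sum_comm
    _ = ∑ l, ∑ k, ∑ m, ∑ n, F k l * G k m * K m n * G l n :=
        Finset.sum_congr rfl fun l _ ↦ Finset.sum_comm
    _ = ∑ k, ∑ l, ∑ m, ∑ n, F k l * G k m * K m n * G l n := Finset.sum_comm
    _ = _ := by
        refine Finset.sum_congr rfl fun k _ ↦ Finset.sum_congr rfl fun l _ ↦
          Finset.sum_congr rfl fun m _ ↦ Finset.sum_congr rfl fun n _ ↦ by ring

/-- Cyclicity of the trace moves `T` onto the metric. With `T` a dual basis and `G` the inverse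
metric, `D` is the Minkowski matrix and coordinate contractions become frame contractions. -/
theorem pairing_congr {G D T : Matrix (Fin 4) (Fin 4) ℂ} (h : T * G * Tᵀ = D)
    (F K : Matrix (Fin 4) (Fin 4) ℂ) :
    pairing G (Tᵀ * F * T) (Tᵀ * K * T) = pairing D F K := by
  have h' : T * Gᵀ * Tᵀ = Dᵀ := by rw [← h]; simp [Matrix.mul_assoc]
  rw [pairing, pairing, ← h', ← h]
  simp only [Matrix.transpose_mul, Matrix.transpose_transpose, Matrix.mul_assoc]
  rw [Matrix.trace_mul_comm]
  simp only [Matrix.mul_assoc]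

theorem pairing_sum_left {ι : Type*} (s : Finset ι) (G : Matrix (Fin 4) (Fin 4) ℂ) (x : ι → ℂ)
    (F : ι → Matrix (Fin 4) (Fin 4) ℂ) (K : Matrix (Fin 4) (Fin 4) ℂ) :
    pairing G (∑ i ∈ s, x i • F i) K = ∑ i ∈ s, x i * pairing G (F i) K := by
  simp only [pairing, Matrix.transpose_sum, Matrix.transpose_smul, Finset.sum_mul,
    Matrix.smul_mul, Matrix.trace_sum, Matrix.trace_smul, Finset.mul_sum, smul_eq_mul]
  exact Finset.sum_congr rfl fun i _ ↦ by ring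

theorem pairing_sum_right {ι : Type*} (s : Finset ι) (G : Matrix (Fin 4) (Fin 4) ℂ) (x : ι → ℂ)
    (F : Matrix (Fin 4) (Fin 4) ℂ) (K : ι → Matrix (Fin 4) (Fin 4) ℂ) :
    pairing G F (∑ i ∈ s, x i • K i) = ∑ i ∈ s, x i * pairing G F (K i) := by
  simp only [pairing, Finset.mul_sum, Finset.sum_mul, Matrix.mul_smul,
    Matrix.smul_mul, Matrix.trace_sum, Matrix.trace_smul, smul_eq_mul]
  exact Finset.sum_congr rfl fun i _ ↦ by ring

theorem pairing_mink (F K : Matrix (Fin 4) (Fin 4) ℂ) :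
    pairing mink F K = (1 / 2) * ∑ c, ∑ d, F c d * mink c c * mink d d * K c d := by
  rw [pairing_eq_sum]
  simp [mink, Matrix.diagonal_apply, Finset.sum_ite_eq]

/-- The self-dual bivector (times `√2`) with frame components `sdBasis A`, in coordinates. -/
def sdBiv (T : Matrix (Fin 4) (Fin 4) ℂ) (A : Fin 3) : Matrix (Fin 4) (Fin 4) ℂ :=
  Tᵀ * sdBasis A * T

theorem sdBiv_transpose (T : Matrix (Fin 4) (Fin 4) ℂ) (A : Fin 3) :
    (sdBiv T A)ᵀ = -sdBiv T A := by
  simp [sdBiv, sdBasis_transpose, Matrix.mul_assoc]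

theorem pairing_sdBiv {G T : Matrix (Fin 4) (Fin 4) ℂ} (h : T * G * Tᵀ = mink) (A B : Fin 3) :
    pairing G (sdBiv T A) (sdBiv T B) = if A = B then -2 else 0 := by
  rw [sdBiv, sdBiv, pairing_congr h, pairing, mink_transpose, trace_mul_mink_mul_mink]
  split_ifs <;> norm_num

theorem sdBiv_mul_mul {G T : Matrix (Fin 4) (Fin 4) ℂ} (h : T * G * Tᵀ = mink) (A B : Fin 3) :
    sdBiv T A * G * sdBiv T B = (if A = B then (1 : ℂ) else 0) • (Tᵀ * mink * T)
      + Complex.I • ∑ C, levi3 A B C • sdBiv T C := by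
  have : sdBiv T A * G * sdBiv T B = Tᵀ * (sdBasis A * mink * sdBasis B) * T := by
    rw [← h]; simp only [sdBiv, Matrix.mul_assoc]
  rw [this, sdBasis_mul_mink_mul]
  simp only [sdBiv, Matrix.mul_add, Matrix.add_mul, Matrix.mul_smul, Matrix.smul_mul,
    Matrix.mul_sum, Matrix.sum_mul]

/-- Linear independence: the basis is orthogonal with nonzero norm -2, so pairing with one member
reads off its coefficient. -/
theorem eq_of_sum_sdBiv {G T : Matrix (Fin 4) (Fin 4) ℂ} (h : T * G * Tᵀ = mink)
    {x y : Fin 3 → ℂ} (hxy : ∑ A, x A • sdBiv T A = ∑ A, y A • sdBiv T A) : x = y := by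
  funext B
  have := congrArg (fun F ↦ pairing G F (sdBiv T B)) hxy
  simpa [pairing_sum_left, pairing_sdBiv h] using this

/-- The double bivector `-(1/2) ∑ Q_{AB} u_A ⊗ u_B`, where `u_A = sdBiv T A`. -/
def dbl (T : Matrix (Fin 4) (Fin 4) ℂ) (Q : Matrix (Fin 3) (Fin 3) ℂ) (i j k l : Fin 4) : ℂ :=
  -(1 / 2) * ∑ A, ∑ B, Q A B * sdBiv T A i j * sdBiv T B k l

theorem dbl_left (T : Matrix (Fin 4) (Fin 4) ℂ) (Q : Matrix (Fin 3) (Fin 3) ℂ) (i j : Fin 4) :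
    Matrix.of (fun k l ↦ dbl T Q i j k l) =
      ∑ B, (-(1 / 2) * ∑ A, Q A B * sdBiv T A i j) • sdBiv T B := by
  ext k l
  simp only [Matrix.of_apply, dbl, Matrix.sum_apply, Matrix.smul_apply, smul_eq_mul, Finset.mul_sum,
    Finset.sum_mul]
  rw [Finset.sum_comm]
  exact Finset.sum_congr rfl fun _ _ ↦ Finset.sum_congr rfl fun _ _ ↦ by ring

theorem dbl_right (T : Matrix (Fin 4) (Fin 4) ℂ) (Q : Matrix (Fin 3) (Fin 3) ℂ) (k l : Fin 4) :
    Matrix.of (fun i j ↦ dbl T Q i j k l) =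
      ∑ A, (-(1 / 2) * ∑ B, Q A B * sdBiv T B k l) • sdBiv T A := by
  ext i j
  simp only [Matrix.of_apply, dbl, Matrix.sum_apply, Matrix.smul_apply, smul_eq_mul, Finset.mul_sum,
    Finset.sum_mul]
  exact Finset.sum_congr rfl fun _ _ ↦ Finset.sum_congr rfl fun _ _ ↦ by ring

section

variable (g : Coord → Matrix (Fin 4) (Fin 4) ℝ) (η : Coord → Fin 4 → Fin 4 → Fin 4 → Fin 4 → ℝ)
  (y : Coord)

theorem hodge_eq_pairing (F : Fin 4 → Fin 4 → ℂ) (i j : Fin 4) : hodge g η y F i j =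
    pairing (Matrix.of (ginv g y)) (Matrix.of fun k l ↦ (η y i j k l : ℂ)) (Matrix.of F) := by
  rw [pairing_eq_sum]; rfl

theorem dblApply_eq_pairing (A : Fin 4 → Fin 4 → Fin 4 → Fin 4 → ℂ) (F : Fin 4 → Fin 4 → ℂ)
    (i j : Fin 4) : dblApply g y A F i j =
    pairing (Matrix.of (ginv g y)) (Matrix.of fun k l ↦ A i j k l) (Matrix.of F) := by
  rw [pairing_eq_sum]; rfl

theorem dblMul_eq_pairing (A B : Fin 4 → Fin 4 → Fin 4 → Fin 4 → ℂ) (i j k l : Fin 4) :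
    dblMul g y A B i j k l = pairing (Matrix.of (ginv g y)) (Matrix.of fun k l ↦ A i j k l)
      (Matrix.of fun p q ↦ B p q k l) := by
  rw [pairing_eq_sum]; rfl

variable {g η y} {T : Matrix (Fin 4) (Fin 4) ℂ}

theorem dblApply_dbl (h : T * Matrix.of (ginv g y) * Tᵀ = mink) (Q : Matrix (Fin 3) (Fin 3) ℂ)
    {F : Fin 4 → Fin 4 → ℂ} {f : Fin 3 → ℂ} (hF : Matrix.of F = ∑ A, f A • sdBiv T A)
    (i j : Fin 4) :
    dblApply g y (dbl T Q) F i j = (∑ A, (Q *ᵥ f) A • sdBiv T A) i j := by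
  rw [dblApply_eq_pairing, dbl_left, pairing_sum_left, hF]
  have : ∀ B, pairing (Matrix.of (ginv g y)) (sdBiv T B) (∑ A, f A • sdBiv T A) = -2 * f B :=
      fun B ↦ by
    rw [pairing_sum_right]; simp [pairing_sdBiv h, mul_comm]
  simp only [this, Matrix.mulVec, dotProduct, Finset.mul_sum, Finset.sum_mul]
  rw [Finset.sum_comm, Matrix.sum_apply]
  simp only [Matrix.smul_apply, smul_eq_mul, Finset.sum_mul]
  exact Finset.sum_congr rfl fun _ _ ↦ Finset.sum_congr rfl fun _ _ ↦ by ring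

/-- The inner pairing contributes -2 and the two prefactors 1/4, which makes -1/2 again: this is the
normalisation of `dbl` that turns products into matrix products. -/
theorem dblMul_dbl (h : T * Matrix.of (ginv g y) * Tᵀ = mink) (Q R : Matrix (Fin 3) (Fin 3) ℂ) :
    dblMul g y (dbl T Q) (dbl T R) = dbl T (Q * R) := by
  ext i j k l
  rw [dblMul_eq_pairing, dbl_left, dbl_right, pairing_sum_left]
  simp only [pairing_sum_right, pairing_sdBiv h]
  simp only [mul_ite, mul_zero, Finset.sum_ite_eq, Finset.mem_univ, if_true, dbl,
    Matrix.mul_apply, Finset.sum_mul, Finset.mul_sum]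
  rw [Finset.sum_comm]
  simp only [Fin.sum_univ_three]
  ring

theorem dblTr_dbl (h : T * Matrix.of (ginv g y) * Tᵀ = mink) (Q : Matrix (Fin 3) (Fin 3) ℂ) :
    dblTr g y (dbl T Q) = Q.trace := by
  have h1 : dblTr g y (dbl T Q) = -(1 / 2) * ∑ A, ∑ B, Q A B *
      pairing (Matrix.of (ginv g y)) (sdBiv T B) (sdBiv T A) := by
    simp only [dblTr, dbl, pairing_eq_sum, Fin.sum_univ_three, Finset.mul_sum,
      ← Finset.sum_add_distrib, Matrix.of_apply]
    exact Finset.sum_congr rfl fun _ _ ↦ Finset.sum_congr rfl fun _ _ ↦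
      Finset.sum_congr rfl fun _ _ ↦ Finset.sum_congr rfl fun _ _ ↦ by ring
  rw [h1]
  simp only [pairing_sdBiv h, Matrix.trace, Fin.sum_univ_three, Matrix.diag_apply]
  simp
  ring

end

end

/-! ### The Weyl tensor in an orthonormal frame as a complex 3 × 3 matrix -/

section

open Matrix

theorem levi_swap (a b c d : Fin 4) : levi b a c d = -levi a b c d := by
  unfold levi; ring

theorem levi_swap_right (a b c d : Fin 4) : levi a b d c = -levi a b c d := by
  unfold levi; ring

/-- The algebraic symmetries of the Weyl tensor in an orthonormal frame. -/
structure IsWeylLike (X : Fin 4 → Fin 4 → Fin 4 → Fin 4 → ℂ) : Prop where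
  anti_left : ∀ a b c d, X b a c d = -X a b c d
  anti_right : ∀ a b c d, X a b d c = -X a b c d
  pair : ∀ a b c d, X c d a b = X a b c d
  bianchi : ∀ a b c d, X a b c d + X a c d b + X a d b c = 0
  trace : ∀ b d, ∑ a, mink a a * X a b a d = 0

/-- The self-dual part of a double bivector in frame components. -/
def sdFlat (X : Fin 4 → Fin 4 → Fin 4 → Fin 4 → ℂ) (a b c d : Fin 4) : ℂ :=
  (1 / 2) * (X a b c d - Complex.I * hodgeFlat (fun m n ↦ X m n c d) a b)

/-- The symmetric matrix of the self-dual Weyl tensor. -/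
def weylMatrix (X : Fin 4 → Fin 4 → Fin 4 → Fin 4 → ℂ) : Matrix (Fin 3) (Fin 3) ℂ :=
  Matrix.of fun A B ↦ -2 * sdFlat X 0 A.succ 0 B.succ

/-- The index pair dual to `0, A.succ`. -/
def dualPair : Fin 3 → Fin 4 × Fin 4 := ![(2, 3), (3, 1), (1, 2)]

theorem eq_of_anti_of_eq {X Y : Fin 4 → Fin 4 → ℂ} (hX : ∀ a b, X b a = -X a b)
    (hY : ∀ a b, Y b a = -Y a b) (h0 : ∀ A : Fin 3, X 0 A.succ = Y 0 A.succ)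
    (h1 : ∀ A : Fin 3, X (dualPair A).1 (dualPair A).2 = Y (dualPair A).1 (dualPair A).2) :
    X = Y := by
  have hX' : ∀ i, X i i = 0 := fun i ↦ self_eq_neg.mp (hX i i)
  have hY' : ∀ i, Y i i = 0 := fun i ↦ self_eq_neg.mp (hY i i)
  have a1 : X 0 1 = Y 0 1 := h0 0
  have a2 : X 0 2 = Y 0 2 := h0 1
  have a3 : X 0 3 = Y 0 3 := h0 2
  have b1 : X 2 3 = Y 2 3 := h1 0
  have b2 : X 3 1 = Y 3 1 := h1 1
  have b3 : X 1 2 = Y 1 2 := h1 2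
  have c1 : X 1 0 = Y 1 0 := by rw [hX 0 1, hY 0 1, a1]
  have c2 : X 2 0 = Y 2 0 := by rw [hX 0 2, hY 0 2, a2]
  have c3 : X 3 0 = Y 3 0 := by rw [hX 0 3, hY 0 3, a3]
  have d1 : X 3 2 = Y 3 2 := by rw [hX 2 3, hY 2 3, b1]
  have d2 : X 1 3 = Y 1 3 := by rw [hX 3 1, hY 3 1, b2]
  have d3 : X 2 1 = Y 2 1 := by rw [hX 1 2, hY 1 2, b3]
  ext a b
  fin_cases a <;> fin_cases b <;> first | assumption | exact (hX' _).trans (hY' _).symm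

theorem sdBasis_time (A B : Fin 3) : sdBasis A 0 B.succ = if A = B then -1 else 0 := by
  fin_cases A <;> fin_cases B <;> simp [sdBasis]

theorem sdBasis_space (A B : Fin 3) : sdBasis A (dualPair B).1 (dualPair B).2 =
    if A = B then -Complex.I else 0 := by
  fin_cases A <;> fin_cases B <;> simp [sdBasis, dualPair]

/-- Self-duality says that magnetic components are i times electric ones. When it holds in both
index pairs, the nine components (0A)(0B) determine everything; the -2 undoes the -1/2 of `dbl`, the
electric entries of `sdBasis` being -1. -/
theorem eq_dbl_one {Y : Fin 4 → Fin 4 → Fin 4 → Fin 4 → ℂ} {Q : Matrix (Fin 3) (Fin 3) ℂ}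
    (hl : ∀ a b c d, Y b a c d = -Y a b c d) (hr : ∀ a b c d, Y a b d c = -Y a b c d)
    (hl1 : ∀ (A : Fin 3) c d, Y (dualPair A).1 (dualPair A).2 c d = Complex.I * Y 0 A.succ c d)
    (hr1 : ∀ A B : Fin 3, Y 0 A.succ (dualPair B).1 (dualPair B).2 =
      Complex.I * Y 0 A.succ 0 B.succ)
    (hQ : ∀ A B, Q A B = -2 * Y 0 A.succ 0 B.succ) : Y = dbl 1 Q := by
  have hs : ∀ A i j, sdBiv 1 A j i = -sdBiv 1 A i j := fun A i j ↦
    congrFun (congrFun (sdBiv_transpose 1 A) i) j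
  have s0 : ∀ A B : Fin 3, sdBiv 1 A 0 B.succ = if A = B then -1 else 0 := fun A B ↦ by
    rw [← sdBasis_time]; simp [sdBiv]
  have s1 : ∀ A B : Fin 3, sdBiv 1 A (dualPair B).1 (dualPair B).2 =
      Complex.I * sdBiv 1 A 0 B.succ := fun A B ↦ by
    rw [s0]; simp [sdBiv, sdBasis_space]
  have dl : ∀ a b c d, dbl 1 Q b a c d = -dbl 1 Q a b c d := fun a b c d ↦ by
    simp only [dbl, hs _ a b, mul_neg, neg_mul, Finset.sum_neg_distrib]
  have dr : ∀ a b c d, dbl 1 Q a b d c = -dbl 1 Q a b c d := fun a b c d ↦ by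
    simp only [dbl, hs _ c d, mul_neg, Finset.sum_neg_distrib]
  have dl1 : ∀ (A : Fin 3) c d, dbl 1 Q (dualPair A).1 (dualPair A).2 c d =
      Complex.I * dbl 1 Q 0 A.succ c d := fun A c d ↦ by
    simp only [dbl, s1, Finset.mul_sum]
    exact Finset.sum_congr rfl fun _ _ ↦ Finset.sum_congr rfl fun _ _ ↦ by ring
  have dr1 : ∀ (A : Fin 3) a b, dbl 1 Q a b (dualPair A).1 (dualPair A).2 =
      Complex.I * dbl 1 Q a b 0 A.succ := fun A a b ↦ by
    simp only [dbl, s1, Finset.mul_sum]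
    exact Finset.sum_congr rfl fun _ _ ↦ Finset.sum_congr rfl fun _ _ ↦ by ring
  have t0 : ∀ A B : Fin 3, Y 0 A.succ 0 B.succ = dbl 1 Q 0 A.succ 0 B.succ := fun A B ↦ by
    simp [dbl, s0, hQ]
  have t1 : ∀ (A : Fin 3) c d, Y 0 A.succ c d = dbl 1 Q 0 A.succ c d := fun A c d ↦
    congrFun (congrFun (eq_of_anti_of_eq (hr 0 A.succ) (dr 0 A.succ) (t0 A)
      fun B ↦ by rw [hr1, dr1, t0]) c) d
  ext a b c d
  exact congrFun (congrFun (eq_of_anti_of_eq (X := fun a b ↦ Y a b c d)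
    (Y := fun a b ↦ dbl 1 Q a b c d) (hl · · c d) (dl · · c d)
    (fun A ↦ t1 A c d) fun A ↦ by rw [hl1, dl1, t1]) a) b

namespace IsWeylLike

variable {X : Fin 4 → Fin 4 → Fin 4 → Fin 4 → ℂ} (hX : IsWeylLike X)
include hX

theorem anti_matrix (c d : Fin 4) :
    (Matrix.of fun m n ↦ X m n c d)ᵀ = -(Matrix.of fun m n ↦ X m n c d) := by
  ext a b; exact hX.anti_left a b c d

theorem hodge_time (c d : Fin 4) (A : Fin 3) : hodgeFlat (fun m n ↦ X m n c d) 0 A.succ =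
    X (dualPair A).1 (dualPair A).2 c d := by
  have := congrFun (congrFun (hodgeFlat_explicit _ (hX.anti_matrix c d)) 0) A.succ
  refine this.trans ?_
  fin_cases A <;> simp [dualPair]

theorem hodge_space (c d : Fin 4) (A : Fin 3) :
    hodgeFlat (fun m n ↦ X m n c d) (dualPair A).1 (dualPair A).2 = -X 0 A.succ c d := by
  have := congrFun (congrFun (hodgeFlat_explicit _ (hX.anti_matrix c d)) (dualPair A).1)
    (dualPair A).2
  refine this.trans ?_
  fin_cases A <;> simp [dualPair]

theorem trace' (b d : Fin 4) : X 1 b 1 d + X 2 b 2 d + X 3 b 3 d = X 0 b 0 d := by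
  have := hX.trace b d
  simp [Fin.sum_univ_four, mink] at this
  linear_combination this

/-- The three mixed time-space components of the trace condition are exactly the three symmetry
relations of the magnetic part. -/
theorem magnetic_symm (A B : Fin 3) : X 0 A.succ (dualPair B).1 (dualPair B).2 =
    X 0 B.succ (dualPair A).1 (dualPair A).2 := by
  have h := hX.trace'
  have h1 := hX.anti_left
  have h2 := hX.anti_right
  have h3 : ∀ a c d, X a a c d = 0 := fun a c d ↦ self_eq_neg.mp (h1 a a c d)
  have h4 : ∀ a c d, X c d a a = 0 := fun a c d ↦ self_eq_neg.mp (h2 c d a a)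
  have k1 : X 0 1 3 1 = X 0 2 2 3 := by
    have := h 0 3
    rw [h3 0, h1 0 1, h1 0 2, h1 0 3, h4 3, h2 0 1 3 1] at this
    linear_combination this
  have k2 : X 0 1 1 2 = X 0 3 2 3 := by
    have := h 0 2
    rw [h3 0, h1 0 1, h1 0 2, h1 0 3, h4 2, h2 0 3 2 3] at this
    linear_combination -this
  have k3 : X 0 2 1 2 = X 0 3 3 1 := by
    have := h 0 1
    rw [h3 0, h1 0 1, h1 0 2, h1 0 3, h4 1, h2 0 2 1 2] at this
    linear_combination this
  fin_cases A <;> fin_cases B <;> simp [dualPair] <;> first | assumption | exact Eq.symm ‹_›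

/-- In three space dimensions a curvature-like tensor is determined by its trace, and the trace
condition identifies the spatial trace with the electric part. With `magnetic_symm`, this makes the
left and right Hodge duals agree. -/
theorem space_eq (A B : Fin 3) : X (dualPair A).1 (dualPair A).2 (dualPair B).1 (dualPair B).2 =
    -X 0 A.succ 0 B.succ := by
  have h := hX.trace'
  have h1 := hX.anti_left
  have h2 := hX.anti_right
  have hp := hX.pair
  have h3 : ∀ a c d, X a a c d = 0 := fun a c d ↦ self_eq_neg.mp (h1 a a c d)
  have h4 : ∀ a c d, X c d a a = 0 := fun a c d ↦ self_eq_neg.mp (h2 c d a a)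
  have e1 := h 1 1
  have e2 := h 2 2
  have e3 := h 3 3
  have e12 := h 1 2
  have e13 := h 1 3
  have e23 := h 2 3
  have e0 := h 0 0
  rw [h3 0, h1 0 1, h1 0 2, h1 0 3, h2 0 1 0 1, h2 0 2 0 2, h2 0 3 0 3] at e0
  rw [h3 1, h1 1 2, h2 1 2 1 2] at e1
  rw [h3 2, h1 2 3, h2 2 3 2 3] at e2
  rw [h3 3, h1 3 1, h2 3 1 3 1] at e3
  rw [h3 1, h4 2] at e12
  rw [h3 1, h4 3, h1 1 2] at e13
  rw [h3 2, h4 3, h2 1 2 3 1] at e23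
  have k11 : X 2 3 2 3 = -X 0 1 0 1 := by linear_combination (e0 - e1 + e2 + e3) / 2
  have k22 : X 3 1 3 1 = -X 0 2 0 2 := by linear_combination (e0 + e1 - e2 + e3) / 2
  have k33 : X 1 2 1 2 = -X 0 3 0 3 := by linear_combination (e0 + e1 + e2 - e3) / 2
  have k12 : X 2 3 3 1 = -X 0 1 0 2 := by
    rw [hp 3 1 2 3, h2 3 1 3 2]; linear_combination -e12
  have k13 : X 2 3 1 2 = -X 0 1 0 3 := by
    rw [hp 1 2 2 3]; linear_combination -e13
  have k23 : X 3 1 1 2 = -X 0 2 0 3 := by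
    rw [hp 1 2 3 1]; linear_combination -e23
  have k21 : X 3 1 2 3 = -X 0 2 0 1 := by rw [hp, k12, hp]
  have k31 : X 1 2 2 3 = -X 0 3 0 1 := by rw [hp, k13, hp]
  have k32 : X 1 2 3 1 = -X 0 3 0 2 := by rw [hp, k23, hp]
  fin_cases A <;> fin_cases B <;> simp [dualPair] <;> assumption

theorem trace_electric : X 0 1 0 1 + X 0 2 0 2 + X 0 3 0 3 = 0 := by
  have h1 := hX.anti_left
  have h2 := hX.anti_right
  have e0 := hX.trace' 0 0
  rw [h1 0 0, h1 0 1, h1 0 2, h1 0 3, h2 0 1 0 1, h2 0 2 0 2, h2 0 3 0 3] at e0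
  have : X 0 0 0 0 = 0 := self_eq_neg.mp (h1 0 0 0 0)
  linear_combination e0 - this

theorem weylMatrix_apply (A B : Fin 3) : weylMatrix X A B =
    -X 0 A.succ 0 B.succ + Complex.I * X 0 A.succ (dualPair B).1 (dualPair B).2 := by
  rw [hX.magnetic_symm A B, hX.pair (dualPair A).1 (dualPair A).2 0 B.succ]
  simp only [weylMatrix, sdFlat, Matrix.of_apply, hX.hodge_time]
  ring

theorem weylMatrix_symm : (weylMatrix X)ᵀ = weylMatrix X := by
  ext A B
  rw [Matrix.transpose_apply, hX.weylMatrix_apply, hX.weylMatrix_apply, hX.magnetic_symm,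
    hX.pair]

/-- The electric part is traceless by the time-time trace condition, the magnetic part by the first
Bianchi identity. -/
theorem weylMatrix_trace : (weylMatrix X).trace = 0 := by
  have h := hX.trace_electric
  have hb := hX.bianchi 0 1 2 3
  simp only [Matrix.trace, Matrix.diag_apply, hX.weylMatrix_apply, Fin.sum_univ_three]
  simp [dualPair]
  linear_combination -h + Complex.I * hb

theorem sdFlat_anti_left (a b c d : Fin 4) : sdFlat X b a c d = -sdFlat X a b c d := by
  have h : hodgeFlat (fun m n ↦ X m n c d) b a = -hodgeFlat (fun m n ↦ X m n c d) a b := by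
    rw [hodgeFlat, hodgeFlat, ← mul_neg, ← Finset.sum_neg_distrib]
    refine congrArg _ (Finset.sum_congr rfl fun m _ ↦ ?_)
    rw [← Finset.sum_neg_distrib]
    refine Finset.sum_congr rfl fun n _ ↦ ?_
    rw [levi_swap a b, Complex.ofReal_neg]; ring
  rw [sdFlat, sdFlat, h, hX.anti_left a b c d]; ring

theorem sdFlat_anti_right (a b c d : Fin 4) : sdFlat X a b d c = -sdFlat X a b c d := by
  have h : hodgeFlat (fun m n ↦ X m n d c) a b = -hodgeFlat (fun m n ↦ X m n c d) a b := by
    rw [hodgeFlat, hodgeFlat, ← mul_neg, ← Finset.sum_neg_distrib]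
    refine congrArg _ (Finset.sum_congr rfl fun m _ ↦ ?_)
    rw [← Finset.sum_neg_distrib]
    refine Finset.sum_congr rfl fun n _ ↦ ?_
    rw [hX.anti_right]; ring
  rw [sdFlat, sdFlat, h, hX.anti_right a b c d]; ring

theorem sdFlat_space (A : Fin 3) (c d : Fin 4) :
    sdFlat X (dualPair A).1 (dualPair A).2 c d = Complex.I * sdFlat X 0 A.succ c d := by
  rw [sdFlat, sdFlat, hX.hodge_time, hX.hodge_space]
  linear_combination (1 / 2) * X (dualPair A).1 (dualPair A).2 c d * Complex.I_sq

/-- Self-duality in the second index pair, although only the first was projected: it comes from the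
trace condition through `space_eq` and `magnetic_symm`. -/
theorem sdFlat_time_space (A B : Fin 3) : sdFlat X 0 A.succ (dualPair B).1 (dualPair B).2 =
    Complex.I * sdFlat X 0 A.succ 0 B.succ := by
  have h : sdFlat X 0 A.succ 0 B.succ = -(1 / 2) * weylMatrix X A B := by
    rw [weylMatrix, Matrix.of_apply]; ring
  rw [h, hX.weylMatrix_apply, sdFlat, hX.hodge_time, hX.space_eq]
  linear_combination (1 / 2) * X 0 A.succ (dualPair B).1 (dualPair B).2 * Complex.I_sq

theorem sdFlat_eq : sdFlat X = dbl 1 (weylMatrix X) :=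
  eq_dbl_one hX.sdFlat_anti_left hX.sdFlat_anti_right hX.sdFlat_space hX.sdFlat_time_space
    fun A B ↦ by rw [weylMatrix, Matrix.of_apply]

end IsWeylLike

end

section

open Matrix

/-! ### Change of frame -/

/-- The components of a tensor of rank four after a linear change of frame. -/
def pull4 (T : Matrix (Fin 4) (Fin 4) ℂ) (X : Fin 4 → Fin 4 → Fin 4 → Fin 4 → ℂ)
    (i j k l : Fin 4) : ℂ :=
  ∑ a, ∑ b, ∑ c, ∑ d, T a i * T b j * T c k * T d l * X a b c d

theorem sandwich_apply (T F : Matrix (Fin 4) (Fin 4) ℂ) (i j : Fin 4) :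
    (Tᵀ * F * T) i j = ∑ a, ∑ b, T a i * T b j * F a b := by
  simp only [Matrix.mul_apply, Matrix.transpose_apply, Finset.sum_mul]
  rw [Finset.sum_comm]
  exact Finset.sum_congr rfl fun _ _ ↦ Finset.sum_congr rfl fun _ _ ↦ by ring

section pull4

variable (T : Matrix (Fin 4) (Fin 4) ℂ) (X : Fin 4 → Fin 4 → Fin 4 → Fin 4 → ℂ)

theorem pull4_eq_right (i j k l : Fin 4) : pull4 T X i j k l =
    ∑ a, ∑ b, T a i * T b j * (Tᵀ * Matrix.of (X a b) * T) k l := by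
  simp only [sandwich_apply, pull4, Finset.mul_sum, Matrix.of_apply]
  exact Finset.sum_congr rfl fun _ _ ↦ Finset.sum_congr rfl fun _ _ ↦
    Finset.sum_congr rfl fun _ _ ↦ Finset.sum_congr rfl fun _ _ ↦ by ring

theorem pull4_eq_sandwich (i j k l : Fin 4) : pull4 T X i j k l =
    (Tᵀ * Matrix.of (fun a b ↦ (Tᵀ * Matrix.of (X a b) * T) k l) * T) i j := by
  rw [pull4_eq_right, sandwich_apply]; rfl

/-- Each index pair transforms by a matrix congruence, so the two changes of frame cancel on one
pair after the other. -/
theorem pull4_pull4 (S : Matrix (Fin 4) (Fin 4) ℂ) (h : S * T = 1) :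
    pull4 T (pull4 S X) = X := by
  have hs : ∀ F : Matrix (Fin 4) (Fin 4) ℂ, Tᵀ * (Sᵀ * F * S) * T = F := fun F ↦ by
    have h' : Tᵀ * Sᵀ = 1 := by rw [← Matrix.transpose_mul, h, Matrix.transpose_one]
    calc Tᵀ * (Sᵀ * F * S) * T = (Tᵀ * Sᵀ) * F * (S * T) := by simp only [Matrix.mul_assoc]
      _ = F := by rw [h, h', Matrix.one_mul, Matrix.mul_one]
  have h1 : ∀ a b, Matrix.of (pull4 S X a b) =
      Sᵀ * (∑ a', ∑ b', (S a' a * S b' b) • Matrix.of (X a' b')) * S := fun a b ↦ by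
    ext k l
    rw [Matrix.of_apply, pull4_eq_right]
    simp only [Matrix.mul_sum, Matrix.sum_mul, Matrix.sum_apply, Matrix.mul_smul,
      Matrix.smul_mul, Matrix.smul_apply, smul_eq_mul]
  ext i j k l
  rw [pull4_eq_sandwich]
  simp only [h1, hs]
  have h2 : (Matrix.of fun a b ↦ (∑ a', ∑ b', (S a' a * S b' b) • Matrix.of (X a' b')) k l) =
      Sᵀ * (Matrix.of fun a b ↦ X a b k l) * S := by
    ext a b
    rw [sandwich_apply]
    simp only [Matrix.of_apply, Matrix.sum_apply, Matrix.smul_apply, smul_eq_mul]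
  rw [h2, hs]; rfl

theorem pull4_anti_left (h : ∀ a b c d, X b a c d = -X a b c d) (i j k l : Fin 4) :
    pull4 T X j i k l = -pull4 T X i j k l := by
  simp only [pull4, ← Finset.sum_neg_distrib]
  rw [Finset.sum_comm]
  exact Finset.sum_congr rfl fun _ _ ↦ Finset.sum_congr rfl fun _ _ ↦
    Finset.sum_congr rfl fun _ _ ↦ Finset.sum_congr rfl fun _ _ ↦ by rw [h]; ring

theorem pull4_pair (h : ∀ a b c d, X c d a b = X a b c d) (i j k l : Fin 4) :
    pull4 T X k l i j = pull4 T X i j k l := by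
  have hX : ∀ c d, Matrix.of (fun a b ↦ X a b c d) = Matrix.of (X c d) := fun c d ↦ by
    ext a b; exact h c d a b
  have : pull4 T X i j k l = ∑ c, ∑ d, T c k * T d l *
      (Tᵀ * Matrix.of (fun a b ↦ X a b c d) * T) i j := by
    simp only [sandwich_apply, pull4, Finset.mul_sum, Matrix.of_apply]
    calc _ = ∑ a, ∑ c, ∑ b, ∑ d, T a i * T b j * T c k * T d l * X a b c d :=
          Finset.sum_congr rfl fun _ _ ↦ Finset.sum_comm
      _ = ∑ c, ∑ a, ∑ b, ∑ d, T a i * T b j * T c k * T d l * X a b c d := Finset.sum_comm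
      _ = ∑ c, ∑ a, ∑ d, ∑ b, T a i * T b j * T c k * T d l * X a b c d :=
          Finset.sum_congr rfl fun _ _ ↦ Finset.sum_congr rfl fun _ _ ↦ Finset.sum_comm
      _ = ∑ c, ∑ d, ∑ a, ∑ b, T a i * T b j * T c k * T d l * X a b c d :=
          Finset.sum_congr rfl fun _ _ ↦ Finset.sum_comm
      _ = _ := Finset.sum_congr rfl fun _ _ ↦ Finset.sum_congr rfl fun _ _ ↦
          Finset.sum_congr rfl fun _ _ ↦ Finset.sum_congr rfl fun _ _ ↦ by ring
  rw [this, pull4_eq_right]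
  simp only [hX]

theorem pull4_anti_right (h : ∀ a b c d, X a b d c = -X a b c d) (i j k l : Fin 4) :
    pull4 T X i j l k = -pull4 T X i j k l := by
  have hX : ∀ a b, (Matrix.of (X a b))ᵀ = -Matrix.of (X a b) := fun a b ↦ by
    ext c d; exact h a b c d
  simp only [pull4_eq_right, ← Finset.sum_neg_distrib]
  refine Finset.sum_congr rfl fun a _ ↦ Finset.sum_congr rfl fun b _ ↦ ?_
  rw [← mul_neg]
  congr 1
  have : (Tᵀ * Matrix.of (X a b) * T)ᵀ = -(Tᵀ * Matrix.of (X a b) * T) := by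
    rw [Matrix.transpose_mul, Matrix.transpose_mul, hX, Matrix.transpose_transpose,
      Matrix.neg_mul, Matrix.mul_neg, Matrix.mul_assoc]
  exact congrFun (congrFun this k) l

theorem pull4_bianchi (h : ∀ a b c d, X a b c d + X a c d b + X a d b c = 0) (i j k l : Fin 4) :
    pull4 T X i j k l + pull4 T X i k l j + pull4 T X i l j k = 0 := by
  have h1 : pull4 T X i k l j =
      ∑ a, ∑ b, ∑ c, ∑ d, T a i * T b j * T c k * T d l * X a c d b := by
    refine Finset.sum_congr rfl fun a _ ↦ ?_
    calc _ = ∑ c, ∑ b, ∑ d, T a i * T c k * T d l * T b j * X a c d b :=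
          Finset.sum_congr rfl fun _ _ ↦ Finset.sum_comm
      _ = ∑ b, ∑ c, ∑ d, T a i * T c k * T d l * T b j * X a c d b := Finset.sum_comm
      _ = _ := Finset.sum_congr rfl fun _ _ ↦ Finset.sum_congr rfl fun _ _ ↦
          Finset.sum_congr rfl fun _ _ ↦ by ring
  have h2 : pull4 T X i l j k =
      ∑ a, ∑ b, ∑ c, ∑ d, T a i * T b j * T c k * T d l * X a d b c := by
    refine Finset.sum_congr rfl fun a _ ↦ ?_
    calc _ = ∑ b, ∑ d, ∑ c, T a i * T d l * T b j * T c k * X a d b c := Finset.sum_comm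
      _ = ∑ b, ∑ c, ∑ d, T a i * T d l * T b j * T c k * X a d b c :=
          Finset.sum_congr rfl fun _ _ ↦ Finset.sum_comm
      _ = _ := Finset.sum_congr rfl fun _ _ ↦ Finset.sum_congr rfl fun _ _ ↦
          Finset.sum_congr rfl fun _ _ ↦ by ring
  rw [h1, h2, pull4]
  simp only [← Finset.sum_add_distrib]
  refine Finset.sum_eq_zero fun a _ ↦ Finset.sum_eq_zero fun b _ ↦ Finset.sum_eq_zero fun c _ ↦
    Finset.sum_eq_zero fun d _ ↦ ?_
  linear_combination (T a i * T b j * T c k * T d l) * h a b c d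

theorem pull4_trace {G : Matrix (Fin 4) (Fin 4) ℂ} (hG : T * mink * Tᵀ = G)
    (h : ∀ b d, ∑ a, ∑ c, G a c * X a b c d = 0) (j l : Fin 4) :
    ∑ i, mink i i * pull4 T X i j i l = 0 := by
  have hG' : ∀ a c, G a c = ∑ i, mink i i * T a i * T c i := fun a c ↦ by
    rw [← hG]
    simp only [Matrix.mul_apply, mink, Matrix.transpose_apply, Matrix.diagonal_apply, mul_ite,
      mul_zero, Finset.sum_ite_eq', Finset.mem_univ, if_true]
    exact Finset.sum_congr rfl fun _ _ ↦ by ring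
  calc _ = ∑ i, ∑ a, ∑ b, ∑ c, ∑ d, (mink i i * T a i * T c i) * (T b j * T d l * X a b c d) := by
        refine Finset.sum_congr rfl fun i _ ↦ ?_
        simp only [pull4, Finset.mul_sum]
        exact Finset.sum_congr rfl fun _ _ ↦ Finset.sum_congr rfl fun _ _ ↦
          Finset.sum_congr rfl fun _ _ ↦ Finset.sum_congr rfl fun _ _ ↦ by ring
    _ = ∑ a, ∑ b, ∑ c, ∑ d, G a c * (T b j * T d l * X a b c d) := by
        rw [Finset.sum_comm]
        refine Finset.sum_congr rfl fun a _ ↦ ?_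
        rw [Finset.sum_comm]
        refine Finset.sum_congr rfl fun b _ ↦ ?_
        rw [Finset.sum_comm]
        refine Finset.sum_congr rfl fun c _ ↦ ?_
        rw [Finset.sum_comm]
        refine Finset.sum_congr rfl fun d _ ↦ ?_
        rw [hG', Finset.sum_mul]
    _ = ∑ b, ∑ d, T b j * T d l * ∑ a, ∑ c, G a c * X a b c d := by
        rw [Finset.sum_comm]
        refine Finset.sum_congr rfl fun b _ ↦ ?_
        simp only [Finset.mul_sum]
        rw [Finset.sum_comm' (s' := fun _ ↦ Finset.univ) (t' := Finset.univ) (by simp)]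
        calc _ = ∑ c, ∑ d, ∑ a, G a c * (T b j * T d l * X a b c d) :=
              Finset.sum_congr rfl fun _ _ ↦ Finset.sum_comm
          _ = ∑ d, ∑ c, ∑ a, G a c * (T b j * T d l * X a b c d) := Finset.sum_comm
          _ = ∑ d, ∑ a, ∑ c, G a c * (T b j * T d l * X a b c d) :=
              Finset.sum_congr rfl fun _ _ ↦ Finset.sum_comm
          _ = _ := Finset.sum_congr rfl fun _ _ ↦ Finset.sum_congr rfl fun _ _ ↦
              Finset.sum_congr rfl fun _ _ ↦ by ring
    _ = 0 := by simp [h]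

/-- The matrix `Q` survives the passage from frame components to coordinates; only the basis
bivectors change. -/
theorem pull4_dbl_one (Q : Matrix (Fin 3) (Fin 3) ℂ) : pull4 T (dbl 1 Q) = dbl T Q := by
  ext i j k l
  have h1 : ∀ k l, (Matrix.of fun a b ↦ (Tᵀ * Matrix.of (dbl 1 Q a b) * T) k l) =
      ∑ A, (-(1 / 2) * ∑ B, Q A B * sdBiv T B k l) • sdBasis A := fun k l ↦ by
    ext a b
    have : Matrix.of (dbl 1 Q a b) = _ := dbl_left 1 Q a b
    rw [Matrix.of_apply, this, Matrix.mul_sum, Matrix.sum_mul, Matrix.sum_apply, Matrix.sum_apply]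
    simp only [Matrix.mul_smul, Matrix.smul_mul, Matrix.smul_apply, smul_eq_mul, sdBiv,
      Matrix.transpose_one, Matrix.one_mul, Matrix.mul_one, Finset.mul_sum, Finset.sum_mul]
    rw [Finset.sum_comm]
    exact Finset.sum_congr rfl fun _ _ ↦ Finset.sum_congr rfl fun _ _ ↦ by ring
  rw [pull4_eq_sandwich, h1]
  have h2 := congrFun (congrFun (dbl_right T Q k l) i) j
  rw [Matrix.of_apply] at h2
  rw [h2]
  simp only [Matrix.mul_sum, Matrix.sum_mul, Matrix.mul_smul, Matrix.smul_mul, sdBiv]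

theorem pull4_mul (F K : Matrix (Fin 4) (Fin 4) ℂ) (i j k l : Fin 4) :
    pull4 T (fun a b c d ↦ F a c * K b d) i j k l = (Tᵀ * F * T) i k * (Tᵀ * K * T) j l := by
  rw [sandwich_apply, sandwich_apply, Finset.sum_mul_sum]
  simp only [Finset.sum_mul_sum, pull4]
  exact Finset.sum_congr rfl fun _ _ ↦ Finset.sum_congr rfl fun _ _ ↦
    Finset.sum_congr rfl fun _ _ ↦ Finset.sum_congr rfl fun _ _ ↦ by ring

theorem pull4_mul' (F K : Matrix (Fin 4) (Fin 4) ℂ) (i j k l : Fin 4) :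
    pull4 T (fun a b c d ↦ F a d * K b c) i j k l = (Tᵀ * F * T) i l * (Tᵀ * K * T) j k := by
  rw [← pull4_mul]
  refine Finset.sum_congr rfl fun _ _ ↦ Finset.sum_congr rfl fun _ _ ↦ ?_
  rw [Finset.sum_comm]
  exact Finset.sum_congr rfl fun _ _ ↦ Finset.sum_congr rfl fun _ _ ↦ by ring

end pull4

end

/-! ### Oriented orthonormal frames and their dual bases -/

section

open Matrix

/-- `E` is an oriented orthonormal frame, `E a i` being the component `e_a^i`. -/
structure IsOrientedFrame (g : Matrix (Fin 4) (Fin 4) ℝ) (η : Fin 4 → Fin 4 → Fin 4 → Fin 4 → ℝ)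
    (E : Matrix (Fin 4) (Fin 4) ℝ) : Prop where
  orthonormal : E * g * Eᵀ = Matrix.of minkowski
  volume : ∃ v, (∀ i j k l, η i j k l = v * levi i j k l) ∧ v * E.det = 1

/-- The dual basis of a frame, with complex coefficients. -/
def dualBasis (E : Matrix (Fin 4) (Fin 4) ℝ) : Matrix (Fin 4) (Fin 4) ℂ :=
  (E⁻¹)ᵀ.map Complex.ofRealHom

theorem map_minkowski : (Matrix.of minkowski).map Complex.ofRealHom = mink := by
  ext a b; exact (mink_apply a b).symm

theorem minkowski_mul_self : Matrix.of minkowski * Matrix.of minkowski = 1 := by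
  ext a b
  fin_cases a <;> fin_cases b <;> simp [Matrix.mul_apply, minkowski]

theorem minkowski_transpose : (Matrix.of minkowski)ᵀ = Matrix.of minkowski := by
  ext a b
  fin_cases a <;> fin_cases b <;> simp [minkowski]

namespace IsOrientedFrame

variable {g : Matrix (Fin 4) (Fin 4) ℝ} {η : Fin 4 → Fin 4 → Fin 4 → Fin 4 → ℝ}
  {E : Matrix (Fin 4) (Fin 4) ℝ} (hE : IsOrientedFrame g η E)
include hE

theorem isUnit_det : IsUnit E.det := by
  obtain ⟨v, -, hv⟩ := hE.volume
  exact IsUnit.of_mul_eq_one v (by rw [mul_comm, hv])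

theorem inv_mul : E⁻¹ * E = 1 := Matrix.nonsing_inv_mul _ hE.isUnit_det

theorem mul_inv : E * E⁻¹ = 1 := Matrix.mul_nonsing_inv _ hE.isUnit_det

theorem metric_eq : g = E⁻¹ * Matrix.of minkowski * (E⁻¹)ᵀ := by
  have h : Eᵀ * (E⁻¹)ᵀ = 1 := by rw [← Matrix.transpose_mul, hE.inv_mul, Matrix.transpose_one]
  calc g = (E⁻¹ * E) * g * (Eᵀ * (E⁻¹)ᵀ) := by rw [h, hE.inv_mul, Matrix.one_mul, Matrix.mul_one]
    _ = E⁻¹ * (E * g * Eᵀ) * (E⁻¹)ᵀ := by simp only [Matrix.mul_assoc]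
    _ = _ := by rw [hE.orthonormal]

theorem metric_inv : g⁻¹ = Eᵀ * Matrix.of minkowski * E := by
  refine Matrix.inv_eq_left_inv ?_
  have h : (E⁻¹)ᵀ = (Eᵀ)⁻¹ := Matrix.transpose_nonsing_inv E
  have h' : Eᵀ * (E⁻¹)ᵀ = 1 := by rw [← Matrix.transpose_mul, hE.inv_mul, Matrix.transpose_one]
  calc Eᵀ * Matrix.of minkowski * E * g =
        Eᵀ * Matrix.of minkowski * (E * g * Eᵀ) * (E⁻¹)ᵀ := by
          simp only [Matrix.mul_assoc, h', Matrix.mul_one]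
    _ = 1 := by
      rw [hE.orthonormal, Matrix.mul_assoc Eᵀ, minkowski_mul_self, Matrix.mul_one, h']

theorem frame_mul_dual : E.map Complex.ofRealHom * (dualBasis E)ᵀ = 1 := by
  rw [dualBasis, Matrix.transpose_map, Matrix.transpose_transpose, ← Matrix.map_mul, hE.mul_inv]
  simp

theorem dual_mul_frame : (dualBasis E)ᵀ * E.map Complex.ofRealHom = 1 := by
  rw [dualBasis, Matrix.transpose_map, Matrix.transpose_transpose, ← Matrix.map_mul, hE.inv_mul]
  simp

theorem transpose_frame_mul_dual : (E.map Complex.ofRealHom)ᵀ * dualBasis E = 1 := by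
  rw [← Matrix.transpose_transpose (dualBasis E), ← Matrix.transpose_mul, hE.dual_mul_frame,
    Matrix.transpose_one]

theorem dual_mul_transpose_frame : dualBasis E * (E.map Complex.ofRealHom)ᵀ = 1 := by
  rw [← Matrix.transpose_transpose (dualBasis E), ← Matrix.transpose_mul, hE.frame_mul_dual,
    Matrix.transpose_one]

theorem map_metric_inv : g⁻¹.map Complex.ofRealHom =
    (E.map Complex.ofRealHom)ᵀ * mink * E.map Complex.ofRealHom := by
  rw [hE.metric_inv, Matrix.map_mul, Matrix.map_mul, map_minkowski, Matrix.transpose_map]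

theorem map_metric : g.map Complex.ofRealHom = (dualBasis E)ᵀ * mink * dualBasis E := by
  nth_rewrite 1 [hE.metric_eq]
  rw [Matrix.map_mul, Matrix.map_mul, map_minkowski, dualBasis, Matrix.transpose_map,
    Matrix.transpose_transpose]

theorem dual_mul_inv_mul : dualBasis E * g⁻¹.map Complex.ofRealHom * (dualBasis E)ᵀ = mink := by
  rw [hE.map_metric_inv]
  calc _ = (dualBasis E * (E.map Complex.ofRealHom)ᵀ) * mink *
        (E.map Complex.ofRealHom * (dualBasis E)ᵀ) := by simp only [Matrix.mul_assoc]
    _ = mink := by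
      rw [hE.frame_mul_dual, hE.dual_mul_transpose_frame, Matrix.one_mul, Matrix.mul_one]

/-- Orientation enters here: the scale `v` is the determinant of the inverse of `E`, so η is the
symbol pulled back by the dual basis, with no sign left over. -/
theorem volume_eq (i j k l : Fin 4) : (η i j k l : ℂ) =
    pull4 (dualBasis E) (fun a b c d ↦ (levi a b c d : ℂ)) i j k l := by
  obtain ⟨v, hv, hv1⟩ := hE.volume
  have h1 : (E⁻¹).det = v := by
    rw [Matrix.det_nonsing_inv, Ring.inverse_eq_inv]
    exact inv_eq_of_mul_eq_one_left hv1
  have h := sum_levi_mul_row E⁻¹ i j k l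
  rw [hv, ← h1, mul_comm, ← h]
  push_cast
  refine Finset.sum_congr rfl fun _ _ ↦ Finset.sum_congr rfl fun _ _ ↦
    Finset.sum_congr rfl fun _ _ ↦ Finset.sum_congr rfl fun _ _ ↦ ?_
  simp only [dualBasis, Matrix.map_apply, Matrix.transpose_apply, Complex.ofRealHom_eq_coe]
  ring

end IsOrientedFrame

section

variable {g : Coord → Matrix (Fin 4) (Fin 4) ℝ} {η : Coord → Fin 4 → Fin 4 → Fin 4 → Fin 4 → ℝ}
  {y : Coord} {E : Matrix (Fin 4) (Fin 4) ℝ} (hE : IsOrientedFrame (g y) (η y) E)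

theorem of_ginv : Matrix.of (ginv g y) = (g y)⁻¹.map Complex.ofRealHom := rfl

include hE

theorem dual_mul_ginv_mul :
    dualBasis E * Matrix.of (ginv g y) * (dualBasis E)ᵀ = mink := hE.dual_mul_inv_mul

/-- The Hodge dual is natural: both η and the inverse metric are pulled back from their standard
forms in the frame. -/
theorem hodge_sandwich {F' : Fin 4 → Fin 4 → ℂ} {F : Matrix (Fin 4) (Fin 4) ℂ}
    (h : Matrix.of F' = (dualBasis E)ᵀ * F * dualBasis E) (i j : Fin 4) : hodge g η y F' i j =
      ((dualBasis E)ᵀ * Matrix.of (hodgeFlat F) * dualBasis E) i j := by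
  have h1 : (Matrix.of fun k l ↦ (η y i j k l : ℂ)) =
      ∑ p : Fin 4 × Fin 4, (dualBasis E p.1 i * dualBasis E p.2 j) •
        ((dualBasis E)ᵀ * Matrix.of (fun c d ↦ (levi p.1 p.2 c d : ℂ)) * dualBasis E) := by
    ext k l
    rw [Matrix.of_apply, hE.volume_eq, pull4_eq_right, Fintype.sum_prod_type, Matrix.sum_apply]
    refine Finset.sum_congr rfl fun a _ ↦ ?_
    rw [Matrix.sum_apply]
    rfl
  rw [hodge_eq_pairing, h1, pairing_sum_left, h, sandwich_apply, Fintype.sum_prod_type]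
  refine Finset.sum_congr rfl fun a _ ↦ Finset.sum_congr rfl fun b _ ↦ ?_
  rw [pairing_congr (dual_mul_ginv_mul hE), pairing_mink]
  rfl

theorem lower_frame (i a : Fin 4) : ((∑ s, g y i s * E a s : ℝ) : ℂ) =
    mink a a * dualBasis E a i := by
  have h : g y * Eᵀ = E⁻¹ * Matrix.of minkowski := by
    have h' : (E⁻¹)ᵀ * Eᵀ = 1 := by rw [← Matrix.transpose_mul, hE.mul_inv, Matrix.transpose_one]
    nth_rewrite 1 [hE.metric_eq]
    rw [Matrix.mul_assoc, h', Matrix.mul_one]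
  have h1 := congrFun (congrFun h i) a
  simp only [Matrix.mul_apply, Matrix.transpose_apply] at h1
  rw [h1, dualBasis, mink_apply]
  simp [minkowski]
  split_ifs <;> simp

/-- The frame components of `e_0 ∧ e_A`. -/
def timeBivector (A : Fin 3) : Matrix (Fin 4) (Fin 4) ℂ :=
  Matrix.of fun i j ↦ (if i = A.succ ∧ j = 0 then 1 else 0) - (if i = 0 ∧ j = A.succ then 1 else 0)

omit hE in
-- Lowering e_0 changes its sign, so the (0, A) component of e_0 ∧ e_A is -1; this fixes the signs
-- in `sdBasis`, and the dual supplies the imaginary entries.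
theorem timeBivector_sd (A : Fin 3) :
    timeBivector A - Complex.I • Matrix.of (hodgeFlat (timeBivector A)) = sdBasis A := by
  rw [hodgeFlat_explicit]
  · ext i j
    fin_cases A <;> fin_cases i <;> fin_cases j <;> simp [timeBivector, sdBasis]
  · ext i j
    simp only [timeBivector, Matrix.transpose_apply, Matrix.of_apply, Matrix.neg_apply, neg_sub,
      and_comm]

theorem frameBivector_eq (e : Coord → Fin 4 → Fin 4 → ℝ) (he : Matrix.of (e y) = E) (A : Fin 3)
    (i j : Fin 4) : (frameBivector g e y A i j : ℂ) =
      ((dualBasis E)ᵀ * timeBivector A * dualBasis E) i j := by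
  subst he
  have h := lower_frame hE
  simp only [Matrix.of_apply] at h
  rw [frameBivector, Complex.ofReal_sub, Complex.ofReal_mul, Complex.ofReal_mul, h, h, h, h,
    sandwich_apply]
  fin_cases A <;> simp [timeBivector, Fin.sum_univ_four, mink]

theorem sdFrameBivector_eq (e : Coord → Fin 4 → Fin 4 → ℝ) (he : Matrix.of (e y) = E) (A : Fin 3)
    (i j : Fin 4) : sdFrameBivector g η e y A i j =
      (1 / (Real.sqrt 2 : ℂ)) * sdBiv (dualBasis E) A i j := by
  have h : Matrix.of (fun m n ↦ (frameBivector g e y A m n : ℂ)) =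
      (dualBasis E)ᵀ * timeBivector A * dualBasis E := by
    ext m n; exact frameBivector_eq hE e he A m n
  rw [sdFrameBivector, hodge_sandwich hE h, frameBivector_eq hE e he, sdBiv, ← timeBivector_sd]
  simp only [Matrix.mul_sub, Matrix.sub_mul, Matrix.mul_smul, Matrix.smul_mul, Matrix.sub_apply,
    Matrix.smul_apply, smul_eq_mul]

omit hE in
-- 𝓖 is the identity on self-dual bivectors. Being self-dual on both sides, it need only be compared
-- on electric components.
theorem sdMetric_flat : (fun a b c d ↦ (1 / 2) * (mink a c * mink b d - mink a d * mink b c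
      - Complex.I * (levi a b c d : ℂ))) = dbl 1 1 := by
  have hm : ∀ a b, mink b a = mink a b := fun a b ↦ congrFun (congrFun mink_transpose a) b
  refine eq_dbl_one (fun a b c d ↦ ?_) (fun a b c d ↦ ?_) (fun A c d ↦ ?_) (fun A B ↦ ?_)
    fun A B ↦ ?_
  · rw [levi_swap a b]; push_cast; ring
  · rw [levi_swap_right a b]; push_cast; ring
  · fin_cases A <;> fin_cases c <;> fin_cases d <;> simp [dualPair, mink, levi] <;>
      norm_num [Complex.ext_iff]
  · fin_cases A <;> fin_cases B <;> simp [dualPair, mink, levi] <;> norm_num [Complex.ext_iff]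
  · fin_cases A <;> fin_cases B <;> simp [mink, levi]

theorem sdMetric_eq : sdMetric g η y = dbl (dualBasis E) 1 := by
  have hm : ∀ i k, ((g y i k : ℝ) : ℂ) = ((dualBasis E)ᵀ * mink * dualBasis E) i k := fun i k ↦ by
    rw [← hE.map_metric]; rfl
  rw [← pull4_dbl_one, ← sdMetric_flat]
  ext i j k l
  rw [sdMetric, hE.volume_eq]
  push_cast
  rw [hm, hm, hm, hm, ← pull4_mul, ← pull4_mul']
  simp only [pull4, Finset.mul_sum, ← Finset.sum_sub_distrib]
  exact Finset.sum_congr rfl fun _ _ ↦ Finset.sum_congr rfl fun _ _ ↦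
    Finset.sum_congr rfl fun _ _ ↦ Finset.sum_congr rfl fun _ _ ↦ by ring

end

end

/-! ### The matrix of the self-dual Weyl tensor, and type I -/

section

open Matrix

/-- The algebraic symmetries of the Weyl tensor with respect to the inverse metric `G`. -/
structure HasWeylSymmetries (G : Matrix (Fin 4) (Fin 4) ℂ)
    (X : Fin 4 → Fin 4 → Fin 4 → Fin 4 → ℂ) : Prop where
  anti_left : ∀ a b c d, X b a c d = -X a b c d
  anti_right : ∀ a b c d, X a b d c = -X a b c d
  pair : ∀ a b c d, X c d a b = X a b c d
  bianchi : ∀ a b c d, X a b c d + X a c d b + X a d b c = 0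
  trace : ∀ b d, ∑ a, ∑ c, G a c * X a b c d = 0

theorem HasWeylSymmetries.isWeylLike_pull4 {G T : Matrix (Fin 4) (Fin 4) ℂ}
    {X : Fin 4 → Fin 4 → Fin 4 → Fin 4 → ℂ} (h : HasWeylSymmetries G X)
    (hG : T * mink * Tᵀ = G) : IsWeylLike (pull4 T X) where
  anti_left a b c d := pull4_anti_left T X h.anti_left a b c d
  anti_right a b c d := pull4_anti_right T X h.anti_right a b c d
  pair a b c d := pull4_pair T X h.pair a b c d
  bianchi a b c d := pull4_bianchi T X h.bianchi a b c d
  trace b d := pull4_trace T X hG h.trace b d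

section

variable {g : Coord → Matrix (Fin 4) (Fin 4) ℝ} {η : Coord → Fin 4 → Fin 4 → Fin 4 → Fin 4 → ℝ}
  {y : Coord} {E : Matrix (Fin 4) (Fin 4) ℝ} (hE : IsOrientedFrame (g y) (η y) E)

/-- The matrix of the self-dual Weyl tensor in the frame `E`. -/
def frameWeyl (g : Coord → Matrix (Fin 4) (Fin 4) ℝ) (y : Coord) (E : Matrix (Fin 4) (Fin 4) ℝ) :
    Matrix (Fin 3) (Fin 3) ℂ :=
  weylMatrix (pull4 (E.map Complex.ofRealHom)ᵀ fun i j k l ↦ (weyl g y i j k l : ℂ))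

theorem hodgeFlat_sandwich (T : Matrix (Fin 4) (Fin 4) ℂ)
    (X : Fin 4 → Fin 4 → Fin 4 → Fin 4 → ℂ) (k l a b : Fin 4) :
    hodgeFlat (fun a b ↦ (Tᵀ * Matrix.of (X a b) * T) k l) a b =
      (Tᵀ * Matrix.of (fun c d ↦ hodgeFlat (fun m n ↦ X m n c d) a b) * T) k l := by
  have : Matrix.of (fun c d ↦ hodgeFlat (fun m n ↦ X m n c d) a b) = ∑ m, ∑ n,
      ((1 / 2) * ((levi a b m n : ℂ) * mink m m * mink n n)) • Matrix.of (X m n) := by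
    ext c d
    simp only [Matrix.of_apply, hodgeFlat, Matrix.sum_apply, Matrix.smul_apply, smul_eq_mul,
      Finset.mul_sum]
    exact Finset.sum_congr rfl fun _ _ ↦ Finset.sum_congr rfl fun _ _ ↦ by ring
  rw [this]
  simp only [Matrix.sum_mul, Matrix.sum_apply, Matrix.mul_smul, Matrix.smul_mul,
    Matrix.smul_apply, smul_eq_mul, hodgeFlat, Finset.mul_sum]
  exact Finset.sum_congr rfl fun _ _ ↦ Finset.sum_congr rfl fun _ _ ↦ by ring

include hE

theorem isWeylLike_frame
    (hW : HasWeylSymmetries (Matrix.of (ginv g y)) fun i j k l ↦ (weyl g y i j k l : ℂ)) :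
    IsWeylLike (pull4 (E.map Complex.ofRealHom)ᵀ fun i j k l ↦ (weyl g y i j k l : ℂ)) :=
  hW.isWeylLike_pull4 (by rw [of_ginv, hE.map_metric_inv, Matrix.transpose_transpose])

/-- The curvature is moved to the frame, where `IsWeylLike.sdFlat_eq` applies, and back. The Hodge
dual acts on the first index pair and so commutes with the change of frame in the second. -/
theorem sdWeyl_eq
    (hW : HasWeylSymmetries (Matrix.of (ginv g y)) fun i j k l ↦ (weyl g y i j k l : ℂ)) :
    sdWeyl g η y = dbl (dualBasis E) (frameWeyl g y E) := by
  have hX := isWeylLike_frame hE hW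
  rw [← pull4_dbl_one, frameWeyl, ← hX.sdFlat_eq]
  set X := pull4 (E.map Complex.ofRealHom)ᵀ fun i j k l ↦ (weyl g y i j k l : ℂ) with hXdef
  have hp : (fun i j k l ↦ (weyl g y i j k l : ℂ)) = pull4 (dualBasis E) X :=
    (pull4_pull4 _ _ _ hE.transpose_frame_mul_dual).symm
  have hw : ∀ i j k l, (weyl g y i j k l : ℂ) = pull4 (dualBasis E) X i j k l := fun i j k l ↦ by
    rw [← hp]
  have hh : ∀ i j k l, hodge g η y (fun m n ↦ (weyl g y m n k l : ℂ)) i j =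
      pull4 (dualBasis E) (fun a b c d ↦ hodgeFlat (fun m n ↦ X m n c d) a b) i j k l :=
      fun i j k l ↦ by
    rw [hodge_sandwich hE (F := Matrix.of fun a b ↦
      ((dualBasis E)ᵀ * Matrix.of (X a b) * dualBasis E) k l), pull4_eq_sandwich]
    · have : Matrix.of (hodgeFlat (Matrix.of fun a b ↦
          ((dualBasis E)ᵀ * Matrix.of (X a b) * dualBasis E) k l)) = Matrix.of fun a b ↦
          ((dualBasis E)ᵀ * Matrix.of (fun c d ↦ hodgeFlat (fun m n ↦ X m n c d) a b) *
            dualBasis E) k l := by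
        ext a b
        exact hodgeFlat_sandwich (dualBasis E) X k l a b
      rw [this]
    · ext m n
      rw [Matrix.of_apply, hw, pull4_eq_sandwich]
  ext i j k l
  rw [sdWeyl, hh, hw]
  simp only [pull4, Finset.mul_sum, ← Finset.sum_sub_distrib, sdFlat]
  exact Finset.sum_congr rfl fun _ _ ↦ Finset.sum_congr rfl fun _ _ ↦
    Finset.sum_congr rfl fun _ _ ↦ Finset.sum_congr rfl fun _ _ ↦ by ring

end

/-! ### Invariants of a traceless `3 × 3` matrix -/

/-- Newton's identities: for zero trace, the coefficients of the characteristic polynomial depend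
only on tr Q² and tr Q³. -/
theorem charpoly_traceless (Q : Matrix (Fin 3) (Fin 3) ℂ) (h : Q.trace = 0) (x : ℂ) :
    (Matrix.scalar (Fin 3) x - Q).det =
      x ^ 3 - (1 / 2) * (Q * Q).trace * x - (1 / 3) * (Q * Q * Q).trace := by
  have h' : Q 2 2 = -Q 0 0 - Q 1 1 := by
    rw [Matrix.trace_fin_three] at h; linear_combination h
  simp [Matrix.det_fin_three, Matrix.trace_fin_three, Matrix.mul_apply, Fin.sum_univ_three, h']
  ring

/-- Vieta's formulas, obtained by subtracting the equations in pairs and dividing by differences of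
roots. -/
theorem cubic_roots {p q x y z : ℂ} (hxy : x ≠ y) (hxz : x ≠ z) (hyz : y ≠ z)
    (hx : x ^ 3 - p * x - q = 0) (hy : y ^ 3 - p * y - q = 0) (hz : z ^ 3 - p * z - q = 0) :
    x + y + z = 0 ∧ p = -(x * y + x * z + y * z) ∧ q = x * y * z := by
  have h1 : x ^ 2 + x * y + y ^ 2 = p := mul_left_cancel₀ (sub_ne_zero.mpr hxy) (by
    linear_combination hx - hy)
  have h2 : x ^ 2 + x * z + z ^ 2 = p := mul_left_cancel₀ (sub_ne_zero.mpr hxz) (by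
    linear_combination hx - hz)
  have h3 : x + y + z = 0 := mul_left_cancel₀ (sub_ne_zero.mpr hyz) (by
    linear_combination h1 - h2)
  obtain rfl : z = -x - y := by linear_combination h3
  refine ⟨h3, by rw [← h1]; ring, ?_⟩
  rw [← h1] at hx
  linear_combination -hx

/-- The expression is twice the discriminant of the characteristic polynomial, whose roots are the
three given distinct eigenvalues. -/
theorem invariant_ne_zero {Q : Matrix (Fin 3) (Fin 3) ℂ} (h : Q.trace = 0) {α : Fin 3 → ℂ}
    (hα : Function.Injective α) (f : Fin 3 → Fin 3 → ℂ) (hf : ∀ A, f A ≠ 0)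
    (hQ : ∀ A, Q *ᵥ f A = α A • f A) :
    (Q * Q).trace ^ 3 - 6 * (Q * Q * Q).trace ^ 2 ≠ 0 := by
  have hr : ∀ A, α A ^ 3 - (1 / 2) * (Q * Q).trace * α A - (1 / 3) * (Q * Q * Q).trace = 0 :=
      fun A ↦ by
    rw [← charpoly_traceless Q h, ← Matrix.exists_mulVec_eq_zero_iff]
    refine ⟨f A, hf A, ?_⟩
    rw [Matrix.sub_mulVec, hQ]
    simp [Matrix.scalar_apply, ← Matrix.smul_one_eq_diagonal, Matrix.smul_mulVec]
  have h01 : α 0 ≠ α 1 := hα.ne (by decide)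
  have h02 : α 0 ≠ α 2 := hα.ne (by decide)
  have h12 : α 1 ≠ α 2 := hα.ne (by decide)
  obtain ⟨h1, h2, h3⟩ := cubic_roots h01 h02 h12 (hr 0) (hr 1) (hr 2)
  have h4 : α 2 = -α 0 - α 1 := by linear_combination h1
  have : (Q * Q).trace ^ 3 - 6 * (Q * Q * Q).trace ^ 2 =
      2 * ((α 0 - α 1) * (α 0 - α 2) * (α 1 - α 2)) ^ 2 := by
    have e2 : (Q * Q).trace = -2 * (α 0 * α 1 + α 0 * α 2 + α 1 * α 2) := by
      linear_combination 2 * h2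
    have e3 : (Q * Q * Q).trace = 3 * (α 0 * α 1 * α 2) := by linear_combination 3 * h3
    rw [e2, e3, h4]; ring
  rw [this]
  exact mul_ne_zero two_ne_zero (pow_ne_zero _ (mul_ne_zero (mul_ne_zero (sub_ne_zero.mpr h01)
    (sub_ne_zero.mpr h02)) (sub_ne_zero.mpr h12)))

section

variable {g : Coord → Matrix (Fin 4) (Fin 4) ℝ} {η : Coord → Fin 4 → Fin 4 → Fin 4 → Fin 4 → ℝ}
  {y : Coord} {E : Matrix (Fin 4) (Fin 4) ℝ} (hE : IsOrientedFrame (g y) (η y) E)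
include hE

theorem exists_sum_sdBiv {F : Fin 4 → Fin 4 → ℂ} (hF : IsSelfDual g η y F) :
    ∃ f : Fin 3 → ℂ, Matrix.of F = ∑ A, f A • sdBiv (dualBasis E) A := by
  obtain ⟨hF1, hF2⟩ := hF
  set S := (E.map Complex.ofRealHom)ᵀ with hS
  set T := dualBasis E with hT
  have hST : S * T = 1 := hE.transpose_frame_mul_dual
  have hTS : Tᵀ * Sᵀ = 1 := by rw [← Matrix.transpose_mul, hST, Matrix.transpose_one]
  have hST' : Sᵀ * Tᵀ = 1 := by
    rw [hS, Matrix.transpose_transpose]; exact hE.frame_mul_dual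
  have hTS' : T * S = 1 := by
    rw [← Matrix.transpose_one, ← hST', Matrix.transpose_mul, Matrix.transpose_transpose,
      Matrix.transpose_transpose]
  obtain ⟨K, hK⟩ : ∃ K, K = Sᵀ * Matrix.of F * S := ⟨_, rfl⟩
  have hFK : Matrix.of F = Tᵀ * K * T := by
    calc Matrix.of F = (Tᵀ * Sᵀ) * Matrix.of F * (S * T) := by
          rw [hST, hTS, Matrix.one_mul, Matrix.mul_one]
      _ = _ := by rw [hK]; simp only [Matrix.mul_assoc]
  have hKt : Kᵀ = -K := by
    have : (Matrix.of F)ᵀ = -Matrix.of F := by ext i j; exact hF1 j i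
    rw [hK, Matrix.transpose_mul, Matrix.transpose_mul, Matrix.transpose_transpose, this,
      Matrix.neg_mul, Matrix.mul_neg, Matrix.mul_assoc]
  have hKh : Matrix.of (hodgeFlat K) = Complex.I • K := by
    have h1 : Tᵀ * Matrix.of (hodgeFlat K) * T = Complex.I • (Tᵀ * K * T) := by
      ext i j
      rw [← hodge_sandwich hE hFK, hF2, ← hFK]; rfl
    have h2 : ∀ M : Matrix (Fin 4) (Fin 4) ℂ, Sᵀ * (Tᵀ * M * T) * S = M := fun M ↦ by
      calc _ = (Sᵀ * Tᵀ) * M * (T * S) := by simp only [Matrix.mul_assoc]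
        _ = M := by rw [hST', hTS', Matrix.one_mul, Matrix.mul_one]
    rw [← h2 (Matrix.of (hodgeFlat K)), h1, Matrix.mul_smul, Matrix.smul_mul, h2]
  rw [hodgeFlat_explicit K hKt] at hKh
  have hk : ∀ i j, K j i = -K i j := fun i j ↦ congrFun (congrFun hKt i) j
  -- The electric entry of `sdBasis A` is -1, whence the sign; self-duality in `hKh` forces the
  -- magnetic entries.
  refine ⟨fun A ↦ -K 0 A.succ, ?_⟩
  have e1 := congrFun (congrFun hKh 0) 1
  have e2 := congrFun (congrFun hKh 0) 2
  have e3 := congrFun (congrFun hKh 0) 3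
  simp at e1 e2 e3
  have hsum : K = ∑ A : Fin 3, (-K 0 A.succ) • sdBasis A := by
    have hd : ∀ i, K i i = 0 := fun i ↦ self_eq_neg.mp (hk i i)
    have e2' : K 1 3 = -(Complex.I * K 0 2) := by rw [hk 3 1, e2]
    ext i j
    simp only [Fin.sum_univ_three, Matrix.add_apply, Matrix.smul_apply, smul_eq_mul]
    fin_cases i <;> fin_cases j <;>
      simp [sdBasis, hd, hk 0 1, hk 0 2, hk 0 3, hk 1 2, hk 2 3, e1, e2, e2', e3, mul_comm]
  rw [hFK]
  nth_rewrite 1 [hsum]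
  simp only [Matrix.mul_sum, Matrix.sum_mul, Matrix.mul_smul, Matrix.smul_mul, sdBiv]

theorem invDelta_eq {Q : Matrix (Fin 3) (Fin 3) ℂ} (hQ : sdWeyl g η y = dbl (dualBasis E) Q) :
    invA g η y = (Q * Q).trace ∧ invB g η y = (Q * Q * Q).trace ∧
      sdWeyl2 g η y = dbl (dualBasis E) (Q * Q) := by
  have hT := dual_mul_ginv_mul hE
  have h2 : sdWeyl2 g η y = dbl (dualBasis E) (Q * Q) := by
    rw [sdWeyl2, hQ, dblMul_dbl hT]
  refine ⟨?_, ?_, h2⟩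
  · rw [invA, h2, dblTr_dbl hT]
  · rw [invB, sdWeyl3, h2, hQ, dblMul_dbl hT, dblTr_dbl hT]

theorem IsTypeI.invDelta_ne_zero (hI : IsTypeI g η y)
    {Q : Matrix (Fin 3) (Fin 3) ℂ} (hQ : sdWeyl g η y = dbl (dualBasis E) Q) (h0 : Q.trace = 0) :
    invDelta g η y ≠ 0 := by
  have hT := dual_mul_ginv_mul hE
  obtain ⟨ha, hb, -⟩ := invDelta_eq hE hQ
  rw [invDelta, ha, hb]
  obtain ⟨α, hα, hF⟩ := hI
  choose F hF0 hFs hFe using hF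
  choose f hf using fun A ↦ exists_sum_sdBiv hE (hFs A)
  refine invariant_ne_zero h0 hα f (fun A h ↦ hF0 A ?_) fun A ↦ ?_
  · have := hf A
    rw [h] at this
    simp only [Pi.zero_apply, zero_smul, Finset.sum_const_zero] at this
    exact this
  · refine eq_of_sum_sdBiv hT ?_
    ext i j
    have h1 := hFe A i j
    rw [hQ, dblApply_dbl hT Q (hf A)] at h1
    rw [h1, ← Matrix.of_apply (f := F A), hf A]
    simp only [Matrix.sum_apply, Matrix.smul_apply, Pi.smul_apply, smul_eq_mul, Finset.mul_sum,
      mul_assoc]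

end

end

section

open Matrix

/-! ### Partial derivatives -/

section pd

variable {F : Type*} [NormedAddCommGroup F] [NormedSpace ℝ F] {f h : Coord → F} {y : Coord}
  (i j : Fin 4)

theorem pd_congr (hfh : f =ᶠ[nhds y] h) : pd i f y = pd i h y := by
  rw [pd, pd, hfh.fderiv_eq]

theorem pd_add (hf : DifferentiableAt ℝ f y) (hh : DifferentiableAt ℝ h y) :
    pd i (fun z ↦ f z + h z) y = pd i f y + pd i h y := by
  rw [pd, fderiv_fun_add hf hh]; rfl

theorem pd_sub (hf : DifferentiableAt ℝ f y) (hh : DifferentiableAt ℝ h y) :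
    pd i (fun z ↦ f z - h z) y = pd i f y - pd i h y := by
  rw [pd, fderiv_fun_sub hf hh]; rfl

theorem pd_sum {ι : Type*} (s : Finset ι) {f : ι → Coord → F}
    (hf : ∀ k ∈ s, DifferentiableAt ℝ (f k) y) :
    pd i (fun z ↦ ∑ k ∈ s, f k z) y = ∑ k ∈ s, pd i (f k) y := by
  rw [pd, fderiv_fun_sum hf, _root_.sum_apply]; rfl

theorem pd_mul {𝔸 : Type*} [NormedCommRing 𝔸] [NormedAlgebra ℝ 𝔸] {f h : Coord → 𝔸}
    (hf : DifferentiableAt ℝ f y) (hh : DifferentiableAt ℝ h y) :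
    pd i (fun z ↦ f z * h z) y = pd i f y * h y + f y * pd i h y := by
  rw [pd, fderiv_fun_mul hf hh]
  simp [pd, mul_comm, add_comm]

theorem pd_const_mul {𝔸 : Type*} [NormedCommRing 𝔸] [NormedAlgebra ℝ 𝔸] {f : Coord → 𝔸}
    (hf : DifferentiableAt ℝ f y) (c : 𝔸) :
    pd i (fun z ↦ c * f z) y = c * pd i f y := by
  rw [pd, fderiv_const_mul hf]; rfl

theorem pd_const (c : F) : pd i (fun _ ↦ c) y = 0 := by
  simp [pd]

theorem pd_ofReal {f : Coord → ℝ} (hf : DifferentiableAt ℝ f y) :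
    pd i (fun z ↦ (f z : ℂ)) y = ((pd i f y : ℝ) : ℂ) := by
  have h := Complex.ofRealCLM.hasFDerivAt.comp y hf.hasFDerivAt
  have h' : HasFDerivAt (fun z ↦ (f z : ℂ)) (Complex.ofRealCLM.comp (fderiv ℝ f y)) y := h
  rw [pd, h'.fderiv]; rfl

theorem contDiffOn_pd {U : Set Coord} (hU : IsOpen U) (hf : ContDiffOn ℝ ∞ f U) :
    ContDiffOn ℝ ∞ (pd i f) U :=
  (hf.fderiv_of_isOpen hU (by norm_cast)).clm_apply contDiffOn_const

theorem pd_comm {U : Set Coord} (hU : IsOpen U) (hf : ContDiffOn ℝ ∞ f U) (hy : y ∈ U) :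
    pd i (pd j f) y = pd j (pd i f) y := by
  have hfa : ContDiffAt ℝ ∞ f y := hf.contDiffAt (hU.mem_nhds hy)
  have hs : IsSymmSndFDerivAt ℝ f y := hfa.isSymmSndFDerivAt (by
    rw [minSmoothness_of_isRCLikeNormedField]; norm_cast)
  have hd : DifferentiableAt ℝ (fderiv ℝ f) y :=
    ((hf.fderiv_of_isOpen hU (m := ∞) (by norm_cast)).contDiffAt (hU.mem_nhds hy)).differentiableAt
      (by simp)
  have h : ∀ i j : Fin 4, pd i (pd j f) y = fderiv ℝ (fderiv ℝ f) y
      (EuclideanSpace.single i (1 : ℝ)) (EuclideanSpace.single j (1 : ℝ)) := fun i j ↦ by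
    have : pd j f = fun z ↦ fderiv ℝ f z (EuclideanSpace.single j (1 : ℝ)) := rfl
    rw [this, pd, fderiv_clm_apply hd (differentiableAt_const _)]
    simp
  rw [h, h]
  exact hs _ _

end pd

section smooth

variable {U : Set Coord} {𝕜 : Type*} [RCLike 𝕜]

theorem contDiffOn_det {n : Type*} [Fintype n] [DecidableEq n] {A : Coord → Matrix n n 𝕜}
    (hA : ∀ i j, ContDiffOn ℝ ∞ (fun z ↦ A z i j) U) :
    ContDiffOn ℝ ∞ (fun z ↦ (A z).det) U := by
  simp only [Matrix.det_apply']
  exact ContDiffOn.sum fun σ _ ↦ contDiffOn_const.mul (contDiffOn_prod fun i _ ↦ hA _ _)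

theorem contDiffOn_inv {n : Type*} [Fintype n] [DecidableEq n] {A : Coord → Matrix n n 𝕜}
    (hA : ∀ i j, ContDiffOn ℝ ∞ (fun z ↦ A z i j) U) (hu : ∀ z ∈ U, (A z).det ≠ 0) (i j : n) :
    ContDiffOn ℝ ∞ (fun z ↦ (A z)⁻¹ i j) U := by
  have h : (fun z ↦ (A z)⁻¹ i j) = fun z ↦ ((A z).det)⁻¹ * (A z).adjugate i j := by
    ext z
    rw [Matrix.inv_def, Ring.inverse_eq_inv]; rfl
  rw [h]
  refine ((contDiffOn_det hA).inv hu).mul ?_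
  simp only [Matrix.adjugate_apply]
  refine contDiffOn_det fun k l ↦ ?_
  by_cases hk : k = j
  · subst hk; simp only [Matrix.updateRow_self]; exact contDiffOn_const
  · simp only [Matrix.updateRow_ne hk]; exact hA k l

end smooth

/-! ### Curvature symmetries of a smooth metric -/

/-- `g` is a smooth nondegenerate symmetric matrix field on the open set `U`. -/
structure IsSmoothMetricOn (g : Coord → Matrix (Fin 4) (Fin 4) ℝ) (U : Set Coord) : Prop where
  isOpen : IsOpen U
  smooth : ∀ i j, ContDiffOn ℝ ∞ (fun z ↦ g z i j) U
  symm : ∀ z ∈ U, ∀ i j, g z i j = g z j i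
  mul_inv : ∀ z ∈ U, g z * (g z)⁻¹ = 1

/-- The Christoffel symbols of the first kind. -/
def christoffelLower (g : Coord → Matrix (Fin 4) (Fin 4) ℝ) (y : Coord) (n i j : Fin 4) : ℝ :=
  (1 / 2) * (pd i (fun z ↦ g z j n) y + pd j (fun z ↦ g z i n) y - pd n (fun z ↦ g z i j) y)

namespace IsSmoothMetricOn

variable {g : Coord → Matrix (Fin 4) (Fin 4) ℝ} {U : Set Coord} (hg : IsSmoothMetricOn g U)
  {y : Coord}

theorem christoffel_eq (g : Coord → Matrix (Fin 4) (Fin 4) ℝ) (y : Coord) (k i j : Fin 4) :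
    christoffel g y k i j = ∑ l, (g y)⁻¹ k l * christoffelLower g y l i j := by
  simp only [christoffel, christoffelLower, Finset.mul_sum]
  exact Finset.sum_congr rfl fun _ _ ↦ by ring

include hg

theorem det_ne_zero (hy : y ∈ U) : (g y).det ≠ 0 := fun h ↦ by
  have := congrArg Matrix.det (hg.mul_inv y hy)
  rw [Matrix.det_mul, h, Matrix.det_one, zero_mul] at this
  exact zero_ne_one this

theorem inv_mul (hy : y ∈ U) : (g y)⁻¹ * g y = 1 := mul_eq_one_comm.mp (hg.mul_inv y hy)

theorem contDiffOn_inv (i j : Fin 4) : ContDiffOn ℝ ∞ (fun z ↦ (g z)⁻¹ i j) U :=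
  Spacetime.contDiffOn_inv hg.smooth (fun _ hz ↦ hg.det_ne_zero hz) i j

theorem contDiffOn_christoffelLower (n i j : Fin 4) :
    ContDiffOn ℝ ∞ (fun z ↦ christoffelLower g z n i j) U :=
  contDiffOn_const.mul (((contDiffOn_pd i hg.isOpen (hg.smooth j n)).add
    (contDiffOn_pd j hg.isOpen (hg.smooth i n))).sub (contDiffOn_pd n hg.isOpen (hg.smooth i j)))

theorem contDiffOn_christoffel (k i j : Fin 4) :
    ContDiffOn ℝ ∞ (fun z ↦ christoffel g z k i j) U := by
  simp only [christoffel_eq]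
  exact ContDiffOn.sum fun l _ ↦ (hg.contDiffOn_inv k l).mul (hg.contDiffOn_christoffelLower l i j)

theorem differentiableAt {f : Coord → ℝ} (hf : ContDiffOn ℝ ∞ f U) (hy : y ∈ U) :
    DifferentiableAt ℝ f y :=
  (hf.contDiffAt (hg.isOpen.mem_nhds hy)).differentiableAt (by simp)

theorem pd_symm (hy : y ∈ U) (k i j : Fin 4) :
    pd k (fun z ↦ g z i j) y = pd k (fun z ↦ g z j i) y :=
  pd_congr k (Filter.eventually_of_mem (hg.isOpen.mem_nhds hy) fun z hz ↦ hg.symm z hz i j)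

theorem christoffelLower_symm (hy : y ∈ U) (n i j : Fin 4) :
    christoffelLower g y n j i = christoffelLower g y n i j := by
  rw [christoffelLower, christoffelLower, hg.pd_symm hy n j i]; ring

theorem lower_christoffel (hy : y ∈ U) (n i j : Fin 4) :
    ∑ m, g y n m * christoffel g y m i j = christoffelLower g y n i j := by
  have h : ∀ l, ∑ m, g y n m * (g y)⁻¹ m l = (1 : Matrix (Fin 4) (Fin 4) ℝ) n l := fun l ↦ by
    rw [← hg.mul_inv y hy, Matrix.mul_apply]
  simp only [christoffel_eq, Finset.mul_sum, ← mul_assoc]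
  rw [Finset.sum_comm]
  simp only [← Finset.sum_mul, h, Matrix.one_apply, ite_mul, one_mul, zero_mul,
    Finset.sum_ite_eq, Finset.mem_univ, if_true]

/-- The metric is parallel. -/
theorem pd_metric (hy : y ∈ U) (a n m : Fin 4) : pd a (fun z ↦ g z n m) y =
    christoffelLower g y n a m + christoffelLower g y m a n := by
  rw [christoffelLower, christoffelLower, hg.pd_symm hy a m n]; ring

theorem inv_symm (hy : y ∈ U) (i j : Fin 4) : (g y)⁻¹ i j = (g y)⁻¹ j i := by
  have h : (g y)ᵀ = g y := by ext i j; exact hg.symm y hy j i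
  have : ((g y)⁻¹)ᵀ = (g y)⁻¹ := by rw [Matrix.transpose_nonsing_inv, h]
  exact (congrFun (congrFun this j) i)

/-- The quadratic part of the Riemann tensor. -/
theorem riemann_eq (hy : y ∈ U) (n c a b : Fin 4) : riemann g y n c a b =
    pd a (fun z ↦ christoffelLower g z n c b) y - pd b (fun z ↦ christoffelLower g z n c a) y
    - ∑ m, ∑ l, (g y)⁻¹ m l * christoffelLower g y m a n * christoffelLower g y l c b
    + ∑ m, ∑ l, (g y)⁻¹ m l * christoffelLower g y m b n * christoffelLower g y l c a := by
  -- The index is lowered inside the derivative by the product rule; the correction term is ∂g,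
  -- expressed by Christoffel symbols of the first kind.
  have h1 : ∀ a b, ∑ m, g y n m * pd a (fun z ↦ christoffel g z m c b) y =
      pd a (fun z ↦ christoffelLower g z n c b) y -
        ∑ m, (christoffelLower g y n a m + christoffelLower g y m a n) * christoffel g y m c b :=
      fun a b ↦ by
    have e1 : pd a (fun z ↦ christoffelLower g z n c b) y =
        pd a (fun z ↦ ∑ m, g z n m * christoffel g z m c b) y :=
      pd_congr a (Filter.eventually_of_mem (hg.isOpen.mem_nhds hy) fun z hz ↦
        (hg.lower_christoffel hz n c b).symm)
    have d1 : ∀ m, DifferentiableAt ℝ (fun z ↦ g z n m) y := fun m ↦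
      hg.differentiableAt (hg.smooth n m) hy
    have d2 : ∀ m, DifferentiableAt ℝ (fun z ↦ christoffel g z m c b) y := fun m ↦
      hg.differentiableAt (hg.contDiffOn_christoffel m c b) hy
    rw [e1, pd_sum a _ (f := fun m z ↦ g z n m * christoffel g z m c b)
      fun m _ ↦ (d1 m).fun_mul (d2 m)]
    simp only [pd_mul a (d1 _) (d2 _), hg.pd_metric hy, Finset.sum_add_distrib]
    ring
  -- The quadratic part of the curvature cancels one of the two correction terms of `h1`.
  have h2 : ∀ a b, ∑ m, g y n m * ∑ k, christoffel g y k c b * christoffel g y m k a =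
      ∑ m, christoffelLower g y n a m * christoffel g y m c b := fun a b ↦ by
    simp only [Finset.mul_sum]
    rw [Finset.sum_comm]
    refine Finset.sum_congr rfl fun k _ ↦ ?_
    rw [hg.christoffelLower_symm hy, ← hg.lower_christoffel hy, Finset.sum_mul]
    exact Finset.sum_congr rfl fun _ _ ↦ by ring
  have h3 : ∀ a b, ∑ m, christoffelLower g y m a n * christoffel g y m c b =
      ∑ m, ∑ l, (g y)⁻¹ m l * christoffelLower g y m a n * christoffelLower g y l c b :=
      fun a b ↦ by
    simp only [christoffel_eq, Finset.mul_sum]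
    exact Finset.sum_congr rfl fun _ _ ↦ Finset.sum_congr rfl fun _ _ ↦ by ring
  have h4 : riemann g y n c a b = ∑ m, g y n m * pd a (fun z ↦ christoffel g z m c b) y
      - ∑ m, g y n m * pd b (fun z ↦ christoffel g z m c a) y
      + ∑ m, g y n m * ∑ k, christoffel g y k c b * christoffel g y m k a
      - ∑ m, g y n m * ∑ k, christoffel g y k c a * christoffel g y m k b := by
    simp only [riemann, riemannUp, Finset.sum_sub_distrib, mul_add, mul_sub,
      Finset.sum_add_distrib]
    ring
  rw [h4, h1, h1, h2, h2, ← h3, ← h3]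
  simp only [add_mul, Finset.sum_add_distrib]
  ring

theorem pd_christoffelLower (hy : y ∈ U) (a n i j : Fin 4) :
    pd a (fun z ↦ christoffelLower g z n i j) y =
      (1 / 2) * (pd a (pd i fun z ↦ g z j n) y + pd a (pd j fun z ↦ g z i n) y
        - pd a (pd n fun z ↦ g z i j) y) := by
  have d : ∀ k i j, DifferentiableAt ℝ (pd k fun z ↦ g z i j) y := fun k i j ↦
    hg.differentiableAt (contDiffOn_pd k hg.isOpen (hg.smooth i j)) hy
  simp only [christoffelLower]
  rw [pd_const_mul a (((d i j n).fun_add (d j i n)).fun_sub (d n i j)),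
    pd_sub a ((d i j n).fun_add (d j i n)) (d n i j), pd_add a (d i j n) (d j i n)]

theorem pd_pd_comm (hy : y ∈ U) (a b i j : Fin 4) :
    pd a (pd b fun z ↦ g z i j) y = pd b (pd a fun z ↦ g z i j) y :=
  pd_comm a b hg.isOpen (hg.smooth i j) hy

theorem pd_pd_symm (hy : y ∈ U) (a b i j : Fin 4) :
    pd a (pd b fun z ↦ g z i j) y = pd a (pd b fun z ↦ g z j i) y :=
  pd_congr a (Filter.eventually_of_mem (hg.isOpen.mem_nhds hy) fun _ hz ↦ hg.pd_symm hz b i j)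

omit hg in
/-- The quadratic part of the Riemann tensor. -/
def riemannQuad (g : Coord → Matrix (Fin 4) (Fin 4) ℝ) (y : Coord) (a n c b : Fin 4) : ℝ :=
  ∑ m, ∑ l, (g y)⁻¹ m l * christoffelLower g y m a n * christoffelLower g y l c b

theorem riemannQuad_swap (hy : y ∈ U) (a n c b : Fin 4) :
    riemannQuad g y c b a n = riemannQuad g y a n c b := by
  rw [riemannQuad, Finset.sum_comm]
  refine Finset.sum_congr rfl fun m _ ↦ Finset.sum_congr rfl fun l _ ↦ ?_
  rw [hg.inv_symm hy]; ring

theorem riemannQuad_left (hy : y ∈ U) (a n c b : Fin 4) :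
    riemannQuad g y n a c b = riemannQuad g y a n c b := by
  simp only [riemannQuad, hg.christoffelLower_symm hy _ a n]

theorem riemannQuad_right (hy : y ∈ U) (a n c b : Fin 4) :
    riemannQuad g y a n b c = riemannQuad g y a n c b := by
  simp only [riemannQuad, hg.christoffelLower_symm hy _ c b]

theorem riemannQuad_cross (hy : y ∈ U) (a n c b : Fin 4) :
    riemannQuad g y a c n b = riemannQuad g y b n c a := by
  rw [hg.riemannQuad_swap hy n b a c, hg.riemannQuad_left hy b n, hg.riemannQuad_right hy b n c a]

/-- Written with second derivatives of the metric and `riemannQuad`, the curvature shows its pair,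
cyclic and first-pair symmetries as permutations of indices: partial derivatives commute, `g` is
symmetric, and so are the Christoffel symbols. -/
theorem riemann_explicit (hy : y ∈ U) (n c a b : Fin 4) : riemann g y n c a b =
    (1 / 2) * (pd a (pd c fun z ↦ g z b n) y - pd a (pd n fun z ↦ g z c b) y
      - pd b (pd c fun z ↦ g z a n) y + pd b (pd n fun z ↦ g z c a) y)
    - riemannQuad g y a n c b + riemannQuad g y b n c a := by
  rw [hg.riemann_eq hy, hg.pd_christoffelLower hy, hg.pd_christoffelLower hy,
    hg.pd_pd_comm hy a b, riemannQuad, riemannQuad]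
  ring

theorem riemann_anti_left (hy : y ∈ U) (n c a b : Fin 4) :
    riemann g y c n a b = -riemann g y n c a b := by
  rw [hg.riemann_explicit hy, hg.riemann_explicit hy, hg.pd_pd_symm hy a n b c,
    hg.pd_pd_symm hy a c n b, hg.pd_pd_symm hy b n a c, hg.pd_pd_symm hy b c n a,
    hg.riemannQuad_cross hy a n c b, hg.riemannQuad_cross hy b n c a]
  ring

omit hg in
theorem riemann_anti_right (n c a b : Fin 4) :
    riemann g y n c b a = -riemann g y n c a b := by
  simp only [riemann, riemannUp, ← Finset.sum_neg_distrib, Finset.sum_sub_distrib]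
  exact Finset.sum_congr rfl fun _ _ ↦ by ring

theorem riemann_pair (hy : y ∈ U) (n c a b : Fin 4) :
    riemann g y a b n c = riemann g y n c a b := by
  rw [hg.riemann_explicit hy, hg.riemann_explicit hy, hg.pd_pd_comm hy n b c a,
    hg.pd_pd_comm hy n a b c, hg.pd_pd_symm hy a n b c, hg.pd_pd_comm hy c b n a,
    hg.pd_pd_symm hy b c n a, hg.pd_pd_comm hy c a b n, hg.riemannQuad_left hy a n b c,
    hg.riemannQuad_right hy a n c b, hg.riemannQuad_swap hy b n c a]
  ring

theorem riemann_bianchi (hy : y ∈ U) (n c a b : Fin 4) :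
    riemann g y n c a b + riemann g y n a b c + riemann g y n b c a = 0 := by
  rw [hg.riemann_explicit hy, hg.riemann_explicit hy, hg.riemann_explicit hy,
    hg.pd_pd_comm hy b a c n, hg.pd_pd_symm hy b n a c, hg.pd_pd_comm hy c a b n,
    hg.pd_pd_symm hy c n b a, hg.pd_pd_comm hy c b a n, hg.pd_pd_symm hy a n b c,
    hg.riemannQuad_right hy b n c a, hg.riemannQuad_right hy c n a b,
    hg.riemannQuad_right hy a n c b]
  ring

theorem ricci_eq (hy : y ∈ U) (c b : Fin 4) :
    ricci g y c b = ∑ n, ∑ m, (g y)⁻¹ n m * riemann g y n c m b := by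
  have h : ∀ n c a b, riemannUp g y n c a b = ∑ m, (g y)⁻¹ n m * riemann g y m c a b :=
      fun n c a b ↦ by
    have h1 : ∀ l, ∑ m, (g y)⁻¹ n m * g y m l = (1 : Matrix (Fin 4) (Fin 4) ℝ) n l := fun l ↦ by
      rw [← hg.inv_mul hy, Matrix.mul_apply]
    simp only [riemann, Finset.mul_sum, ← mul_assoc]
    rw [Finset.sum_comm]
    simp only [← Finset.sum_mul, h1, Matrix.one_apply, ite_mul, one_mul, zero_mul,
      Finset.sum_ite_eq, Finset.mem_univ, if_true]
  simp only [ricci, h]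
  rw [Finset.sum_comm]
  exact Finset.sum_congr rfl fun _ _ ↦ Finset.sum_congr rfl fun _ _ ↦ by rw [hg.inv_symm hy]

theorem ricci_symm (hy : y ∈ U) (c b : Fin 4) : ricci g y c b = ricci g y b c := by
  rw [hg.ricci_eq hy, hg.ricci_eq hy, Finset.sum_comm]
  exact Finset.sum_congr rfl fun _ _ ↦ Finset.sum_congr rfl fun _ _ ↦ by
    rw [hg.inv_symm hy, hg.riemann_pair hy]

/-- The coefficients 1/2 and 1/6 belong to dimension four: with g^{ik} g_{ik} = 4 the trace is Ric -
(1/2)(2 Ric + S g) + (S/6)(3 g) = 0, where S is the scalar curvature. -/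
theorem weyl_trace (hy : y ∈ U) (j l : Fin 4) :
    ∑ i, ∑ k, (g y)⁻¹ i k * weyl g y i j k l = 0 := by
  have h1 : ∀ n l, ∑ m, (g y)⁻¹ n m * g y m l = (1 : Matrix (Fin 4) (Fin 4) ℝ) n l := fun n l ↦ by
    rw [← hg.inv_mul hy, Matrix.mul_apply]
  have t1 : ∑ i, ∑ k, (g y)⁻¹ i k * g y i k = 4 := by
    have : ∀ i k, (g y)⁻¹ i k * g y i k = (g y)⁻¹ i k * g y k i := fun i k ↦ by
      rw [hg.symm y hy i k]
    refine (Finset.sum_congr rfl fun i _ ↦ (Finset.sum_congr rfl fun k _ ↦ this i k).trans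
      (h1 i i)).trans ?_
    simp
  have t2 : ∀ f : Fin 4 → ℝ, ∑ i, ∑ k, (g y)⁻¹ i k * (g y i l * f k) = f l := fun f ↦ by
    have : ∀ i k, (g y)⁻¹ i k * (g y i l * f k) = (g y)⁻¹ k i * g y i l * f k := fun i k ↦ by
      rw [hg.inv_symm hy]; ring
    simp only [this]
    rw [Finset.sum_comm]
    simp only [← Finset.sum_mul, h1]
    simp [Matrix.one_apply]
  have t3 : ∀ f : Fin 4 → ℝ, ∑ i, ∑ k, (g y)⁻¹ i k * (g y j k * f i) = f j := fun f ↦ by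
    have : ∀ i k, (g y)⁻¹ i k * (g y j k * f i) = (g y)⁻¹ i k * g y k j * f i := fun i k ↦ by
      rw [hg.symm y hy j k]; ring
    simp only [this]
    simp only [← Finset.sum_mul, h1]
    simp [Matrix.one_apply]
  have t4 : ∑ i, ∑ k, (g y)⁻¹ i k * (g y i l * g y j k) = g y j l := t2 fun k ↦ g y j k
  have expand : ∑ i, ∑ k, (g y)⁻¹ i k * weyl g y i j k l =
      ∑ i, ∑ k, (g y)⁻¹ i k * riemann g y i j k l
      - (1 / 2) * (ricci g y j l * (∑ i, ∑ k, (g y)⁻¹ i k * g y i k)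
        - ∑ i, ∑ k, (g y)⁻¹ i k * (g y i l * ricci g y j k)
        + g y j l * (∑ i, ∑ k, (g y)⁻¹ i k * ricci g y i k)
        - ∑ i, ∑ k, (g y)⁻¹ i k * (g y j k * ricci g y i l))
      + (scalarCurv g y / 6) * (g y j l * (∑ i, ∑ k, (g y)⁻¹ i k * g y i k)
        - ∑ i, ∑ k, (g y)⁻¹ i k * (g y i l * g y j k)) := by
    simp only [Finset.mul_sum, ← Finset.sum_sub_distrib, ← Finset.sum_add_distrib, weyl]
    exact Finset.sum_congr rfl fun _ _ ↦ Finset.sum_congr rfl fun _ _ ↦ by ring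
  rw [expand, t1, t2, t3, t4, ← hg.ricci_eq hy]
  change _ - 1 / 2 * (_ - _ + _ * scalarCurv g y - _) + _ = _
  ring

theorem hasWeylSymmetries (hy : y ∈ U) :
    HasWeylSymmetries (Matrix.of (ginv g y)) fun i j k l ↦ (weyl g y i j k l : ℂ) where
  anti_left a b c d := by
    rw [← Complex.ofReal_neg, weyl, weyl, hg.riemann_anti_left hy a b]
    congr 1; ring
  anti_right a b c d := by
    rw [← Complex.ofReal_neg, weyl, weyl, riemann_anti_right a b c d]
    congr 1; ring
  pair a b c d := by
    rw [weyl, weyl, hg.riemann_pair hy, hg.symm y hy c a, hg.symm y hy d b, hg.symm y hy c b,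
      hg.symm y hy d a, hg.ricci_symm hy d b, hg.ricci_symm hy d a, hg.ricci_symm hy c b,
      hg.ricci_symm hy c a]
    congr 1; ring
  bianchi a b c d := by
    rw [← Complex.ofReal_add, ← Complex.ofReal_add, ← Complex.ofReal_zero]
    congr 1
    rw [weyl, weyl, weyl, hg.symm y hy c b, hg.symm y hy d b, hg.symm y hy d c,
      hg.ricci_symm hy c b, hg.ricci_symm hy d b, hg.ricci_symm hy d c]
    linear_combination hg.riemann_bianchi hy a b c d
  trace b d := by
    rw [← Complex.ofReal_zero, ← hg.weyl_trace hy b d]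
    push_cast
    rfl

end IsSmoothMetricOn

end

section

open Matrix

/-! ### Self-dual decomposition of the connection -/

/-- The complexified Lorentz algebra splits into two commuting halves, self-dual and anti-self-dual.
Both the rotation of the u_A by the connection and the reality of `lorentz` rest on this. -/
theorem sdBasis_commute_conj (A B : Fin 3) :
    sdBasis A * mink * (sdBasis B).map (starRingEnd ℂ) =
      (sdBasis B).map (starRingEnd ℂ) * mink * sdBasis A := by
  have h : ∀ M N : Matrix (Fin 4) (Fin 4) ℂ, ∀ i j, (M * mink * N) i j =
      -(M i 0 * N 0 j) + M i 1 * N 1 j + M i 2 * N 2 j + M i 3 * N 3 j := fun M N i j ↦ by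
    simp [Matrix.mul_apply, Fin.sum_univ_four, mink]
  ext i j
  rw [h, h]
  fin_cases A <;> fin_cases B <;> simp [sdBasis] <;> fin_cases i <;> fin_cases j <;> simp

/-- The self-dual components of a real bivector. -/
def sdCoeff (h : Matrix (Fin 4) (Fin 4) ℝ) (A : Fin 3) : ℂ :=
  (1 / 2) * (-(h 0 A.succ : ℂ) + Complex.I * (h (dualPair A).1 (dualPair A).2 : ℂ))

/-- A real bivector is twice the real part of its self-dual part; the 1/2 in `sdCoeff` compensates
for the doubling. -/
theorem map_eq_sum_sdCoeff {h : Matrix (Fin 4) (Fin 4) ℝ} (hh : hᵀ = -h) :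
    h.map Complex.ofRealHom = ∑ A, (sdCoeff h A • sdBasis A +
      (starRingEnd ℂ) (sdCoeff h A) • (sdBasis A).map (starRingEnd ℂ)) := by
  have hk : ∀ i j, h j i = -h i j := fun i j ↦ congrFun (congrFun hh i) j
  have hd : ∀ i, h i i = 0 := fun i ↦ self_eq_neg.mp (hk i i)
  have key : ∀ A : Fin 3, sdCoeff h A • sdBasis A +
      (starRingEnd ℂ) (sdCoeff h A) • (sdBasis A).map (starRingEnd ℂ) = Matrix.of fun i j ↦
        (sdCoeff h A * sdBasis A i j + (starRingEnd ℂ) (sdCoeff h A * sdBasis A i j)) :=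
      fun A ↦ by ext i j; simp
  have key' : ∀ z : ℂ, z + (starRingEnd ℂ) z = (2 * z.re : ℝ) := fun z ↦ by
    rw [Complex.add_conj]
  simp only [key, key']
  ext i j
  simp only [Fin.sum_univ_three, Matrix.add_apply, Matrix.of_apply, sdCoeff, Matrix.map_apply,
    Complex.ofRealHom_eq_coe]
  fin_cases i <;> fin_cases j <;>
    simp [sdBasis, dualPair, hd, hk 0 1, hk 0 2, hk 0 3, hk 1 2, hk 2 3, hk 3 1]

/-- The antisymmetric matrix of the connection induced on the self-dual bivectors. -/
def sdRotation (s : Fin 3 → ℂ) : Matrix (Fin 3) (Fin 3) ℂ :=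
  Matrix.of fun A C ↦ 2 * Complex.I * ∑ D, levi3 A D C * s D

theorem levi3_swap (A B C : Fin 3) : levi3 B A C = -levi3 A B C := by
  unfold levi3; ring

/-- The anti-self-dual half of `h` drops out of the commutator, and the Pauli relations give 2i ε
for the self-dual half. -/
theorem sdBasis_mul_sub {h : Matrix (Fin 4) (Fin 4) ℝ} (hh : hᵀ = -h) (A : Fin 3) :
    sdBasis A * mink * h.map Complex.ofRealHom - h.map Complex.ofRealHom * mink * sdBasis A =
      ∑ C, sdRotation (sdCoeff h) A C • sdBasis C := by
  rw [map_eq_sum_sdCoeff hh]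
  simp only [Matrix.mul_sum, Matrix.sum_mul, Matrix.mul_add, Matrix.add_mul, Matrix.mul_smul,
    Matrix.smul_mul, sdBasis_commute_conj, ← Finset.sum_sub_distrib, add_sub_add_right_eq_sub,
    ← smul_sub]
  have h1 : ∀ D, sdBasis A * mink * sdBasis D - sdBasis D * mink * sdBasis A =
      (2 * Complex.I) • ∑ C, levi3 A D C • sdBasis C := fun D ↦ by
    rw [sdBasis_mul_mink_mul, sdBasis_mul_mink_mul]
    simp only [levi3_swap A D, neg_smul, Finset.sum_neg_distrib, smul_neg, eq_comm (a := D)]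
    rw [two_mul, add_smul]
    abel
  simp only [h1, Finset.smul_sum, sdRotation, Matrix.of_apply, Finset.mul_sum, Finset.sum_smul]
  rw [Finset.sum_comm]
  refine Finset.sum_congr rfl fun C _ ↦ Finset.sum_congr rfl fun D _ ↦ ?_
  rw [smul_smul, smul_smul]
  congr 1; ring

section

variable {g : Coord → Matrix (Fin 4) (Fin 4) ℝ} {y : Coord} {T : Matrix (Fin 4) (Fin 4) ℂ}

/-- By the Pauli relations, contracting the two inner indices separates `Q` into its trace, which
multiplies the metric, and its antisymmetric part, which gives a self-dual bivector. -/
theorem sum_ginv_dbl (hT : T * Matrix.of (ginv g y) * Tᵀ = mink) (Q : Matrix (Fin 3) (Fin 3) ℂ) :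
    (Matrix.of fun a r ↦ ∑ b, ∑ b', ginv g y b b' * dbl T Q a b b' r) =
      (-(1 / 2) * Q.trace) • (Tᵀ * mink * T) +
        ∑ C, (-(1 / 2) * Complex.I * ∑ A, ∑ B, Q A B * levi3 A B C) • sdBiv T C := by
  have h1 : (Matrix.of fun a r ↦ ∑ b, ∑ b', ginv g y b b' * dbl T Q a b b' r) =
      ∑ A, ∑ B, (-(1 / 2) * Q A B) • (sdBiv T A * Matrix.of (ginv g y) * sdBiv T B) := by
    ext a r
    simp only [Matrix.of_apply, dbl, Matrix.sum_apply, Matrix.smul_apply, smul_eq_mul,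
      Matrix.mul_apply, Finset.mul_sum, Finset.sum_mul]
    calc _ = ∑ b, ∑ A, ∑ b', ∑ B, ginv g y b b' * (-(1 / 2) * (Q A B * sdBiv T A a b * sdBiv T B b' r)) :=
          Finset.sum_congr rfl fun _ _ ↦ Finset.sum_comm
      _ = ∑ A, ∑ b, ∑ b', ∑ B, ginv g y b b' * (-(1 / 2) * (Q A B * sdBiv T A a b * sdBiv T B b' r)) :=
          Finset.sum_comm
      _ = ∑ A, ∑ b, ∑ B, ∑ b', ginv g y b b' * (-(1 / 2) * (Q A B * sdBiv T A a b * sdBiv T B b' r)) :=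
          Finset.sum_congr rfl fun _ _ ↦ Finset.sum_congr rfl fun _ _ ↦ Finset.sum_comm
      _ = ∑ A, ∑ B, ∑ b, ∑ b', ginv g y b b' * (-(1 / 2) * (Q A B * sdBiv T A a b * sdBiv T B b' r)) :=
          Finset.sum_congr rfl fun _ _ ↦ Finset.sum_comm
      _ = _ := by
        refine Finset.sum_congr rfl fun A _ ↦ Finset.sum_congr rfl fun B _ ↦ ?_
        rw [Finset.sum_comm]
        exact Finset.sum_congr rfl fun _ _ ↦ Finset.sum_congr rfl fun _ _ ↦ by ring
  rw [h1]
  simp only [sdBiv_mul_mul hT, Fin.sum_univ_three, Matrix.trace, Matrix.diag_apply]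
  simp [levi3]
  module

/-- The triple contraction in 𝓧 is a product of double bivectors followed by one inner contraction,
so `sum_ginv_dbl` applies to it. -/
theorem tensor_contract (A : Fin 4 → Fin 4 → Fin 4 → Fin 4 → ℂ)
    (B : Fin 4 → Fin 4 → Fin 4 → Fin 4 → ℂ) (a r : Fin 4) :
    (1 / 2) * ∑ b, ∑ m, ∑ n, ∑ b', ∑ m', ∑ n',
      A a b m n * ginv g y m m' * ginv g y n n' * ginv g y b b' * B m' n' b' r =
    ∑ b, ∑ b', ginv g y b b' * dblMul g y A B a b b' r := by
  simp only [dblMul, Finset.mul_sum]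
  refine Finset.sum_congr rfl fun b _ ↦ ?_
  calc _ = ∑ m, ∑ b', ∑ n, ∑ m', ∑ n', 1 / 2 *
          (A a b m n * ginv g y m m' * ginv g y n n' * ginv g y b b' * B m' n' b' r) :=
        Finset.sum_congr rfl fun _ _ ↦ Finset.sum_comm
    _ = ∑ b', ∑ m, ∑ n, ∑ m', ∑ n', 1 / 2 *
          (A a b m n * ginv g y m m' * ginv g y n n' * ginv g y b b' * B m' n' b' r) :=
        Finset.sum_comm
    _ = _ := Finset.sum_congr rfl fun _ _ ↦ Finset.sum_congr rfl fun _ _ ↦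
        Finset.sum_congr rfl fun _ _ ↦ Finset.sum_congr rfl fun _ _ ↦
        Finset.sum_congr rfl fun _ _ ↦ by ring

theorem pairing_mink_sdBasis (A : Fin 3) : pairing mink mink (sdBasis A) = 0 := by
  rw [pairing_mink]
  fin_cases A <;> simp [mink, sdBasis, Fin.sum_univ_four, Matrix.diagonal_apply]

theorem sum_dbl_right (hT : T * Matrix.of (ginv g y) * Tᵀ = mink) (R : Matrix (Fin 3) (Fin 3) ℂ)
    (X : Fin 4 → Fin 4 → ℂ) (c : ℂ) (x : Fin 3 → ℂ)
    (hX : Matrix.of X = c • (Tᵀ * mink * T) + ∑ C, x C • sdBiv T C) (m n : Fin 4) :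
    ∑ l, ∑ r, ∑ l', ∑ r', X l r * ginv g y l l' * ginv g y r r' * dbl T R l' r' m n =
      2 * ∑ A, x A * ∑ B, R A B * sdBiv T B m n := by
  have h1 : ∑ l, ∑ r, ∑ l', ∑ r', X l r * ginv g y l l' * ginv g y r r' * dbl T R l' r' m n =
      2 * pairing (Matrix.of (ginv g y)) (Matrix.of X)
        (Matrix.of fun i j ↦ dbl T R i j m n) := by
    rw [pairing_eq_sum]; simp only [Matrix.of_apply]; ring
  have h2 : ∀ A, pairing (Matrix.of (ginv g y)) (Matrix.of X) (sdBiv T A) = -2 * x A := fun A ↦ by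
    -- The metric term is adjoined as a fourth summand indexed by `none`; it pairs to zero with
    -- bivectors, being symmetric.
    have e : Matrix.of X = ∑ p : Option (Fin 3), (p.elim c x) •
        (p.elim (Tᵀ * mink * T) (sdBiv T)) := by
      rw [hX, Fintype.sum_option]; rfl
    rw [e, pairing_sum_left, Fintype.sum_option]
    simp only [Option.elim, pairing_sdBiv hT]
    rw [sdBiv, pairing_congr hT, pairing_mink_sdBasis]
    simp [mul_comm]
  rw [h1, dbl_right, pairing_sum_right]
  simp only [h2, Finset.mul_sum, Finset.sum_mul]
  exact Finset.sum_congr rfl fun _ _ ↦ Finset.sum_congr rfl fun _ _ ↦ by ring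

end

theorem eq_of_dbl_eq {G T : Matrix (Fin 4) (Fin 4) ℂ} (h : T * G * Tᵀ = mink)
    {Q R : Matrix (Fin 3) (Fin 3) ℂ} (hQR : dbl T Q = dbl T R) : Q = R := by
  have h1 : ∀ i j B, ∑ A, Q A B * sdBiv T A i j = ∑ A, R A B * sdBiv T A i j := fun i j B ↦ by
    have := congrFun (eq_of_sum_sdBiv h ((dbl_left T Q i j).symm.trans
      ((by rw [hQR] : _ = _).trans (dbl_left T R i j)))) B
    simpa using this
  ext A B
  refine congrFun (eq_of_sum_sdBiv h (x := fun A ↦ Q A B) (y := fun A ↦ R A B) ?_) A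
  ext i j
  simpa [Matrix.sum_apply] using h1 i j B

end

/-! ### The connection of a smooth orthonormal frame -/

section

open Matrix

section smoothness

variable {g : Coord → Matrix (Fin 4) (Fin 4) ℝ} {U : Set Coord}

theorem contDiffOn_ofReal {f : Coord → ℝ} (hf : ContDiffOn ℝ ∞ f U) :
    ContDiffOn ℝ ∞ (fun z ↦ (f z : ℂ)) U :=
  Complex.ofRealCLM.contDiff.comp_contDiffOn hf

theorem IsSmoothMetricOn.contDiffOn_weyl (hg : IsSmoothMetricOn g U) (i j k l : Fin 4) :
    ContDiffOn ℝ ∞ (fun z ↦ weyl g z i j k l) U := by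
  have hR : ∀ n c a b, ContDiffOn ℝ ∞ (fun z ↦ riemannUp g z n c a b) U := fun n c a b ↦ by
    have h := hg.contDiffOn_christoffel
    exact ((contDiffOn_pd a hg.isOpen (h n c b)).sub (contDiffOn_pd b hg.isOpen (h n c a))).add
      (ContDiffOn.sum fun m _ ↦ ((h m c b).mul (h n m a)).sub ((h m c a).mul (h n m b)))
  have hR' : ∀ n c a b, ContDiffOn ℝ ∞ (fun z ↦ riemann g z n c a b) U := fun n c a b ↦
    ContDiffOn.sum fun m _ ↦ (hg.smooth n m).mul (hR m c a b)
  have hr : ∀ c b, ContDiffOn ℝ ∞ (fun z ↦ ricci g z c b) U := fun c b ↦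
    ContDiffOn.sum fun n _ ↦ hR n c n b
  have hs : ContDiffOn ℝ ∞ (fun z ↦ scalarCurv g z) U :=
    ContDiffOn.sum fun i _ ↦ ContDiffOn.sum fun j _ ↦ (hg.contDiffOn_inv i j).mul (hr i j)
  exact ((hR' i j k l).sub (contDiffOn_const.mul
    (((((hg.smooth i k).mul (hr j l)).sub ((hg.smooth i l).mul (hr j k))).add
      ((hg.smooth j l).mul (hr i k))).sub ((hg.smooth j k).mul (hr i l))))).add
    ((hs.div_const 6).mul (((hg.smooth i k).mul (hg.smooth j l)).sub
      ((hg.smooth i l).mul (hg.smooth j k))))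

theorem IsSmoothMetricOn.contDiffOn_frameWeyl (hg : IsSmoothMetricOn g U)
    {E : Coord → Matrix (Fin 4) (Fin 4) ℝ} (hE : ∀ a i, ContDiffOn ℝ ∞ (fun z ↦ E z a i) U)
    (A B : Fin 3) : ContDiffOn ℝ ∞ (fun z ↦ frameWeyl g z (E z) A B) U := by
  have hp : ∀ a b c d, ContDiffOn ℝ ∞ (fun z ↦ pull4 ((E z).map Complex.ofRealHom)ᵀ
      (fun i j k l ↦ (weyl g z i j k l : ℂ)) a b c d) U := fun a b c d ↦
    ContDiffOn.sum fun i _ ↦ ContDiffOn.sum fun j _ ↦ ContDiffOn.sum fun k _ ↦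
      ContDiffOn.sum fun l _ ↦ ((((contDiffOn_ofReal (hE a i)).mul
        (contDiffOn_ofReal (hE b j))).mul (contDiffOn_ofReal (hE c k))).mul
        (contDiffOn_ofReal (hE d l))).mul (contDiffOn_ofReal (hg.contDiffOn_weyl i j k l))
  exact contDiffOn_const.mul (contDiffOn_const.mul ((hp _ _ _ _).sub (contDiffOn_const.mul
    (contDiffOn_const.mul (ContDiffOn.sum fun c _ ↦ ContDiffOn.sum fun d _ ↦
      contDiffOn_const.mul (hp _ _ _ _))))))

end smoothness

/-- The matrix `θ^c(∇_l e_a)` of a frame. -/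
def connMatrix (g : Coord → Matrix (Fin 4) (Fin 4) ℝ) (e : Coord → Fin 4 → Fin 4 → ℝ) (y : Coord)
    (l : Fin 4) : Matrix (Fin 4) (Fin 4) ℝ :=
  Matrix.of fun c a ↦ ∑ m, coframe e y c m * nablaFrame g e y a l m

/-- The covariant derivative of the dual basis of a frame. -/
def nablaCoframe (g : Coord → Matrix (Fin 4) (Fin 4) ℝ) (e : Coord → Fin 4 → Fin 4 → ℝ)
    (y : Coord) (l : Fin 4) : Matrix (Fin 4) (Fin 4) ℝ :=
  Matrix.of fun a i ↦ pd l (fun z ↦ coframe e z a i) y - ∑ s, christoffel g y s l i * coframe e y a s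

/-- A smooth oriented orthonormal frame on the open set `U`. -/
structure IsSmoothFrameOn (g : Coord → Matrix (Fin 4) (Fin 4) ℝ)
    (η : Coord → Fin 4 → Fin 4 → Fin 4 → Fin 4 → ℝ) (U : Set Coord)
    (e : Coord → Fin 4 → Fin 4 → ℝ) : Prop where
  metric : IsSmoothMetricOn g U
  smooth : ∀ a i, ContDiffOn ℝ ∞ (fun z ↦ e z a i) U
  frame : ∀ z ∈ U, IsOrientedFrame (g z) (η z) (Matrix.of (e z))

namespace IsSmoothFrameOn

variable {g : Coord → Matrix (Fin 4) (Fin 4) ℝ} {η : Coord → Fin 4 → Fin 4 → Fin 4 → Fin 4 → ℝ}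
  {U : Set Coord} {e : Coord → Fin 4 → Fin 4 → ℝ} (he : IsSmoothFrameOn g η U e) {y : Coord}
include he

theorem contDiffOn_coframe (a i : Fin 4) : ContDiffOn ℝ ∞ (fun z ↦ coframe e z a i) U :=
  contDiffOn_inv (A := fun z ↦ Matrix.of (e z)) he.smooth
    (fun z hz ↦ (he.frame z hz).isUnit_det.ne_zero) i a

theorem nhds (hy : y ∈ U) : U ∈ nhds y := he.metric.isOpen.mem_nhds hy

theorem differentiableAt {F : Type*} [NormedAddCommGroup F] [NormedSpace ℝ F] {f : Coord → F}
    (hf : ContDiffOn ℝ ∞ f U) (hy : y ∈ U) : DifferentiableAt ℝ f y :=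
  (hf.contDiffAt (he.nhds hy)).differentiableAt (by simp)

theorem sum_coframe_mul (hy : y ∈ U) (a b : Fin 4) : ∑ i, coframe e y a i * e y b i =
    (1 : Matrix (Fin 4) (Fin 4) ℝ) b a := by
  have h := (he.frame y hy).mul_inv
  rw [← h, Matrix.mul_apply]
  exact Finset.sum_congr rfl fun _ _ ↦ mul_comm _ _

theorem sum_mul_coframe (hy : y ∈ U) (i j : Fin 4) : ∑ a, e y a i * coframe e y a j =
    (1 : Matrix (Fin 4) (Fin 4) ℝ) j i := by
  have h := (he.frame y hy).inv_mul
  rw [← h, Matrix.mul_apply]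
  exact Finset.sum_congr rfl fun _ _ ↦ mul_comm _ _

/-- Leibniz rule applied to the constant functions θ^a(e_b). -/
theorem nablaCoframe_eq (hy : y ∈ U) (l : Fin 4) : nablaCoframe g e y l =
    -(connMatrix g e y l * ((Matrix.of (e y))⁻¹)ᵀ) := by
  have hθ := fun a i ↦ he.differentiableAt (he.contDiffOn_coframe a i) hy
  have hd := fun a i ↦ he.differentiableAt (he.smooth a i) hy
  have h1 : nablaCoframe g e y l * (Matrix.of (e y))ᵀ = -connMatrix g e y l := by
    ext a b
    have h0 : pd l (fun z ↦ ∑ i, coframe e z a i * e z b i) y = 0 := by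
      rw [pd_congr l (Filter.eventually_of_mem (he.nhds hy) fun z hz ↦ he.sum_coframe_mul hz a b),
        pd_const]
    rw [pd_sum l _ (f := fun i z ↦ coframe e z a i * e z b i)
      fun i _ ↦ (hθ a i).fun_mul (hd b i)] at h0
    simp only [pd_mul l (hθ a _) (hd b _), Finset.sum_add_distrib] at h0
    have h2 : ∑ i, (∑ s, christoffel g y s l i * coframe e y a s) * e y b i =
        ∑ i, coframe e y a i * ∑ n, christoffel g y i l n * e y b n := by
      simp only [Finset.sum_mul, Finset.mul_sum]
      rw [Finset.sum_comm]
      exact Finset.sum_congr rfl fun _ _ ↦ Finset.sum_congr rfl fun _ _ ↦ by ring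
    simp only [Matrix.mul_apply, nablaCoframe, Matrix.of_apply, Matrix.transpose_apply,
      Matrix.neg_apply, connMatrix, nablaFrame, sub_mul, Finset.sum_sub_distrib, mul_add,
      Finset.sum_add_distrib]
    rw [h2]
    linear_combination h0
  have h' : (Matrix.of (e y))ᵀ * ((Matrix.of (e y))⁻¹)ᵀ = 1 := by
    rw [← Matrix.transpose_mul, (he.frame y hy).inv_mul, Matrix.transpose_one]
  rw [← Matrix.neg_mul, ← h1, Matrix.mul_assoc, h', Matrix.mul_one]

theorem metric_apply (hy : y ∈ U) (n m : Fin 4) :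
    g y n m = ∑ c, minkowski c c * (coframe e y c n * coframe e y c m) := by
  have h := congrFun (congrFun (he.frame y hy).metric_eq n) m
  rw [h]
  simp only [Matrix.mul_apply, Matrix.of_apply, minkowski, Matrix.transpose_apply, coframe]
  refine Finset.sum_congr rfl fun c _ ↦ ?_
  simp only [mul_ite, mul_zero, Finset.sum_ite_eq', Finset.mem_univ, if_true]
  split_ifs <;> ring

/-- Metric compatibility: differentiating g = Σ ± θ^c ⊗ θ^c and comparing with ∂g puts the
connection in the Lorentz algebra, so that it is a real bivector. -/
theorem connMatrix_anti (hy : y ∈ U) (l : Fin 4) :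
    (connMatrix g e y l)ᵀ * Matrix.of minkowski = -(Matrix.of minkowski * connMatrix g e y l) := by
  have hθ := fun a i ↦ he.differentiableAt (he.contDiffOn_coframe a i) hy
  set θ : Matrix (Fin 4) (Fin 4) ℝ := ((Matrix.of (e y))⁻¹)ᵀ with hθdef
  have h1 : (nablaCoframe g e y l)ᵀ * Matrix.of minkowski * θ +
      θᵀ * Matrix.of minkowski * nablaCoframe g e y l = 0 := by
    ext n m
    have h0 := he.metric.pd_metric hy l n m
    rw [pd_congr l (Filter.eventually_of_mem (he.nhds hy) fun z hz ↦ he.metric_apply hz n m),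
      pd_sum l _ (f := fun c z ↦ minkowski c c * (coframe e z c n * coframe e z c m))
        fun c _ ↦ ((hθ c n).fun_mul (hθ c m)).const_mul _] at h0
    simp only [pd_const_mul l ((hθ _ n).fun_mul (hθ _ m)), pd_mul l (hθ _ n) (hθ _ m)] at h0
    have h2 : ∀ n m, christoffelLower g y n l m = ∑ c, minkowski c c * (coframe e y c n *
        ∑ s, christoffel g y s l m * coframe e y c s) := fun n m ↦ by
      rw [← he.metric.lower_christoffel hy]
      simp only [he.metric_apply hy n, Finset.sum_mul, Finset.mul_sum]
      rw [Finset.sum_comm]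
      exact Finset.sum_congr rfl fun _ _ ↦ Finset.sum_congr rfl fun _ _ ↦ by ring
    rw [h2, h2] at h0
    have h3 : ∀ A B : Matrix (Fin 4) (Fin 4) ℝ, (Aᵀ * Matrix.of minkowski * B) n m =
        ∑ c, minkowski c c * (A c n * B c m) := fun A B ↦ by
      simp only [Matrix.mul_apply, Matrix.of_apply, minkowski, Matrix.transpose_apply]
      refine Finset.sum_congr rfl fun c _ ↦ ?_
      simp only [mul_ite, mul_zero, Finset.sum_ite_eq', Finset.mem_univ, if_true]
      split_ifs <;> ring
    rw [Matrix.add_apply, h3, h3, Matrix.zero_apply, ← sub_eq_zero.mpr h0]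
    simp only [← Finset.sum_add_distrib, ← Finset.sum_sub_distrib, nablaCoframe, Matrix.of_apply]
    refine Finset.sum_congr rfl fun c _ ↦ ?_
    change minkowski c c * (_ * coframe e y c m) + minkowski c c * (coframe e y c n * _) = _
    ring
  rw [he.nablaCoframe_eq hy, ← hθdef] at h1
  have hθE : θ * (Matrix.of (e y))ᵀ = 1 := by
    rw [hθdef, ← Matrix.transpose_mul, (he.frame y hy).mul_inv, Matrix.transpose_one]
  have hEθ : Matrix.of (e y) * θᵀ = 1 := by
    rw [hθdef, Matrix.transpose_transpose, (he.frame y hy).mul_inv]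
  -- Evaluation on the frame vectors removes the invertible coframe factors on both sides.
  have h4 := congrArg (fun M ↦ Matrix.of (e y) * M * (Matrix.of (e y))ᵀ) h1
  have h5 : ∀ M : Matrix (Fin 4) (Fin 4) ℝ,
      Matrix.of (e y) * (θᵀ * M * θ) * (Matrix.of (e y))ᵀ = M := fun M ↦ by
    calc _ = (Matrix.of (e y) * θᵀ) * M * (θ * (Matrix.of (e y))ᵀ) := by
          simp only [Matrix.mul_assoc]
      _ = M := by rw [hθE, hEθ, Matrix.one_mul, Matrix.mul_one]
  have h6 : (-(connMatrix g e y l * θ))ᵀ * Matrix.of minkowski * θ +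
      θᵀ * Matrix.of minkowski * -(connMatrix g e y l * θ) =
      θᵀ * (-((connMatrix g e y l)ᵀ * Matrix.of minkowski +
        Matrix.of minkowski * connMatrix g e y l)) * θ := by
    rw [Matrix.transpose_neg, Matrix.transpose_mul]
    noncomm_ring
  rw [h6, h5] at h4
  simp only [Matrix.mul_zero, Matrix.zero_mul, neg_eq_zero] at h4
  exact eq_neg_of_add_eq_zero_left h4

/-- Summing over the direction index uses completeness of the frame and restores the coordinate
direction `l`. What remains is the connection bivector carried from the frame to coordinates. -/
theorem connectionTensor_eq (hy : y ∈ U) (l n m : Fin 4) : connectionTensor g e y l n m =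
    ((Matrix.of (e y))⁻¹ * ((connMatrix g e y l)ᵀ * Matrix.of minkowski) *
      ((Matrix.of (e y))⁻¹)ᵀ) n m := by
  have hl : ∀ c, ∑ s, g y m s * e y c s = minkowski c c * coframe e y c m := fun c ↦ by
    have := lower_frame (he.frame y hy) m c
    rw [mink_apply, show dualBasis (Matrix.of (e y)) c m = ((coframe e y c m : ℝ) : ℂ) from rfl,
      ← Complex.ofReal_mul] at this
    exact Complex.ofReal_injective this
  have h1 : ∀ a c, ∑ b, connCoeff g e y c a b * coframe e y b l = connMatrix g e y l c a :=
      fun a c ↦ by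
    simp only [connCoeff, connMatrix, Matrix.of_apply, Finset.sum_mul]
    rw [Finset.sum_comm]
    have h2 : ∀ l', ∑ b, ∑ m', coframe e y c m' * e y b l' * nablaFrame g e y a l' m' *
        coframe e y b l = (∑ b, e y b l' * coframe e y b l) *
          ∑ m', coframe e y c m' * nablaFrame g e y a l' m' := fun l' ↦ by
      rw [Finset.sum_mul_sum]
      exact Finset.sum_congr rfl fun _ _ ↦ Finset.sum_congr rfl fun _ _ ↦ by ring
    simp only [h2, he.sum_mul_coframe hy, Matrix.one_apply, ite_mul, one_mul, zero_mul,
      Finset.sum_ite_eq, Finset.mem_univ, if_true]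
  simp only [connectionTensor, hl]
  have h3 : ∀ a, ∑ b, ∑ c, connCoeff g e y c a b * coframe e y b l * coframe e y a n *
      (minkowski c c * coframe e y c m) = ∑ c, connMatrix g e y l c a * coframe e y a n *
      (minkowski c c * coframe e y c m) := fun a ↦ by
    rw [Finset.sum_comm]
    simp only [← Finset.sum_mul, h1]
  simp only [h3]
  simp only [Matrix.mul_apply, Matrix.of_apply, minkowski, Matrix.transpose_apply, coframe,
    Finset.sum_mul, Finset.mul_sum]
  rw [Finset.sum_comm]
  refine Finset.sum_congr rfl fun c _ ↦ Finset.sum_congr rfl fun a _ ↦ ?_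
  simp only [mul_ite, mul_zero, ite_mul, zero_mul, Finset.sum_ite_eq', Finset.mem_univ, if_true]
  split_ifs <;> ring

end IsSmoothFrameOn

end

/-! ### The covariant derivative of the self-dual Weyl tensor -/

section

open Matrix

theorem nablaSdWeyl_dbl {g : Coord → Matrix (Fin 4) (Fin 4) ℝ}
    {η : Coord → Fin 4 → Fin 4 → Fin 4 → Fin 4 → ℝ} {y : Coord}
    {u : Fin 3 → Coord → Fin 4 → Fin 4 → ℂ} {α : Fin 3 → Coord → ℂ}
    (hW : ∀ i j k l, (fun z ↦ sdWeyl g η z i j k l) =ᶠ[nhds y]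
      fun z ↦ ∑ A, α A z * (u A z i j * u A z k l))
    (hu : ∀ A i j, DifferentiableAt ℝ (fun z ↦ u A z i j) y)
    (hα : ∀ A, DifferentiableAt ℝ (α A) y) (m i j k l : Fin 4)
    (Du : Fin 3 → Fin 4 → Fin 4 → ℂ)
    (hDu : ∀ A i j, Du A i j = pd m (fun z ↦ u A z i j) y -
      ∑ s, ((christoffel g y s m i : ℂ) * u A y s j + (christoffel g y s m j : ℂ) * u A y i s)) :
    nablaSdWeyl g η y m i j k l = ∑ A, (pd m (α A) y * (u A y i j * u A y k l) +
      α A y * (Du A i j * u A y k l + u A y i j * Du A k l)) := by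
  have hpd : pd m (fun z ↦ sdWeyl g η z i j k l) y = ∑ A, (pd m (α A) y * (u A y i j * u A y k l) +
      α A y * (pd m (fun z ↦ u A z i j) y * u A y k l +
        u A y i j * pd m (fun z ↦ u A z k l) y)) := by
    rw [pd_congr m (hW i j k l), pd_sum m _ (f := fun A z ↦ α A z * (u A z i j * u A z k l))
      fun A _ ↦ (hα A).fun_mul ((hu A i j).fun_mul (hu A k l))]
    refine Finset.sum_congr rfl fun A _ ↦ ?_
    rw [pd_mul m (hα A) ((hu A i j).fun_mul (hu A k l)), pd_mul m (hu A i j) (hu A k l)]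
  have hW' : ∀ i j k l, sdWeyl g η y i j k l = ∑ A, α A y * (u A y i j * u A y k l) :=
    fun i j k l ↦ (hW i j k l).self_of_nhds
  rw [nablaSdWeyl, hpd]
  simp only [hW', hDu]
  have h : ∑ s, ((christoffel g y s m i : ℂ) * ∑ A, α A y * (u A y s j * u A y k l) +
      (christoffel g y s m j : ℂ) * ∑ A, α A y * (u A y i s * u A y k l) +
      (christoffel g y s m k : ℂ) * ∑ A, α A y * (u A y i j * u A y s l) +
      (christoffel g y s m l : ℂ) * ∑ A, α A y * (u A y i j * u A y k s)) =
      ∑ A, α A y * ((∑ s, ((christoffel g y s m i : ℂ) * u A y s j +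
        (christoffel g y s m j : ℂ) * u A y i s)) * u A y k l +
        u A y i j * ∑ s, ((christoffel g y s m k : ℂ) * u A y s l +
        (christoffel g y s m l : ℂ) * u A y k s)) := by
    simp only [Finset.mul_sum, Finset.sum_mul, ← Finset.sum_add_distrib]
    rw [Finset.sum_comm]
    exact Finset.sum_congr rfl fun _ _ ↦ Finset.sum_congr rfl fun _ _ ↦ by ring
  rw [h, ← Finset.sum_sub_distrib]
  exact Finset.sum_congr rfl fun A _ ↦ by ring

namespace IsSmoothFrameOn

variable {g : Coord → Matrix (Fin 4) (Fin 4) ℝ} {η : Coord → Fin 4 → Fin 4 → Fin 4 → Fin 4 → ℝ}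
  {U : Set Coord} {e : Coord → Fin 4 → Fin 4 → ℝ} (he : IsSmoothFrameOn g η U e) {y : Coord}
include he

theorem sdWeyl_eq_dbl (hy : y ∈ U) : sdWeyl g η y =
    dbl (dualBasis (Matrix.of (e y))) (frameWeyl g y (Matrix.of (e y))) :=
  sdWeyl_eq (he.frame y hy) (he.metric.hasWeylSymmetries hy)

theorem frameWeyl_trace (hy : y ∈ U) : (frameWeyl g y (Matrix.of (e y))).trace = 0 :=
  (isWeylLike_frame (he.frame y hy) (he.metric.hasWeylSymmetries hy)).weylMatrix_trace

theorem frameWeyl_symm (hy : y ∈ U) :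
    (frameWeyl g y (Matrix.of (e y)))ᵀ = frameWeyl g y (Matrix.of (e y)) :=
  (isWeylLike_frame (he.frame y hy) (he.metric.hasWeylSymmetries hy)).weylMatrix_symm

/-- The two factors 1/√2 in the 𝓤_A multiply to the 1/2 of `dbl`, and the matrix of a double
bivector is unique. -/
theorem diagonalizesWeyl_iff (hy : y ∈ U) : DiagonalizesWeyl g η e y ↔
    ∃ α, frameWeyl g y (Matrix.of (e y)) = Matrix.diagonal α := by
  have h2 : (1 / (Real.sqrt 2 : ℂ)) * (1 / (Real.sqrt 2 : ℂ)) = 1 / 2 := by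
    rw [div_mul_div_comm, one_mul, ← Complex.ofReal_mul, Real.mul_self_sqrt (by norm_num)]
    norm_num
  have h1 : ∀ α : Fin 3 → ℂ, (∀ i j k l, sdWeyl g η y i j k l =
      -∑ A, α A * sdFrameBivector g η e y A i j * sdFrameBivector g η e y A k l) ↔
      sdWeyl g η y = dbl (dualBasis (Matrix.of (e y))) (Matrix.diagonal α) := fun α ↦ by
    have : ∀ i j k l, -∑ A, α A * sdFrameBivector g η e y A i j * sdFrameBivector g η e y A k l =
        dbl (dualBasis (Matrix.of (e y))) (Matrix.diagonal α) i j k l := fun i j k l ↦ by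
      rw [dbl, ← Finset.sum_neg_distrib, Finset.mul_sum]
      refine Finset.sum_congr rfl fun A _ ↦ ?_
      simp only [sdFrameBivector_eq (he.frame y hy) e rfl, Matrix.diagonal_apply, ite_mul,
        zero_mul, Finset.sum_ite_eq, Finset.mem_univ, if_true]
      linear_combination (-(α A * sdBiv (dualBasis (Matrix.of (e y))) A i j *
        sdBiv (dualBasis (Matrix.of (e y))) A k l)) * h2
    simp only [this, funext_iff]
  refine exists_congr fun α ↦ (h1 α).trans ?_
  rw [he.sdWeyl_eq_dbl hy]
  exact ⟨eq_of_dbl_eq (dual_mul_ginv_mul (he.frame y hy)), fun h ↦ by rw [h]⟩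

/-- The real bivector of the connection in the direction `l`. -/
theorem connBivector_transpose (hy : y ∈ U) (l : Fin 4) :
    ((connMatrix g e y l)ᵀ * Matrix.of minkowski)ᵀ =
      -((connMatrix g e y l)ᵀ * Matrix.of minkowski) := by
  rw [Matrix.transpose_mul, Matrix.transpose_transpose, minkowski_transpose,
    he.connMatrix_anti hy, neg_neg]

/-- The frame components of u_A are constant, so its derivative comes from the coframe alone and is
the commutator with the connection bivector. -/
theorem nabla_sdBiv (hy : y ∈ U) (l : Fin 4) (A : Fin 3) (i j : Fin 4) :
    pd l (fun z ↦ sdBiv (dualBasis (Matrix.of (e z))) A i j) y -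
      ∑ s, ((christoffel g y s l i : ℂ) * sdBiv (dualBasis (Matrix.of (e y))) A s j +
        (christoffel g y s l j : ℂ) * sdBiv (dualBasis (Matrix.of (e y))) A i s) =
      ∑ C, sdRotation (sdCoeff ((connMatrix g e y l)ᵀ * Matrix.of minkowski)) A C *
        sdBiv (dualBasis (Matrix.of (e y))) C i j := by
  set T := dualBasis (Matrix.of (e y)) with hT
  set h := (connMatrix g e y l)ᵀ * Matrix.of minkowski with hh
  have hθ : ∀ a i, DifferentiableAt ℝ (fun z ↦ ((coframe e z a i : ℝ) : ℂ)) y := fun a i ↦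
    he.differentiableAt (contDiffOn_ofReal (he.contDiffOn_coframe a i)) hy
  have hθ' := fun a i ↦ he.differentiableAt (he.contDiffOn_coframe a i) hy
  obtain ⟨D, hD⟩ : ∃ D, D = (nablaCoframe g e y l).map Complex.ofRealHom := ⟨_, rfl⟩
  have hanti : hᵀ = -h := he.connBivector_transpose hy l
  -- Metric compatibility rewrites ∇θ = -γ θ by means of the bivector `h`, which is γ with an index
  -- lowered.
  have hDT : D = mink * h.map Complex.ofRealHom * T := by
    have h1 : -connMatrix g e y l = Matrix.of minkowski * h := by
      have := he.connMatrix_anti hy l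
      rw [hh, this, Matrix.mul_neg, ← Matrix.mul_assoc, minkowski_mul_self, Matrix.one_mul]
    rw [hD, he.nablaCoframe_eq hy, ← Matrix.neg_mul, h1, Matrix.map_mul, Matrix.map_mul,
      map_minkowski, hT, dualBasis]
  have hmain : pd l (fun z ↦ sdBiv (dualBasis (Matrix.of (e z))) A i j) y -
      ∑ s, ((christoffel g y s l i : ℂ) * sdBiv T A s j +
        (christoffel g y s l j : ℂ) * sdBiv T A i s) =
      (Dᵀ * sdBasis A * T + Tᵀ * sdBasis A * D) i j := by
    have e1 : ∀ z i j, sdBiv (dualBasis (Matrix.of (e z))) A i j =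
        ∑ a, ∑ b, sdBasis A a b * ((coframe e z a i : ℂ) * (coframe e z b j : ℂ)) := fun z i j ↦ by
      rw [sdBiv, sandwich_apply]
      refine Finset.sum_congr rfl fun a _ ↦ Finset.sum_congr rfl fun b _ ↦ ?_
      rw [mul_comm]; rfl
    have e2 : ∀ M N : Matrix (Fin 4) (Fin 4) ℂ, ∀ i j, (Mᵀ * sdBasis A * N) i j =
        ∑ a, ∑ b, sdBasis A a b * (M a i * N b j) := fun M N i j ↦ by
      simp only [Matrix.mul_apply, Matrix.transpose_apply, Finset.sum_mul]
      rw [Finset.sum_comm]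
      exact Finset.sum_congr rfl fun _ _ ↦ Finset.sum_congr rfl fun _ _ ↦ by ring
    have e3 : ∀ a i, D a i = pd l (fun z ↦ ((coframe e z a i : ℝ) : ℂ)) y -
        ∑ s, (christoffel g y s l i : ℂ) * (coframe e y a s : ℂ) := fun a i ↦ by
      rw [pd_ofReal l (hθ' a i), hD]
      simp [nablaCoframe]
    rw [Matrix.add_apply, e2, e2]
    simp only [e1, hT]
    rw [pd_sum l _ (f := fun a z ↦ ∑ b, sdBasis A a b *
      ((coframe e z a i : ℂ) * (coframe e z b j : ℂ))) fun a _ ↦ DifferentiableAt.fun_sum fun b _ ↦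
        ((hθ a i).fun_mul (hθ b j)).const_mul _]
    have e4 : ∀ a, pd l (fun z ↦ ∑ b, sdBasis A a b *
        ((coframe e z a i : ℂ) * (coframe e z b j : ℂ))) y = ∑ b, sdBasis A a b *
        (pd l (fun z ↦ ((coframe e z a i : ℝ) : ℂ)) y * (coframe e y b j : ℂ) +
        (coframe e y a i : ℂ) * pd l (fun z ↦ ((coframe e z b j : ℝ) : ℂ)) y) := fun a ↦ by
      rw [pd_sum l _ (f := fun b z ↦ sdBasis A a b *
        ((coframe e z a i : ℂ) * (coframe e z b j : ℂ))) fun b _ ↦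
        ((hθ a i).fun_mul (hθ b j)).const_mul _]
      refine Finset.sum_congr rfl fun b _ ↦ ?_
      rw [pd_const_mul l ((hθ a i).fun_mul (hθ b j)), pd_mul l (hθ a i) (hθ b j)]
    simp only [e4, e3]
    have e5 : ∑ s, ((christoffel g y s l i : ℂ) * ∑ a, ∑ b, sdBasis A a b *
        ((coframe e y a s : ℂ) * (coframe e y b j : ℂ)) +
        (christoffel g y s l j : ℂ) * ∑ a, ∑ b, sdBasis A a b *
        ((coframe e y a i : ℂ) * (coframe e y b s : ℂ))) = ∑ a, ∑ b, sdBasis A a b *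
        ((∑ s, (christoffel g y s l i : ℂ) * (coframe e y a s : ℂ)) * (coframe e y b j : ℂ) +
        (coframe e y a i : ℂ) * ∑ s, (christoffel g y s l j : ℂ) * (coframe e y b s : ℂ)) := by
      simp only [Finset.mul_sum, Finset.sum_mul, ← Finset.sum_add_distrib]
      rw [Finset.sum_comm]
      refine Finset.sum_congr rfl fun a _ ↦ ?_
      rw [Finset.sum_comm]
      exact Finset.sum_congr rfl fun _ _ ↦ Finset.sum_congr rfl fun _ _ ↦ by ring
    rw [e5]
    simp only [← Finset.sum_sub_distrib, ← Finset.sum_add_distrib]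
    refine Finset.sum_congr rfl fun a _ ↦ Finset.sum_congr rfl fun b _ ↦ ?_
    have e6 : ∀ a i, dualBasis (Matrix.of (e y)) a i = (coframe e y a i : ℂ) := fun _ _ ↦ rfl
    rw [e6, e6]
    ring
  rw [hmain]
  -- Antisymmetry of `h` turns the sum in the Leibniz rule into a commutator.
  have hM : Dᵀ * sdBasis A * T + Tᵀ * sdBasis A * D =
      Tᵀ * (sdBasis A * mink * h.map Complex.ofRealHom -
        h.map Complex.ofRealHom * mink * sdBasis A) * T := by
    have ht : (h.map Complex.ofRealHom)ᵀ = -(h.map Complex.ofRealHom) := by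
      rw [← Matrix.transpose_map, hanti]
      ext a b; simp
    rw [hDT, Matrix.transpose_mul, Matrix.transpose_mul, ht, mink_transpose]
    noncomm_ring
  rw [hM, sdBasis_mul_sub hanti]
  simp only [Matrix.mul_sum, Matrix.sum_mul, Matrix.sum_apply, Matrix.mul_smul, Matrix.smul_mul,
    Matrix.smul_apply, smul_eq_mul, sdBiv]

/-- The covariant derivative of the self-dual Weyl tensor in a principal frame. -/
theorem nablaSdWeyl_eq_dbl (hd : ∀ z ∈ U, DiagonalizesWeyl g η e z) (hy : y ∈ U) (l : Fin 4) :
    nablaSdWeyl g η y l = dbl (dualBasis (Matrix.of (e y))) (Matrix.of fun B C ↦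
      (if B = C then pd l (fun z ↦ frameWeyl g z (Matrix.of (e z)) B B) y else 0) +
        (frameWeyl g y (Matrix.of (e y)) C C - frameWeyl g y (Matrix.of (e y)) B B) *
          sdRotation (sdCoeff ((connMatrix g e y l)ᵀ * Matrix.of minkowski)) C B) := by
  have hα : ∀ A, DifferentiableAt ℝ (fun z ↦ frameWeyl g z (Matrix.of (e z)) A A) y := fun A ↦
    he.differentiableAt (he.metric.contDiffOn_frameWeyl (E := fun z ↦ Matrix.of (e z))
      he.smooth A A) hy
  have hu : ∀ A i j, DifferentiableAt ℝ (fun z ↦ sdBiv (dualBasis (Matrix.of (e z))) A i j) y :=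
      fun A i j ↦ by
    refine he.differentiableAt (U := U) ?_ hy
    simp only [sdBiv, sandwich_apply]
    exact ContDiffOn.sum fun a _ ↦ ContDiffOn.sum fun b _ ↦
      ((contDiffOn_ofReal (he.contDiffOn_coframe a i)).mul
        (contDiffOn_ofReal (he.contDiffOn_coframe b j))).mul contDiffOn_const
  -- The diagonal form is differentiated, so it has to hold near `y` and not only at `y`.
  have hW : ∀ i j k l, (fun z ↦ sdWeyl g η z i j k l) =ᶠ[_root_.nhds y] fun z ↦
      ∑ A, (-(1 / 2) * frameWeyl g z (Matrix.of (e z)) A A) *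
        (sdBiv (dualBasis (Matrix.of (e z))) A i j *
          sdBiv (dualBasis (Matrix.of (e z))) A k l) := fun i j k l ↦
    Filter.eventually_of_mem (he.nhds hy) fun z hz ↦ by
      obtain ⟨α, hα⟩ := (he.diagonalizesWeyl_iff hz).mp (hd z hz)
      simp only [he.sdWeyl_eq_dbl hz, dbl, hα, Matrix.diagonal_apply, ite_mul, zero_mul,
        Finset.sum_ite_eq, Finset.mem_univ, if_true, Finset.mul_sum]
      exact Finset.sum_congr rfl fun _ _ ↦ by ring
  ext i j k m
  rw [nablaSdWeyl_dbl (u := fun A z ↦ sdBiv (dualBasis (Matrix.of (e z))) A) hW hu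
    (fun A ↦ (hα A).const_mul _) l i j k m _ fun A i j ↦ (he.nabla_sdBiv hy l A i j).symm]
  simp only [pd_const_mul l (hα _)]
  -- The coefficient of u_B ⊗ u_C is α_C R_CB + α_B R_BC, and antisymmetry of the rotation R makes
  -- it (α_C - α_B) R_CB.
  simp only [dbl, Matrix.of_apply, sdRotation, Fin.sum_univ_three, levi3]
  simp
  ring

end IsSmoothFrameOn

end

/-! ### Recovering the connection from the Weyl tensor -/

section

open Matrix

namespace IsSmoothFrameOn

variable {g : Coord → Matrix (Fin 4) (Fin 4) ℝ} {η : Coord → Fin 4 → Fin 4 → Fin 4 → Fin 4 → ℝ}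
  {U : Set Coord} {e : Coord → Fin 4 → Fin 4 → ℝ} (he : IsSmoothFrameOn g η U e) {y : Coord}
include he

theorem connectionTensor_eq_sum (hy : y ∈ U) (l n m : Fin 4) :
    (connectionTensor g e y l n m : ℂ) =
      ∑ A, sdCoeff ((connMatrix g e y l)ᵀ * Matrix.of minkowski) A *
        sdBiv (dualBasis (Matrix.of (e y))) A n m +
      (starRingEnd ℂ) (∑ A, sdCoeff ((connMatrix g e y l)ᵀ * Matrix.of minkowski) A *
        sdBiv (dualBasis (Matrix.of (e y))) A n m) := by
  set h := (connMatrix g e y l)ᵀ * Matrix.of minkowski with hh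
  set T := dualBasis (Matrix.of (e y)) with hT
  have h1 : (connectionTensor g e y l n m : ℂ) = (Tᵀ * h.map Complex.ofRealHom * T) n m := by
    have : ∀ h : Matrix (Fin 4) (Fin 4) ℝ, Tᵀ * h.map Complex.ofRealHom * T =
        ((Matrix.of (e y))⁻¹ * h * ((Matrix.of (e y))⁻¹)ᵀ).map Complex.ofRealHom := fun h ↦ by
      rw [Matrix.map_mul, Matrix.map_mul, hT, dualBasis, Matrix.transpose_map,
        Matrix.transpose_transpose]
    rw [this, he.connectionTensor_eq hy]; rfl
  have hc : ∀ a i, (starRingEnd ℂ) (T a i) = T a i := fun a i ↦ Complex.conj_ofReal _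
  have h2 : ∀ A, (Tᵀ * (sdBasis A).map (starRingEnd ℂ) * T) n m =
      (starRingEnd ℂ) (sdBiv T A n m) := fun A ↦ by
    rw [sdBiv, sandwich_apply, sandwich_apply]
    simp only [map_sum, map_mul, hc, Matrix.map_apply]
  rw [h1, map_eq_sum_sdCoeff (he.connBivector_transpose hy l)]
  simp only [Matrix.mul_sum, Matrix.sum_mul, Matrix.sum_apply, Matrix.mul_add, Matrix.add_mul,
    Matrix.add_apply, Matrix.mul_smul, Matrix.smul_mul, Matrix.smul_apply, smul_eq_mul, h2,
    Finset.sum_add_distrib, map_sum, map_mul]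
  rfl

/-- In the principal basis 𝓧 multiplies each self-dual component of the connection by the squared
difference of the other two eigenvalues, and 𝓨 is diagonal with the inverse entries. The outer √2 is
the 2 of the unhalved contraction over the 1/√2 in 𝓗. -/
theorem sdConnection_eq (hd : ∀ z ∈ U, DiagonalizesWeyl g η e z) (hy : y ∈ U)
    (hΔ : invDelta g η y ≠ 0) (l m n : Fin 4) : sdConnection g η y l m n =
      (Real.sqrt 2 : ℂ) * ∑ A, sdCoeff ((connMatrix g e y l)ᵀ * Matrix.of minkowski) A *
        sdBiv (dualBasis (Matrix.of (e y))) A m n := by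
  have hE := he.frame y hy
  have hG := dual_mul_ginv_mul hE
  have hW := he.sdWeyl_eq_dbl hy
  have hN := he.nablaSdWeyl_eq_dbl hd hy l
  have htr := he.frameWeyl_trace hy
  obtain ⟨ha, hb, hW2⟩ := invDelta_eq hE hW
  have hGm := sdMetric_eq hE
  obtain ⟨α, hα⟩ := (he.diagonalizesWeyl_iff hy).mp (hd y hy)
  set T := dualBasis (Matrix.of (e y)) with hT
  set s := sdCoeff ((connMatrix g e y l)ᵀ * Matrix.of minkowski) with hs
  set p := fun B ↦ pd l (fun z ↦ frameWeyl g z (Matrix.of (e z)) B B) y with hp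
  rw [hα] at hW hN ha hb hW2 htr
  set M : Matrix (Fin 3) (Fin 3) ℂ := Matrix.of fun B C ↦ (if B = C then p B else 0) +
    (Matrix.diagonal α C C - Matrix.diagonal α B B) * sdRotation s C B with hM
  have hN' : nablaSdWeyl g η y l = dbl T M := hN
  set R : Matrix (Fin 3) (Fin 3) ℂ := Matrix.of fun A B ↦
    (3 * invA g η y * (Matrix.diagonal α * Matrix.diagonal α : Matrix (Fin 3) (Fin 3) ℂ) A B +
      6 * invB g η y * (Matrix.diagonal α : Matrix (Fin 3) (Fin 3) ℂ) A B +
      (1 / 2) * invA g η y ^ 2 * (1 : Matrix (Fin 3) (Fin 3) ℂ) A B) / invDelta g η y with hR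
  have hY : ∀ i j k m, tensorY g η y i j k m = dbl T R i j k m := fun i j k m ↦ by
    rw [tensorY, hW2, hW, hGm]
    simp only [dbl, hR, Matrix.of_apply, Fin.sum_univ_three]
    field_simp
    ring
  have hX : (Matrix.of fun a r ↦ tensorX g η y l a r) = (-(1 / 2) * (M * Matrix.diagonal α).trace) •
      (Tᵀ * mink * T) + ∑ C, (-(1 / 2) * Complex.I * ∑ A, ∑ B,
        (M * Matrix.diagonal α) A B * levi3 A B C) • sdBiv T C := by
    rw [← sum_ginv_dbl hG]
    ext a r
    rw [Matrix.of_apply, tensorX, tensor_contract, hN', hW, dblMul_dbl hG]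
    rfl
  rw [sdConnection]
  simp only [hY]
  rw [sum_dbl_right hG R (fun a r ↦ tensorX g η y l a r) _ _ hX]
  have h2 : (Real.sqrt 2 : ℂ) * (Real.sqrt 2 : ℂ) = 2 := by
    rw [← Complex.ofReal_mul, Real.mul_self_sqrt (by norm_num)]; norm_num
  have h20 : (Real.sqrt 2 : ℂ) ≠ 0 := fun h ↦ by rw [h, mul_zero] at h2; norm_num at h2
  have hsum : α 2 = -α 0 - α 1 := by
    rw [Matrix.trace_diagonal, Fin.sum_univ_three] at htr
    linear_combination htr
  have key : ∀ A, (-(1 / 2) * Complex.I * ∑ B, ∑ C,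
      (M * Matrix.diagonal α) B C * levi3 B C A) * R A A = s A := fun A ↦ by
    have e1 : R A A * invDelta g η y = 3 * invA g η y * α A ^ 2 + 6 * invB g η y * α A +
        (1 / 2) * invA g η y ^ 2 := by
      rw [hR, Matrix.of_apply, div_mul_cancel₀ _ hΔ, Matrix.diagonal_mul_diagonal,
        Matrix.diagonal_apply_eq, Matrix.diagonal_apply_eq, Matrix.one_apply_eq]
      ring
    have e2 : invA g η y = 2 * (α 0 ^ 2 + α 0 * α 1 + α 1 ^ 2) := by
      rw [ha, Matrix.diagonal_mul_diagonal, Matrix.trace_diagonal, Fin.sum_univ_three, hsum]; ring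
    have e3 : invB g η y = -3 * (α 0 * α 1 * (α 0 + α 1)) := by
      rw [hb, Matrix.diagonal_mul_diagonal, Matrix.diagonal_mul_diagonal, Matrix.trace_diagonal,
        Fin.sum_univ_three, hsum]; ring
    -- ε keeps only the two off-diagonal entries opposite `A`. One difference of eigenvalues comes
    -- from `M`, the other from antisymmetrizing its product with diag(α); the square equals 2a - 3
    -- α_A² because the eigenvalues sum to zero.
    have e4 : -(1 / 2) * Complex.I * ∑ B, ∑ C, (M * Matrix.diagonal α) B C * levi3 B C A =
        (2 * invA g η y - 3 * α A ^ 2) * s A := by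
      rw [e2]
      simp only [Matrix.mul_diagonal, hM, Matrix.of_apply, Matrix.diagonal_apply_eq, sdRotation]
      fin_cases A <;> simp [Fin.sum_univ_three, levi3, hsum] <;> ring_nf <;> simp only [Complex.I_sq] <;> ring
    -- After clearing Δ, what remains is (2a - 3x²)(3a x² + 6b x + a²/2) = Δ at x = α_A.
    refine mul_right_cancel₀ hΔ ?_
    rw [mul_assoc, e1, e4, invDelta, e2, e3]
    fin_cases A <;> simp [hsum] <;> ring
  have hRd : ∀ A B, A ≠ B → R A B = 0 := fun A B h ↦ by
    simp [hR, Matrix.diagonal_apply_ne _ h, Matrix.one_apply_ne h]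
  have hfin : ∀ A, (-(1 / 2) * Complex.I * ∑ B, ∑ C,
      (M * Matrix.diagonal α) B C * levi3 B C A) * ∑ B, R A B * sdBiv T B m n =
      s A * sdBiv T A m n := fun A ↦ by
    have : ∑ B, R A B * sdBiv T B m n = R A A * sdBiv T A m n :=
      Finset.sum_eq_single A (fun B _ h ↦ by rw [hRd A B h.symm, zero_mul]) (by simp)
    rw [this, ← mul_assoc, key]
  simp only [hfin]
  rw [← h2]
  field_simp

theorem connectionTensor_eq_sdConnection (hd : ∀ z ∈ U, DiagonalizesWeyl g η e z) (hy : y ∈ U)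
    (hΔ : invDelta g η y ≠ 0) (l m n : Fin 4) : (connectionTensor g e y l m n : ℂ) =
      (1 / (Real.sqrt 2 : ℂ)) * (sdConnection g η y l m n +
        (starRingEnd ℂ) (sdConnection g η y l m n)) := by
  have h20 : (Real.sqrt 2 : ℂ) ≠ 0 := by
    rw [Complex.ofReal_ne_zero]; positivity
  rw [he.connectionTensor_eq_sum hy, he.sdConnection_eq hd hy hΔ, map_mul, Complex.conj_ofReal,
    ← mul_add, ← mul_assoc, one_div_mul_cancel h20, one_mul]

end IsSmoothFrameOn

end

section

open Matrix Filter Topology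

/-! ### Germs of smooth functions -/

/-- `f` is smooth in a neighbourhood of `y`. -/
def SmoothNear {F : Type*} [NormedAddCommGroup F] [NormedSpace ℝ F] (f : Coord → F) (y : Coord) :
    Prop :=
  -- Order ∞ at the single point `y` would give, for each finite order, a neighbourhood depending on
  -- that order; the eventual form provides a common one.
  ∀ᶠ z in 𝓝 y, ContDiffAt ℝ ∞ f z

namespace SmoothNear

variable {F : Type*} [NormedAddCommGroup F] [NormedSpace ℝ F] {y : Coord}

theorem of_contDiffOn {f : Coord → F} {U : Set Coord} (hU : IsOpen U) (hy : y ∈ U)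
    (hf : ContDiffOn ℝ ∞ f U) : SmoothNear f y :=
  Filter.eventually_of_mem (hU.mem_nhds hy) fun _ hz ↦ hf.contDiffAt (hU.mem_nhds hz)

theorem continuousAt {f : Coord → F} (hf : SmoothNear f y) : ContinuousAt f y :=
  (Eventually.self_of_nhds hf).continuousAt

theorem const (c : F) : SmoothNear (fun _ ↦ c) y :=
  Eventually.of_forall fun _ ↦ contDiffAt_const

theorem add {f h : Coord → F} (hf : SmoothNear f y) (hh : SmoothNear h y) :
    SmoothNear (fun z ↦ f z + h z) y := by
  filter_upwards [hf, hh] with z h1 h2 using h1.add h2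

theorem sub {f h : Coord → F} (hf : SmoothNear f y) (hh : SmoothNear h y) :
    SmoothNear (fun z ↦ f z - h z) y := by
  filter_upwards [hf, hh] with z h1 h2 using h1.sub h2

theorem neg {f : Coord → F} (hf : SmoothNear f y) : SmoothNear (fun z ↦ -f z) y := by
  filter_upwards [hf] with z h1 using h1.neg

theorem mul {𝔸 : Type*} [NormedCommRing 𝔸] [NormedAlgebra ℝ 𝔸] {f h : Coord → 𝔸}
    (hf : SmoothNear f y) (hh : SmoothNear h y) : SmoothNear (fun z ↦ f z * h z) y := by
  filter_upwards [hf, hh] with z h1 h2 using h1.mul h2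

theorem sum {ι : Type*} {s : Finset ι} {f : ι → Coord → F} (hf : ∀ i ∈ s, SmoothNear (f i) y) :
    SmoothNear (fun z ↦ ∑ i ∈ s, f i z) y := by
  filter_upwards [(Filter.eventually_all_finset s).mpr hf] with z h1
  exact ContDiffAt.sum fun i hi ↦ h1 i hi

theorem prod {ι : Type*} {𝔸 : Type*} [NormedCommRing 𝔸] [NormedAlgebra ℝ 𝔸] {s : Finset ι}
    {f : ι → Coord → 𝔸} (hf : ∀ i ∈ s, SmoothNear (f i) y) :
    SmoothNear (fun z ↦ ∏ i ∈ s, f i z) y := by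
  filter_upwards [(Filter.eventually_all_finset s).mpr hf] with z h1
  exact contDiffAt_prod fun i hi ↦ h1 i hi

theorem pow {𝔸 : Type*} [NormedCommRing 𝔸] [NormedAlgebra ℝ 𝔸] {f : Coord → 𝔸}
    (hf : SmoothNear f y) (n : ℕ) : SmoothNear (fun z ↦ f z ^ n) y := by
  filter_upwards [hf] with z h1 using h1.pow n

theorem inv {𝕜 : Type*} [RCLike 𝕜] {f : Coord → 𝕜} (hf : SmoothNear f y) (h0 : f y ≠ 0) :
    SmoothNear (fun z ↦ (f z)⁻¹) y := by
  filter_upwards [hf, hf.continuousAt.eventually_ne h0] with z h1 h2 using h1.inv h2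

theorem div {𝕜 : Type*} [RCLike 𝕜] {f h : Coord → 𝕜} (hf : SmoothNear f y) (hh : SmoothNear h y)
    (h0 : h y ≠ 0) : SmoothNear (fun z ↦ f z / h z) y := by
  simp only [div_eq_mul_inv]
  exact hf.mul (hh.inv h0)

theorem sqrt {f : Coord → ℝ} (hf : SmoothNear f y) (h0 : f y ≠ 0) :
    SmoothNear (fun z ↦ √(f z)) y := by
  filter_upwards [hf, hf.continuousAt.eventually_ne h0] with z h1 h2 using h1.sqrt h2

theorem re {f : Coord → ℂ} (hf : SmoothNear f y) : SmoothNear (fun z ↦ (f z).re) y := by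
  filter_upwards [hf] with z h1 using Complex.reCLM.contDiff.contDiffAt.comp z h1

theorem im {f : Coord → ℂ} (hf : SmoothNear f y) : SmoothNear (fun z ↦ (f z).im) y := by
  filter_upwards [hf] with z h1 using Complex.imCLM.contDiff.contDiffAt.comp z h1

theorem conj {f : Coord → ℂ} (hf : SmoothNear f y) :
    SmoothNear (fun z ↦ (starRingEnd ℂ) (f z)) y := by
  filter_upwards [hf] with z h1 using Complex.conjCLE.contDiff.contDiffAt.comp z h1

theorem det {n 𝕜 : Type*} [RCLike 𝕜] [Fintype n] [DecidableEq n] {A : Coord → Matrix n n 𝕜}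
    (hA : ∀ i j, SmoothNear (fun z ↦ A z i j) y) : SmoothNear (fun z ↦ (A z).det) y := by
  simp only [Matrix.det_apply']
  exact SmoothNear.sum fun σ _ ↦ (SmoothNear.const _).mul (SmoothNear.prod fun i _ ↦ hA _ _)

/-- A nonvanishing smooth complex function has a smooth `n`-th root near a point. -/
theorem exists_pow_eq {f : Coord → ℂ} (hf : SmoothNear f y) (h0 : f y ≠ 0) {n : ℕ} (hn : n ≠ 0) :
    ∃ h : Coord → ℂ, SmoothNear h y ∧ (∀ᶠ z in 𝓝 y, h z ^ n = f z) ∧ h y ≠ 0 := by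
  -- A root `c` of the value at `y` is split off, so that the logarithm is taken only of f / f(y),
  -- which is near 1 and off the branch cut.
  obtain ⟨c, hc⟩ := IsAlgClosed.exists_pow_nat_eq (f y) (Nat.pos_of_ne_zero hn)
  have hq : SmoothNear (fun z ↦ f z / f y) y := hf.div (SmoothNear.const _) h0
  have h1 : f y / f y ∈ Complex.slitPlane := by rw [div_self h0]; exact Complex.one_mem_slitPlane
  have h2 : ∀ᶠ z in 𝓝 y, f z / f y ∈ Complex.slitPlane :=
    hq.continuousAt.eventually_mem (Complex.isOpen_slitPlane.mem_nhds h1)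
  refine ⟨fun z ↦ c * Complex.exp (Complex.log (f z / f y) / n), ?_, ?_, ?_⟩
  · filter_upwards [hq, h2] with z hz1 hz2
    have hl : ContDiffAt ℝ ∞ (fun z ↦ Complex.log (f z / f y)) z :=
      ContDiffAt.comp (g := Complex.log) z
        ((Complex.contDiffAt_log (n := ∞) hz2).restrict_scalars ℝ) hz1
    exact contDiffAt_const.mul ((hl.div_const _).cexp)
  · filter_upwards [h2] with z hz
    have hn' : (n : ℂ) ≠ 0 := Nat.cast_ne_zero.mpr hn
    rw [mul_pow, hc, ← Complex.exp_nat_mul, mul_div_cancel₀ _ hn',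
      Complex.exp_log (Complex.slitPlane_ne_zero hz), mul_div_cancel₀ _ h0]
  · refine mul_ne_zero (fun h ↦ h0 ?_) (Complex.exp_ne_zero _)
    rw [← hc, h, zero_pow hn]

end SmoothNear

/-! ### Smooth orthonormal frames -/

theorem minkowski_self_mul (a : Fin 4) : minkowski a a * minkowski a a = 1 := by
  unfold minkowski; simp; split_ifs <;> norm_num

theorem minkowski_ne {a b : Fin 4} (h : a ≠ b) : minkowski a b = 0 := by
  simp [minkowski, h]

theorem smoothNear_toBilin' {g : Coord → Matrix (Fin 4) (Fin 4) ℝ} {y : Coord}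
    (hg : ∀ i j, SmoothNear (fun z ↦ g z i j) y) {u v : Coord → Fin 4 → ℝ}
    (hu : ∀ i, SmoothNear (fun z ↦ u z i) y) (hv : ∀ i, SmoothNear (fun z ↦ v z i) y) :
    SmoothNear (fun z ↦ Matrix.toBilin' (g z) (u z) (v z)) y := by
  simp only [Matrix.toBilin'_apply]
  exact SmoothNear.sum fun i _ ↦ SmoothNear.sum fun j _ ↦ ((hu i).mul (hg i j)).mul (hv j)

/-- Gram-Schmidt orthonormalization depending smoothly on a parameter. -/
theorem exists_smooth_orthonormal {g : Coord → Matrix (Fin 4) (Fin 4) ℝ} {y : Coord}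
    (hg : ∀ i j, SmoothNear (fun z ↦ g z i j) y) (hs : ∀ᶠ z in 𝓝 y, (g z)ᵀ = g z)
    (e₀ : Fin 4 → Fin 4 → ℝ)
    (he₀ : ∀ a b, Matrix.toBilin' (g y) (e₀ a) (e₀ b) = minkowski a b) (k : ℕ) (hk : k ≤ 4) :
    ∃ e : Coord → Fin 4 → Fin 4 → ℝ, (∀ a i, SmoothNear (fun z ↦ e z a i) y) ∧ e y = e₀ ∧
      ∀ᶠ z in 𝓝 y, ∀ a b : Fin 4, (a : ℕ) < k →
        Matrix.toBilin' (g z) (e z a) (e z b) = minkowski a b := by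
  -- The first `k` vectors are orthonormal and also orthogonal to all later ones. Each step
  -- normalises one vector and subtracts its component from the others; keeping the value e₀ at `y`
  -- ensures that its norm does not vanish nearby.
  induction k with
  | zero => exact ⟨fun _ ↦ e₀, fun a i ↦ SmoothNear.const _, rfl,
      Eventually.of_forall fun z a b h ↦ absurd h (Nat.not_lt_zero _)⟩
  | succ k ih =>
    obtain ⟨e, he, hey, hort⟩ := ih (by omega)
    set p : Fin 4 := ⟨k, by omega⟩ with hp
    have hB : ∀ a b, SmoothNear (fun z ↦ Matrix.toBilin' (g z) (e z a) (e z b)) y := fun a b ↦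
      smoothNear_toBilin' hg (he a) (he b)
    have hN : SmoothNear (fun z ↦ minkowski p p * Matrix.toBilin' (g z) (e z p) (e z p)) y :=
      (SmoothNear.const _).mul (hB p p)
    have hNy : minkowski p p * Matrix.toBilin' (g y) (e y p) (e y p) = 1 := by
      rw [hey, he₀, minkowski_self_mul]
    have hNpos : ∀ᶠ z in 𝓝 y, 0 < minkowski p p * Matrix.toBilin' (g z) (e z p) (e z p) :=
      hN.continuousAt.eventually (lt_mem_nhds (lt_of_lt_of_eq one_pos hNy.symm))
    have hB0 : Matrix.toBilin' (g y) (e y p) (e y p) ≠ 0 := fun h ↦ by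
      rw [h, mul_zero] at hNy; exact zero_ne_one hNy
    refine ⟨fun z a ↦ if a = p then
      (√(minkowski p p * Matrix.toBilin' (g z) (e z p) (e z p)))⁻¹ • e z p else
      e z a - (Matrix.toBilin' (g z) (e z a) (e z p) / Matrix.toBilin' (g z) (e z p) (e z p)) •
        e z p, ?_, ?_, ?_⟩
    · intro a i
      by_cases ha : a = p
      · simp only [ha, if_true, Pi.smul_apply, smul_eq_mul]
        exact ((hN.sqrt (by rw [hNy]; norm_num)).inv (by rw [hNy]; norm_num)).mul (he p i)
      · simp only [ha, if_false, Pi.sub_apply, Pi.smul_apply, smul_eq_mul]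
        exact (he a i).sub (((hB a p).div (hB p p) hB0).mul (he p i))
    · ext a i
      by_cases ha : a = p
      · simp only [ha, if_true]
        rw [hNy, Real.sqrt_one, inv_one, one_smul, hey]
      · simp only [ha, if_false]
        rw [hey, he₀, minkowski_ne ha, zero_div, zero_smul, sub_zero]
    · filter_upwards [hort, hNpos, hs] with z hz hpos hsz a b hab
      set B := Matrix.toBilin' (g z) with hBdef
      have hsymm : ∀ u v, B u v = B v u := fun u v ↦ by
        rw [hBdef, Matrix.toBilin'_apply', Matrix.toBilin'_apply', Matrix.dotProduct_mulVec,
          ← Matrix.mulVec_transpose, hsz, dotProduct_comm]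
      have hBp : B (e z p) (e z p) ≠ 0 := fun h ↦ by
        rw [h, mul_zero] at hpos; exact lt_irrefl _ hpos
      by_cases ha : a = p
      · by_cases hb : b = p
        · simp only [ha, hb, if_true, map_smul, LinearMap.smul_apply, smul_eq_mul]
          rw [← mul_assoc, ← mul_inv, Real.mul_self_sqrt hpos.le]
          have hm : minkowski p p ≠ 0 := fun h ↦ by
            rw [h, zero_mul] at hpos; exact lt_irrefl _ hpos
          field_simp
          rw [pow_two, minkowski_self_mul]
        · simp only [ha, hb, if_true, if_false, map_smul, LinearMap.smul_apply, smul_eq_mul,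
            map_sub]
          rw [minkowski_ne (Ne.symm hb), hsymm (e z b)]
          field_simp
          ring
      · have hak : (a : ℕ) < k := by
          have : (a : ℕ) ≠ k := fun h ↦ ha (Fin.ext h)
          omega
        have hap : B (e z a) (e z p) = 0 := by rw [hz a p hak, minkowski_ne ha]
        by_cases hb : b = p
        · simp only [ha, hb, if_true, if_false, hap, zero_div, zero_smul, sub_zero, map_smul,
            smul_eq_mul, mul_zero]
          rw [minkowski_ne ha]
        · simp only [ha, hb, if_false, hap, zero_div, zero_smul, sub_zero, map_sub, map_smul,
            smul_eq_mul, mul_zero]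
          exact hz a b hak

theorem toBilin'_eq (g E : Matrix (Fin 4) (Fin 4) ℝ) (a b : Fin 4) :
    Matrix.toBilin' g (E a) (E b) = (E * g * Eᵀ) a b := by
  rw [Matrix.toBilin'_apply]
  simp only [Matrix.mul_apply, Matrix.transpose_apply, Finset.sum_mul]
  rw [Finset.sum_comm]

/-- Smooth oriented orthonormal frames exist locally. -/
theorem exists_smooth_orientedFrame {g : Coord → Matrix (Fin 4) (Fin 4) ℝ}
    {η : Coord → Fin 4 → Fin 4 → Fin 4 → Fin 4 → ℝ} {v : Coord → ℝ} {y : Coord}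
    (hg : ∀ i j, SmoothNear (fun z ↦ g z i j) y) (hs : ∀ᶠ z in 𝓝 y, (g z)ᵀ = g z)
    (hv : SmoothNear v y) (hη : ∀ᶠ z in 𝓝 y, ∀ i j k l, η z i j k l = v z * levi i j k l)
    (hv1 : ∀ᶠ z in 𝓝 y, ∀ E : Matrix (Fin 4) (Fin 4) ℝ, E * g z * Eᵀ = Matrix.of minkowski →
      (v z * E.det) * (v z * E.det) = 1)
    (hsig : ∃ E : Matrix (Fin 4) (Fin 4) ℝ, E * g y * Eᵀ = Matrix.of minkowski) :
    ∃ E : Coord → Matrix (Fin 4) (Fin 4) ℝ, (∀ a i, SmoothNear (fun z ↦ E z a i) y) ∧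
      ∀ᶠ z in 𝓝 y, IsOrientedFrame (g z) (η z) (E z) := by
  obtain ⟨E₀, hE₀⟩ := hsig
  obtain ⟨e, he, -, hort⟩ := exists_smooth_orthonormal hg hs (fun a ↦ E₀ a)
    (fun a b ↦ by rw [toBilin'_eq, hE₀]; rfl) 4 le_rfl
  -- The orientation sign of the frame, written as a smooth function with square 1; rescaling the
  -- last vector by it corrects the orientation.
  set σ : Coord → ℝ := fun z ↦ v z * (Matrix.of (e z)).det with hσ
  have hσs : SmoothNear σ y := hv.mul (SmoothNear.det he)
  set D : Coord → Fin 4 → ℝ := fun z ↦ ![1, 1, 1, σ z] with hD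
  have hDs : ∀ a, SmoothNear (fun z ↦ D z a) y := fun a ↦ by
    fin_cases a
    · exact SmoothNear.const _
    · exact SmoothNear.const _
    · exact SmoothNear.const _
    · exact hσs
  refine ⟨fun z ↦ Matrix.diagonal (D z) * Matrix.of (e z), fun a i ↦ ?_, ?_⟩
  · simp only [Matrix.diagonal_mul]
    exact (hDs a).mul (he a i)
  · filter_upwards [hort, hη, hv1] with z hz hηz hv1z
    have ho : Matrix.of (e z) * g z * (Matrix.of (e z))ᵀ = Matrix.of minkowski := by
      ext a b
      rw [← toBilin'_eq]; exact hz a b a.isLt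
    have hσ2 : σ z * σ z = 1 := hv1z _ ho
    refine ⟨?_, v z, hηz, ?_⟩
    · rw [Matrix.transpose_mul, Matrix.diagonal_transpose]
      calc _ = Matrix.diagonal (D z) * (Matrix.of (e z) * g z * (Matrix.of (e z))ᵀ) *
            Matrix.diagonal (D z) := by simp only [Matrix.mul_assoc]
        _ = Matrix.of minkowski := by
          rw [ho]
          ext a b
          rw [Matrix.mul_diagonal, Matrix.diagonal_mul, Matrix.of_apply]
          by_cases hab : a = b
          · subst hab
            fin_cases a <;> simp [hD, minkowski, hσ2]
          · rw [minkowski_ne hab]; simp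
    · rw [Matrix.det_mul, Matrix.det_diagonal]
      simp only [hD, Fin.prod_univ_four]
      simp
      rw [← hσ2]
      simp only [hσ]; ring

end

section

open Matrix Filter Topology

/-! ### Smooth diagonalization of complex symmetric matrices -/

/-- The roots of the characteristic polynomial of a traceless matrix depend smoothly on it. -/
theorem exists_smooth_roots {a b : Coord → ℂ} {y : Coord} (ha : SmoothNear a y)
    (hb : SmoothNear b y) (h0 : a y ^ 3 - 6 * b y ^ 2 ≠ 0) :
    ∃ α : Fin 3 → Coord → ℂ, (∀ A, SmoothNear (α A) y) ∧ ∀ᶠ z in 𝓝 y,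
      α 0 z + α 1 z + α 2 z = 0 ∧
      α 0 z * α 1 z + α 0 z * α 2 z + α 1 z * α 2 z = -(a z / 2) ∧
      α 0 z * α 1 z * α 2 z = b z / 3 := by
  -- Cardano's radicand for x³ - p x - q, namely (q/2)² - (p/3)³ with p = a/2 and q = b/3.
  have hD : SmoothNear (fun z ↦ -(a z ^ 3 - 6 * b z ^ 2) / 216) y :=
    (((ha.pow 3).sub ((SmoothNear.const 6).mul (hb.pow 2))).neg).div (SmoothNear.const 216)
      (by norm_num)
  have hD0 : -(a y ^ 3 - 6 * b y ^ 2) / 216 ≠ 0 := div_ne_zero (neg_ne_zero.mpr h0) (by norm_num)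
  -- The sign of the square root is chosen so that q/2 + d ≠ 0 at `y`: both signs cannot fail, since
  -- d ≠ 0 there. The cube root `u` is then smooth and invertible, and its partner is p/(3u) =
  -- a/(6u).
  obtain ⟨d, hd, hd2, hd0, hdb⟩ : ∃ d : Coord → ℂ, SmoothNear d y ∧
      (∀ᶠ z in 𝓝 y, d z ^ 2 = -(a z ^ 3 - 6 * b z ^ 2) / 216) ∧ d y ≠ 0 ∧ b y / 6 + d y ≠ 0 := by
    obtain ⟨d, hd, hd2, hd0⟩ := hD.exists_pow_eq hD0 two_ne_zero
    by_cases h : b y / 6 + d y = 0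
    · refine ⟨fun z ↦ -d z, hd.neg, ?_, neg_ne_zero.mpr hd0, fun h' ↦ hd0 ?_⟩
      · filter_upwards [hd2] with z hz
        rw [neg_sq, hz]
      · linear_combination (h - h') / 2
    · exact ⟨d, hd, hd2, hd0, h⟩
  obtain ⟨u, hu, hu3, hu0⟩ := ((hb.div (SmoothNear.const 6) (by norm_num)).add hd).exists_pow_eq
    hdb (n := 3) (by norm_num)
  obtain ⟨s, hs⟩ := IsAlgClosed.exists_pow_nat_eq (-3 : ℂ) (n := 2) (by norm_num)
  obtain ⟨w, hw⟩ : ∃ w : ℂ, w ^ 2 + w + 1 = 0 := ⟨(-1 + s) / 2, by linear_combination hs / 4⟩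
  have hw3 : w ^ 3 = 1 := by linear_combination (w - 1) * hw
  have hv : SmoothNear (fun z ↦ a z / (6 * u z)) y :=
    ha.div ((SmoothNear.const 6).mul hu) (mul_ne_zero (by norm_num) hu0)
  refine ⟨![fun z ↦ u z + a z / (6 * u z), fun z ↦ w * u z + w ^ 2 * (a z / (6 * u z)),
    fun z ↦ w ^ 2 * u z + w * (a z / (6 * u z))], fun A ↦ ?_, ?_⟩
  · fin_cases A
    · exact hu.add hv
    · exact ((SmoothNear.const w).mul hu).add ((SmoothNear.const (w ^ 2)).mul hv)
    · exact ((SmoothNear.const (w ^ 2)).mul hu).add ((SmoothNear.const w).mul hv)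
  · filter_upwards [hd2, hu3, hu.continuousAt.eventually_ne hu0] with z hz1 hz2 hz0
    obtain ⟨v, hv⟩ : ∃ v, v = a z / (6 * u z) := ⟨_, rfl⟩
    have hv1 : u z * v = a z / 6 := by rw [hv]; field_simp
    have hv3 : u z ^ 3 * v ^ 3 = u z ^ 3 * (b z / 6 - d z) := by
      rw [← mul_pow, hv1, hz2]
      linear_combination hz1
    have hv3' := mul_left_cancel₀ (pow_ne_zero 3 hz0) hv3
    simp only [Matrix.cons_val_zero, Matrix.cons_val_one, Matrix.cons_val]
    rw [← hv]
    refine ⟨?_, ?_, ?_⟩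
    · linear_combination (u z + v) * hw
    · linear_combination ((u z ^ 2 + v ^ 2) * (w + (w - 1) * w + 0) + u z * v * (2 * w + 2 + w ^ 2 - w - 1)) * hw - 3 * hv1 - (2 * (u z * v) + (u z ^ 2 + v ^ 2) * w) * hw3
    · have : (u z + v) * (w * u z + w ^ 2 * v) * (w ^ 2 * u z + w * v) = u z ^ 3 + v ^ 3 := by
        linear_combination (u z ^ 3 + v ^ 3) * hw3 + u z * v * (u z + v) * w ^ 2 * hw
      rw [this, hz2, hv3']; ring

theorem cayley_traceless (Q : Matrix (Fin 3) (Fin 3) ℂ) (h : Q.trace = 0) :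
    Q * Q * Q = ((Q * Q).trace / 2) • Q + ((Q * Q * Q).trace / 3) • (1 : Matrix (Fin 3) (Fin 3) ℂ) := by
  have h' : Q 2 2 = -Q 0 0 - Q 1 1 := by
    rw [Matrix.trace_fin_three] at h; linear_combination h
  ext i j
  fin_cases i <;> fin_cases j <;>
    simp [Matrix.trace_fin_three, Matrix.mul_apply, Fin.sum_univ_three, h'] <;> ring

/-- The eigenprojection, up to a factor, of a traceless matrix. -/
def eigenProj (Q : Matrix (Fin 3) (Fin 3) ℂ) (x : ℂ) : Matrix (Fin 3) (Fin 3) ℂ :=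
  Q * Q + x • Q + (x ^ 2 - (Q * Q).trace / 2) • (1 : Matrix (Fin 3) (Fin 3) ℂ)

/-- `eigenProj Q x` is the quotient of the characteristic polynomial χ by the factor at its root
`x`, evaluated at `Q`, so Cayley-Hamilton applies. For the same reason its square is χ'(x) times
itself, with χ'(x) = 3x² - a/2. -/
theorem mul_eigenProj {Q : Matrix (Fin 3) (Fin 3) ℂ} (h : Q.trace = 0) {x : ℂ}
    (hx : x ^ 3 - (Q * Q).trace / 2 * x - (Q * Q * Q).trace / 3 = 0) :
    Q * eigenProj Q x = x • eigenProj Q x := by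
  have h1 : (Q * Q * Q).trace / 3 = x ^ 3 - (Q * Q).trace / 2 * x := by linear_combination -hx
  have h2 := cayley_traceless Q h
  rw [h1] at h2
  simp only [eigenProj, Matrix.mul_add, Matrix.mul_smul, Matrix.mul_one, ← Matrix.mul_assoc, h2]
  module

theorem eigenProj_mul_self {Q : Matrix (Fin 3) (Fin 3) ℂ} (h : Q.trace = 0) {x : ℂ}
    (hx : x ^ 3 - (Q * Q).trace / 2 * x - (Q * Q * Q).trace / 3 = 0) :
    eigenProj Q x * eigenProj Q x = (3 * x ^ 2 - (Q * Q).trace / 2) • eigenProj Q x := by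
  have h1 := mul_eigenProj h hx
  nth_rewrite 1 [eigenProj]
  rw [Matrix.add_mul, Matrix.add_mul, Matrix.mul_assoc, h1, Matrix.mul_smul, h1, Matrix.smul_mul,
    h1, Matrix.smul_mul, Matrix.one_mul]
  module

theorem trace_eigenProj {Q : Matrix (Fin 3) (Fin 3) ℂ} (h : Q.trace = 0) (x : ℂ) :
    (eigenProj Q x).trace = 3 * x ^ 2 - (Q * Q).trace / 2 := by
  simp only [eigenProj, Matrix.trace_add, Matrix.trace_smul, h, Matrix.trace_one, smul_eq_mul]
  simp
  ring

/-- Columns of the eigenprojections are smooth eigenvectors. Symmetry of `Q` makes those of distinct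
eigenvalues orthogonal for the complex bilinear form, and simplicity of the eigenvalues allows them
to be chosen non-isotropic, hence normalised. -/
theorem exists_smooth_orthogonal {Q : Coord → Matrix (Fin 3) (Fin 3) ℂ} {y : Coord}
    (hQ : ∀ i j, SmoothNear (fun z ↦ Q z i j) y) (hs : ∀ᶠ z in 𝓝 y, (Q z)ᵀ = Q z)
    (ht : ∀ᶠ z in 𝓝 y, (Q z).trace = 0)
    (h0 : (Q y * Q y).trace ^ 3 - 6 * (Q y * Q y * Q y).trace ^ 2 ≠ 0) :
    ∃ (P : Coord → Matrix (Fin 3) (Fin 3) ℂ) (α : Coord → Fin 3 → ℂ),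
      (∀ i j, SmoothNear (fun z ↦ P z i j) y) ∧
      ∀ᶠ z in 𝓝 y, P z * (P z)ᵀ = 1 ∧ P z * Q z = Matrix.diagonal (α z) * P z := by
  have hQQ : ∀ i j, SmoothNear (fun z ↦ (Q z * Q z) i j) y := fun i j ↦ by
    simp only [Matrix.mul_apply]
    exact SmoothNear.sum fun k _ ↦ (hQ i k).mul (hQ k j)
  have hQQQ : ∀ i j, SmoothNear (fun z ↦ (Q z * Q z * Q z) i j) y := fun i j ↦ by
    simp only [Matrix.mul_apply (M := _ * _)]
    exact SmoothNear.sum fun k _ ↦ (hQQ i k).mul (hQ k j)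
  have ha : SmoothNear (fun z ↦ (Q z * Q z).trace) y := SmoothNear.sum fun i _ ↦ hQQ i i
  have hb : SmoothNear (fun z ↦ (Q z * Q z * Q z).trace) y := SmoothNear.sum fun i _ ↦ hQQQ i i
  obtain ⟨α, hα, hroots⟩ := exists_smooth_roots ha hb h0
  have hne : ∀ᶠ z in 𝓝 y, (Q z * Q z).trace ^ 3 - 6 * (Q z * Q z * Q z).trace ^ 2 ≠ 0 :=
    ((ha.pow 3).sub ((SmoothNear.const 6).mul (hb.pow 2))).continuousAt.eventually_ne h0
  have hchar : ∀ᶠ z in 𝓝 y, ∀ A, α A z ^ 3 - (Q z * Q z).trace / 2 * α A z -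
      (Q z * Q z * Q z).trace / 3 = 0 := by
    filter_upwards [hroots] with z ⟨h1, h2, h3⟩ A
    fin_cases A
    · change α 0 z ^ 3 - _ * α 0 z - _ = 0
      linear_combination (α 0 z) ^ 2 * h1 - α 0 z * h2 + h3
    · change α 1 z ^ 3 - _ * α 1 z - _ = 0
      linear_combination (α 1 z) ^ 2 * h1 - α 1 z * h2 + h3
    · change α 2 z ^ 3 - _ * α 2 z - _ = 0
      linear_combination (α 2 z) ^ 2 * h1 - α 2 z * h2 + h3
  have hdist : ∀ᶠ z in 𝓝 y, α 0 z ≠ α 1 z ∧ α 0 z ≠ α 2 z ∧ α 1 z ≠ α 2 z := by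
    filter_upwards [hroots, hne] with z ⟨h1, h2, h3⟩ h4
    have h5 : (Q z * Q z).trace ^ 3 - 6 * (Q z * Q z * Q z).trace ^ 2 =
        2 * ((α 0 z - α 1 z) * (α 0 z - α 2 z) * (α 1 z - α 2 z)) ^ 2 := by
      have e2 : (Q z * Q z).trace = -2 * (α 0 z * α 1 z + α 0 z * α 2 z + α 1 z * α 2 z) := by
        linear_combination 2 * h2
      have e3 : (Q z * Q z * Q z).trace = 3 * (α 0 z * α 1 z * α 2 z) := by
        linear_combination -3 * h3
      have h6 : α 2 z = -α 0 z - α 1 z := by linear_combination h1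
      rw [e2, e3, h6]; ring
    rw [h5] at h4
    refine ⟨fun h ↦ h4 ?_, fun h ↦ h4 ?_, fun h ↦ h4 ?_⟩ <;> rw [h] <;> ring
  have htr : ∀ A, 3 * α A y ^ 2 - (Q y * Q y).trace / 2 ≠ 0 := fun A ↦ by
    obtain ⟨h1, h2, -⟩ := hroots.self_of_nhds
    obtain ⟨d1, d2, d3⟩ := hdist.self_of_nhds
    have d1 := sub_ne_zero.mpr d1
    have d2 := sub_ne_zero.mpr d2
    have d3 := sub_ne_zero.mpr d3
    have h6 : α 2 y = -α 0 y - α 1 y := by linear_combination h1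
    have e2 : (Q y * Q y).trace = -2 * (α 0 y * α 1 y + α 0 y * α 2 y + α 1 y * α 2 y) := by
      linear_combination 2 * h2
    fin_cases A
    · have : 3 * α 0 y ^ 2 - (Q y * Q y).trace / 2 = (α 0 y - α 1 y) * (α 0 y - α 2 y) := by
        rw [e2, h6]; ring
      exact this ▸ mul_ne_zero d1 d2
    · have : 3 * α 1 y ^ 2 - (Q y * Q y).trace / 2 = -((α 0 y - α 1 y) * (α 1 y - α 2 y)) := by
        rw [e2, h6]; ring
      exact this ▸ neg_ne_zero.mpr (mul_ne_zero d1 d3)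
    · have : 3 * α 2 y ^ 2 - (Q y * Q y).trace / 2 = (α 0 y - α 2 y) * (α 1 y - α 2 y) := by
        rw [e2, h6]; ring
      exact this ▸ mul_ne_zero d2 d3
  -- The trace is χ'(α_A), a product of differences of eigenvalues up to sign, so some diagonal
  -- entry is nonzero.
  have hk : ∀ A, ∃ k, eigenProj (Q y) (α A y) k k ≠ 0 := fun A ↦ by
    by_contra! h
    refine htr A ?_
    rw [← trace_eigenProj ht.self_of_nhds]
    exact Finset.sum_eq_zero fun k _ ↦ h k
  choose k hk using hk
  have hP : ∀ A i j, SmoothNear (fun z ↦ eigenProj (Q z) (α A z) i j) y := fun A i j ↦ by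
    simp only [eigenProj, Matrix.add_apply, Matrix.smul_apply, smul_eq_mul]
    exact ((hQQ i j).add ((hα A).mul (hQ i j))).add ((((hα A).pow 2).sub
      (ha.div (SmoothNear.const 2) (by norm_num))).mul (SmoothNear.const _))
  -- The radicand is a diagonal entry of the squared symmetric projection, that is, the bilinear
  -- square of the chosen column.
  have hn : ∀ A, ∃ n : Coord → ℂ, SmoothNear n y ∧ (∀ᶠ z in 𝓝 y, n z ^ 2 =
      (3 * α A z ^ 2 - (Q z * Q z).trace / 2) * eigenProj (Q z) (α A z) (k A) (k A)) ∧ n y ≠ 0 :=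
    fun A ↦ SmoothNear.exists_pow_eq ((((SmoothNear.const 3).mul ((hα A).pow 2)).sub
      (ha.div (SmoothNear.const 2) (by norm_num))).mul (hP A _ _))
      (mul_ne_zero (htr A) (hk A)) two_ne_zero
  choose n hn hn2 hn0 using hn
  refine ⟨fun z ↦ Matrix.of fun A i ↦ eigenProj (Q z) (α A z) i (k A) / n A z,
    fun z A ↦ α A z, fun A i ↦ (hP A i (k A)).div (hn A) (hn0 A), ?_⟩
  filter_upwards [hs, ht, hchar, hdist, Filter.eventually_all.mpr hn2, Filter.eventually_all.mpr
    fun A ↦ (hn A).continuousAt.eventually_ne (hn0 A)] with z hsz htz hcz hdz hn2z hn0z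
  have hPs : ∀ A, (eigenProj (Q z) (α A z))ᵀ = eigenProj (Q z) (α A z) := fun A ↦ by
    simp only [eigenProj, Matrix.transpose_add, Matrix.transpose_smul, Matrix.transpose_mul, hsz,
      Matrix.transpose_one]
  set F : Matrix (Fin 3) (Fin 3) ℂ :=
    Matrix.of fun A i ↦ eigenProj (Q z) (α A z) i (k A) / n A z with hF
  have hFQ : F * Q z = Matrix.diagonal (fun A ↦ α A z) * F := by
    ext A i
    have h1 := congrFun (congrFun (mul_eigenProj htz (hcz A)) i) (k A)
    rw [Matrix.smul_apply, smul_eq_mul, Matrix.mul_apply] at h1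
    rw [Matrix.diagonal_mul, hF, Matrix.of_apply, ← mul_div_assoc, ← h1, Matrix.mul_apply,
      Finset.sum_div]
    refine Finset.sum_congr rfl fun j _ ↦ ?_
    rw [Matrix.of_apply, show Q z j i = Q z i j from congrFun (congrFun hsz i) j]
    ring
  refine ⟨?_, hFQ⟩
  have hcomm : Matrix.diagonal (fun A ↦ α A z) * (F * Fᵀ) =
      (F * Fᵀ) * Matrix.diagonal (fun A ↦ α A z) := by
    have h1 : (F * Q z * Fᵀ)ᵀ = F * Q z * Fᵀ := by
      rw [Matrix.transpose_mul, Matrix.transpose_mul, Matrix.transpose_transpose, hsz,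
        Matrix.mul_assoc]
    rw [hFQ, Matrix.mul_assoc] at h1
    rw [← h1, Matrix.transpose_mul, Matrix.transpose_mul, Matrix.transpose_transpose,
      Matrix.diagonal_transpose]
  ext A B
  by_cases hAB : A = B
  · subst hAB
    have h1 := congrFun (congrFun (eigenProj_mul_self htz (hcz A)) (k A)) (k A)
    rw [Matrix.smul_apply, smul_eq_mul, ← hn2z A, Matrix.mul_apply] at h1
    rw [Matrix.mul_apply, Matrix.one_apply_eq]
    have h2 : ∀ i, F A i * Fᵀ i A = eigenProj (Q z) (α A z) (k A) i *
        eigenProj (Q z) (α A z) i (k A) / n A z ^ 2 := fun i ↦ by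
      have : eigenProj (Q z) (α A z) (k A) i = eigenProj (Q z) (α A z) i (k A) :=
        congrFun (congrFun (hPs A) i) (k A)
      rw [this, Matrix.transpose_apply, hF, Matrix.of_apply, div_mul_div_comm, pow_two]
    simp only [h2]
    rw [← Finset.sum_div, h1, div_self (pow_ne_zero 2 (hn0z A))]
  · have h1 := congrFun (congrFun hcomm A) B
    rw [Matrix.diagonal_mul, Matrix.mul_diagonal] at h1
    have h2 : α A z - α B z ≠ 0 := by
      obtain ⟨d1, d2, d3⟩ := hdz
      refine sub_ne_zero.mpr ?_
      fin_cases A <;> fin_cases B <;> first | exact absurd rfl hAB | assumption | exact Ne.symm ‹_›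
    rw [Matrix.one_apply_ne hAB]
    refine (mul_eq_zero.mp ?_).resolve_left h2
    linear_combination h1

/-- A smooth family of special orthogonal matrices diagonalizing a smooth family of complex
symmetric matrices, with the sign of the eigenvectors chosen so that `1 + tr P ≠ 0`. -/
theorem exists_smooth_specialOrthogonal {Q : Coord → Matrix (Fin 3) (Fin 3) ℂ} {y : Coord}
    (hQ : ∀ i j, SmoothNear (fun z ↦ Q z i j) y) (hs : ∀ᶠ z in 𝓝 y, (Q z)ᵀ = Q z)
    (ht : ∀ᶠ z in 𝓝 y, (Q z).trace = 0)
    (h0 : (Q y * Q y).trace ^ 3 - 6 * (Q y * Q y * Q y).trace ^ 2 ≠ 0) :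
    ∃ (P : Coord → Matrix (Fin 3) (Fin 3) ℂ) (α : Coord → Fin 3 → ℂ),
      (∀ i j, SmoothNear (fun z ↦ P z i j) y) ∧ 1 + (P y).trace ≠ 0 ∧
      ∀ᶠ z in 𝓝 y, P z * (P z)ᵀ = 1 ∧ (P z).det = 1 ∧
        P z * Q z * (P z)ᵀ = Matrix.diagonal (α z) := by
  obtain ⟨F, α, hF, hFz⟩ := exists_smooth_orthogonal hQ hs ht h0
  have hdet : SmoothNear (fun z ↦ (F z).det) y := SmoothNear.det hF
  -- The determinant squares to 1, so multiplying the last eigenvector by it makes the total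
  -- determinant 1.
  set D : Coord → Fin 3 → ℂ := fun z ↦ ![1, 1, (F z).det] with hD
  have hDs : ∀ A, SmoothNear (fun z ↦ D z A) y := fun A ↦ by
    fin_cases A
    · exact SmoothNear.const _
    · exact SmoothNear.const _
    · exact hdet
  -- Over the four sign patterns of product 1 the diagonal terms cancel, so the four values of 1 +
  -- tr add up to 4 and cannot all vanish.
  obtain ⟨σ, hσ, hσ1, hσt⟩ : ∃ σ : Fin 3 → ℂ, (∀ A, σ A * σ A = 1) ∧ σ 0 * σ 1 * σ 2 = 1 ∧
      1 + ∑ A, σ A * (D y A * F y A A) ≠ 0 := by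
    by_contra! h
    have h1 := h ![1, 1, 1] (by intro A; fin_cases A <;> simp) (by simp)
    have h2 := h ![1, -1, -1] (by intro A; fin_cases A <;> simp) (by simp)
    have h3 := h ![-1, 1, -1] (by intro A; fin_cases A <;> simp) (by simp)
    have h4 := h ![-1, -1, 1] (by intro A; fin_cases A <;> simp) (by simp)
    simp [Fin.sum_univ_three] at h1 h2 h3 h4
    have : (4 : ℂ) = 0 := by linear_combination h1 + h2 + h3 + h4
    norm_num at this
  refine ⟨fun z ↦ Matrix.diagonal σ * (Matrix.diagonal (D z) * F z), α, fun i j ↦ ?_, ?_, ?_⟩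
  · simp only [Matrix.diagonal_mul]
    exact (SmoothNear.const _).mul ((hDs i).mul (hF i j))
  · simpa [Matrix.trace, Matrix.diagonal_mul] using hσt
  · filter_upwards [hFz] with z ⟨h1, h2⟩
    have hd2 : (F z).det * (F z).det = 1 := by
      have := congrArg Matrix.det h1
      rwa [Matrix.det_mul, Matrix.det_transpose, Matrix.det_one] at this
    have hDD : Matrix.diagonal (D z) * Matrix.diagonal (D z) = 1 := by
      rw [Matrix.diagonal_mul_diagonal, ← Matrix.diagonal_one]
      congr 1; ext A; fin_cases A <;> simp [hD, hd2]
    have hσσ : Matrix.diagonal σ * Matrix.diagonal σ = 1 := by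
      rw [Matrix.diagonal_mul_diagonal, ← Matrix.diagonal_one]
      congr 1; ext A; exact hσ A
    have hort : Matrix.diagonal σ * (Matrix.diagonal (D z) * F z) *
        (Matrix.diagonal σ * (Matrix.diagonal (D z) * F z))ᵀ = 1 := by
      simp only [Matrix.transpose_mul, Matrix.diagonal_transpose]
      calc _ = Matrix.diagonal σ * (Matrix.diagonal (D z) * (F z * (F z)ᵀ) *
            Matrix.diagonal (D z)) * Matrix.diagonal σ := by simp only [Matrix.mul_assoc]
        _ = 1 := by rw [h1, Matrix.mul_one, hDD, Matrix.mul_one, hσσ]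
    have hdiag : Matrix.diagonal σ * (Matrix.diagonal (D z) * F z) * Q z =
        Matrix.diagonal (α z) * (Matrix.diagonal σ * (Matrix.diagonal (D z) * F z)) := by
      ext A i
      have h3 := congrFun (congrFun h2 A) i
      rw [Matrix.diagonal_mul] at h3
      rw [Matrix.mul_assoc, Matrix.mul_assoc, Matrix.diagonal_mul, Matrix.diagonal_mul,
        Matrix.diagonal_mul, Matrix.diagonal_mul, Matrix.diagonal_mul, h3]
      ring
    refine ⟨hort, ?_, ?_⟩
    · rw [Matrix.det_mul, Matrix.det_mul, Matrix.det_diagonal, Matrix.det_diagonal,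
        Fin.prod_univ_three, hσ1, Fin.prod_univ_three]
      simp [hD, hd2]
    · rw [hdiag, Matrix.mul_assoc, hort, Matrix.mul_one]

end

section

open Matrix Filter Topology

/-! ### Lorentz transformations from complex rotations -/

/-- The endomorphism `(sdBasis A)^a_b`. -/
def pauli (A : Fin 3) : Matrix (Fin 4) (Fin 4) ℂ := mink * sdBasis A

theorem pauli_mul (A B : Fin 3) : pauli A * pauli B =
    (if A = B then (1 : ℂ) else 0) • 1 + Complex.I • ∑ C, levi3 A B C • pauli C := by
  have : pauli A * pauli B = mink * (sdBasis A * mink * sdBasis B) := by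
    simp only [pauli, Matrix.mul_assoc]
  rw [this, sdBasis_mul_mink_mul]
  simp only [pauli, Matrix.mul_add, Matrix.mul_smul, Matrix.mul_sum, mink_mul_mink]

theorem pauli_mul_self (A : Fin 3) : pauli A * pauli A = 1 := by
  rw [pauli_mul]; fin_cases A <;> simp [levi3]

theorem pauli_mul_of_levi3 (A B C : Fin 3) (h : levi3 A B C = 1) :
    pauli A * pauli B = Complex.I • pauli C ∧ pauli B * pauli A = -(Complex.I • pauli C) := by
  rw [pauli_mul, pauli_mul]
  fin_cases A <;> fin_cases B <;> fin_cases C <;> norm_num [levi3] at h <;>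
    norm_num [levi3, Fin.sum_univ_three] <;> rfl

/-- The quaternion `t + i ∑ c_A J_A`. -/
def quat (t : ℂ) (c : Fin 3 → ℂ) : Matrix (Fin 4) (Fin 4) ℂ :=
  t • 1 + Complex.I • ∑ A, c A • pauli A

/-- `N` times the rotation matrix of a quaternion of norm `N`. -/
def quatRot (t : ℂ) (c : Fin 3 → ℂ) : Matrix (Fin 3) (Fin 3) ℂ :=
  !![t ^ 2 + c 0 ^ 2 - c 1 ^ 2 - c 2 ^ 2, 2 * c 0 * c 1 + 2 * t * c 2, 2 * c 0 * c 2 - 2 * t * c 1;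
    2 * c 0 * c 1 - 2 * t * c 2, t ^ 2 + c 1 ^ 2 - c 0 ^ 2 - c 2 ^ 2, 2 * c 1 * c 2 + 2 * t * c 0;
    2 * c 0 * c 2 + 2 * t * c 1, 2 * c 1 * c 2 - 2 * t * c 0, t ^ 2 + c 2 ^ 2 - c 0 ^ 2 - c 1 ^ 2]

theorem quat_conj_mul (t : ℂ) (c : Fin 3 → ℂ) :
    quat t (-c) * quat t c = (t ^ 2 + c 0 ^ 2 + c 1 ^ 2 + c 2 ^ 2) • 1 := by
  obtain ⟨h01, h10⟩ := pauli_mul_of_levi3 0 1 2 (by norm_num [levi3])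
  obtain ⟨h12, h21⟩ := pauli_mul_of_levi3 1 2 0 (by norm_num [levi3])
  obtain ⟨h20, h02⟩ := pauli_mul_of_levi3 2 0 1 (by norm_num [levi3])
  simp only [quat, Fin.sum_univ_three, Pi.neg_apply, Matrix.add_mul, Matrix.mul_add, smul_add,
    Matrix.smul_mul, Matrix.mul_smul, Matrix.one_mul, Matrix.mul_one, pauli_mul_self,
    h01, h10, h12, h21, h20, h02]
  match_scalars
  · linear_combination (-c 0 ^ 2 - c 1 ^ 2 - c 2 ^ 2) * Complex.I_sq
  all_goals ring

theorem quat_conj_mul_pauli_mul (t : ℂ) (c : Fin 3 → ℂ) (A : Fin 3) :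
    quat t (-c) * pauli A * quat t c = ∑ B, quatRot t c A B • pauli B := by
  obtain ⟨h01, h10⟩ := pauli_mul_of_levi3 0 1 2 (by norm_num [levi3])
  obtain ⟨h12, h21⟩ := pauli_mul_of_levi3 1 2 0 (by norm_num [levi3])
  obtain ⟨h20, h02⟩ := pauli_mul_of_levi3 2 0 1 (by norm_num [levi3])
  have hI := Complex.I_sq
  have hI4 : Complex.I ^ 4 = 1 := Complex.I_pow_four
  fin_cases A <;>
  simp only [quat, Fin.sum_univ_three, Pi.neg_apply, Matrix.add_mul, Matrix.mul_add, smul_add,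
    Matrix.smul_mul, Matrix.mul_smul, Matrix.one_mul, Matrix.mul_one, pauli_mul_self,
    Matrix.neg_mul, Fin.zero_eta, Fin.mk_one, Fin.reduceFinMk, Fin.isValue,
    h01, h10, h12, h21, h20, h02, quatRot, Matrix.of_apply, Matrix.cons_val_zero,
    Matrix.cons_val_one, Matrix.cons_val] <;>
  match_scalars <;> ring_nf <;> simp only [hI, hI4] <;> ring

/-- The matrices `pauli A` are skew for the Minkowski form, so the metric adjoint of a quaternion is
its quaternionic conjugate. -/
theorem quat_transpose (t : ℂ) (c : Fin 3 → ℂ) : (quat t c)ᵀ = mink * quat t (-c) * mink := by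
  have h : ∀ A, (pauli A)ᵀ = -(mink * pauli A * mink) := fun A ↦ by
    rw [pauli, Matrix.transpose_mul, sdBasis_transpose, mink_transpose, ← Matrix.mul_assoc mink,
      mink_mul_mink, Matrix.one_mul, Matrix.neg_mul]
  simp only [quat, Matrix.transpose_add, Matrix.transpose_smul, Matrix.transpose_one,
    Matrix.transpose_sum, h, Matrix.mul_add, Matrix.add_mul, Matrix.mul_smul, Matrix.smul_mul,
    Matrix.mul_one, mink_mul_mink, Matrix.mul_sum, Matrix.sum_mul, Pi.neg_apply, smul_neg, neg_smul,
    Matrix.mul_neg, Matrix.neg_mul]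

theorem det_quat (t : ℂ) (c : Fin 3 → ℂ) :
    (quat t c).det = (t ^ 2 + c 0 ^ 2 + c 1 ^ 2 + c 2 ^ 2) ^ 2 := by
  have : quat t c = !![t, Complex.I * c 0, Complex.I * c 1, Complex.I * c 2;
      Complex.I * c 0, t, c 2, -c 1; Complex.I * c 1, -c 2, t, c 0;
      Complex.I * c 2, c 1, -c 0, t] := by
    ext i j
    fin_cases i <;> fin_cases j <;>
      simp [quat, pauli, mink, sdBasis, Fin.sum_univ_three, Matrix.add_apply,
        Matrix.diagonal_mul] <;> ring_nf <;> simp [Complex.I_sq]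
  rw [this]
  simp [Matrix.det_succ_row_zero, Fin.sum_univ_succ, Fin.succAbove]
  ring_nf
  simp only [Complex.I_sq]
  ring

/-- The vector part of the quaternion of a rotation. -/
def axis (P : Matrix (Fin 3) (Fin 3) ℂ) : Fin 3 → ℂ :=
  ![P 1 2 - P 2 1, P 2 0 - P 0 2, P 0 1 - P 1 0]

/-- For a real rotation by θ, 1 + tr P = 4 cos²(θ/2) and the antisymmetric part carries 4 sin(θ/2)
cos(θ/2) times the unit axis: together they are 4 cos(θ/2) times the unit quaternion, up to the sign
convention. The resulting identities are polynomial and hold over ℂ. -/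
theorem quatRot_axis {P : Matrix (Fin 3) (Fin 3) ℂ} (h : P * Pᵀ = 1) (hd : P.det = 1) :
    quatRot (1 + P.trace) (axis P) = (4 * (1 + P.trace)) • P ∧
    (1 + P.trace) ^ 2 + axis P 0 ^ 2 + axis P 1 ^ 2 + axis P 2 ^ 2 = 4 * (1 + P.trace) := by
  have h' : Pᵀ * P = 1 := mul_eq_one_comm.mp h
  have hadj : P.adjugate = Pᵀ := by
    have := Matrix.adjugate_mul P
    calc P.adjugate = P.adjugate * (P * Pᵀ) := by rw [h, Matrix.mul_one]
      _ = Pᵀ := by rw [← Matrix.mul_assoc, this, hd, one_smul, Matrix.one_mul]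
  have row : ∀ i j, P i 0 * P j 0 + P i 1 * P j 1 + P i 2 * P j 2 = if i = j then 1 else 0 :=
    fun i j ↦ by
      have := congrFun (congrFun h i) j
      simpa [Matrix.mul_apply, Fin.sum_univ_three, Matrix.one_apply] using this
  have col : ∀ i j, P 0 i * P 0 j + P 1 i * P 1 j + P 2 i * P 2 j = if i = j then 1 else 0 :=
    fun i j ↦ by
      have := congrFun (congrFun h' i) j
      simpa [Matrix.mul_apply, Fin.sum_univ_three, Matrix.one_apply] using this
  have adj : ∀ i j, P.adjugate i j = P j i := fun i j ↦ by rw [hadj, Matrix.transpose_apply]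
  rw [Matrix.adjugate_fin_three] at adj
  have a00 := adj 0 0
  have a01 := adj 0 1
  have a02 := adj 0 2
  have a10 := adj 1 0
  have a11 := adj 1 1
  have a12 := adj 1 2
  have a20 := adj 2 0
  have a21 := adj 2 1
  have a22 := adj 2 2
  have r00 := row 0 0
  have r01 := row 0 1
  have r02 := row 0 2
  have r11 := row 1 1
  have r12 := row 1 2
  have r22 := row 2 2
  have c00 := col 0 0
  have c01 := col 0 1
  have c02 := col 0 2
  have c11 := col 1 1
  have c12 := col 1 2
  have c22 := col 2 2
  simp at a00 a01 a02 a10 a11 a12 a20 a21 a22 r00 r01 r02 r11 r12 r22 c00 c01 c02 c11 c12 c22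
  obtain ⟨t, ht⟩ : ∃ t, t = 1 + P.trace := ⟨_, rfl⟩
  have ht' : t = 1 + P 0 0 + P 1 1 + P 2 2 := by rw [ht, Matrix.trace_fin_three]; ring
  rw [← ht]
  -- All quadratic expressions in the axis reduce to entries of `P` by orthonormality of rows and
  -- columns together with adj P = Pᵀ, which encodes det P = 1.
  have e0 : (P 1 2 - P 2 1) ^ 2 = t * (2 + 2 * P 0 0 - t) := by
    rw [ht']; linear_combination r11 + r22 - c00 + 2 * a00
  have e1 : (P 2 0 - P 0 2) ^ 2 = t * (2 + 2 * P 1 1 - t) := by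
    rw [ht']; linear_combination r00 + r22 - c11 + 2 * a11
  have e2 : (P 0 1 - P 1 0) ^ 2 = t * (2 + 2 * P 2 2 - t) := by
    rw [ht']; linear_combination r00 + r11 - c22 + 2 * a22
  have e01 : (P 1 2 - P 2 1) * (P 2 0 - P 0 2) = t * (P 0 1 + P 1 0) := by
    rw [ht']; linear_combination a10 + a01 - r01 - c01
  have e02 : (P 1 2 - P 2 1) * (P 0 1 - P 1 0) = t * (P 0 2 + P 2 0) := by
    rw [ht']; linear_combination a20 + a02 - r02 - c02
  have e12 : (P 2 0 - P 0 2) * (P 0 1 - P 1 0) = t * (P 1 2 + P 2 1) := by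
    rw [ht']; linear_combination a21 + a12 - r12 - c12
  refine ⟨?_, ?_⟩
  · ext i j
    fin_cases i <;> fin_cases j <;> simp [quatRot, axis]
    · linear_combination e0 - e1 - e2 + 2 * t * ht'
    · linear_combination 2 * e01
    · linear_combination 2 * e02
    · linear_combination 2 * e01
    · linear_combination e1 - e0 - e2 + 2 * t * ht'
    · linear_combination 2 * e12
    · linear_combination 2 * e02
    · linear_combination 2 * e12
    · linear_combination e2 - e0 - e1 + 2 * t * ht'
  · simp [axis]
    linear_combination e0 + e1 + e2 - 2 * t * ht'

theorem Commute.quat_left {X : Matrix (Fin 4) (Fin 4) ℂ} (h : ∀ A, Commute (pauli A) X) (t : ℂ)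
    (c : Fin 3 → ℂ) : Commute (quat t c) X :=
  ((Commute.one_left X).smul_left t).add_left
    ((Commute.sum_left _ _ _ fun A _ ↦ (h A).smul_left (c A)).smul_left Complex.I)

theorem map_conj_mink : mink.map (starRingEnd ℂ) = mink := by
  ext i j; rw [Matrix.map_apply, mink_apply, Complex.conj_ofReal]

theorem quat_map_conj (t : ℂ) (c : Fin 3 → ℂ) : (quat t c).map (starRingEnd ℂ) =
    (starRingEnd ℂ t) • 1 +
      -Complex.I • ∑ A, (starRingEnd ℂ (c A)) • (pauli A).map (starRingEnd ℂ) := by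
  ext i j
  simp [quat, Matrix.sum_apply, Matrix.one_apply, apply_ite (starRingEnd ℂ)]

theorem pauli_commute_conj (A B : Fin 3) :
    Commute (pauli A) ((pauli B).map (starRingEnd ℂ)) := by
  simp only [Commute, SemiconjBy, pauli, Matrix.map_mul, map_conj_mink]
  rw [Matrix.mul_assoc, ← Matrix.mul_assoc (sdBasis A), sdBasis_commute_conj]
  simp only [Matrix.mul_assoc]

theorem quat_commute_conj (t s : ℂ) (c d : Fin 3 → ℂ) :
    Commute (quat t c) ((quat s d).map (starRingEnd ℂ)) := by
  refine Commute.quat_left (fun A ↦ ?_) t c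
  rw [quat_map_conj]
  exact ((Commute.one_right _).smul_right _).add_right
    ((Commute.sum_right _ _ _ fun B _ ↦ (pauli_commute_conj A B).smul_right _).smul_right _)

/-- The squared norm of a quaternion. -/
def quatNorm (t : ℂ) (c : Fin 3 → ℂ) : ℂ := t ^ 2 + c 0 ^ 2 + c 1 ^ 2 + c 2 ^ 2

/-- The Lorentz transformation defined by a quaternion. -/
def lorentz (t : ℂ) (c : Fin 3 → ℂ) : Matrix (Fin 4) (Fin 4) ℝ :=
  Matrix.of fun i j ↦ ((quat t c * (quat t c).map (starRingEnd ℂ)) i j).re /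
    Real.sqrt (Complex.normSq (quatNorm t c))

/-- A quaternion commutes with its complex conjugate, so their product is a real matrix and taking
real parts in `lorentz` loses nothing. -/
theorem map_lorentz (t : ℂ) (c : Fin 3 → ℂ) : (lorentz t c).map Complex.ofRealHom =
    ((Real.sqrt (Complex.normSq (quatNorm t c)) : ℝ) : ℂ)⁻¹ •
      (quat t c * (quat t c).map (starRingEnd ℂ)) := by
  have h : (quat t c * (quat t c).map (starRingEnd ℂ)).map (starRingEnd ℂ) =
      quat t c * (quat t c).map (starRingEnd ℂ) := by
    rw [Matrix.map_mul, Matrix.map_map, (quat_commute_conj t t c c).eq]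
    congr 1
    ext i j
    simp
  ext i j
  have h1 := Complex.conj_eq_iff_re.mp (congrFun (congrFun h i) j)
  rw [Matrix.map_apply, Matrix.smul_apply, smul_eq_mul, ← h1, lorentz, Matrix.of_apply]
  simp only [Complex.ofRealHom_eq_coe, Complex.ofReal_div]
  ring

section

variable {t : ℂ} {c : Fin 3 → ℂ} (hN : quatNorm t c ≠ 0)
include hN

theorem sqrt_normSq_sq : (((Real.sqrt (Complex.normSq (quatNorm t c)) : ℝ) : ℂ)⁻¹) ^ 2 *
    (quatNorm t c * starRingEnd ℂ (quatNorm t c)) = 1 := by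
  rw [Complex.mul_conj, ← Complex.ofReal_inv, ← Complex.ofReal_pow, ← Complex.ofReal_mul, inv_pow,
    Real.sq_sqrt (Complex.normSq_nonneg _), inv_mul_cancel₀ (Complex.normSq_pos.mpr hN).ne',
    Complex.ofReal_one]

/-- The complex-conjugate quaternions pass through `X` and meet, contributing only the conjugate of
the norm; with the normalisation 1/|N|² this leaves conjugation by q over its norm N. `X = 1` gives
the Lorentz property, `X = pauli A` the rotation of self-dual bivectors. -/
theorem lorentz_transpose_mul_mul (X : Matrix (Fin 4) (Fin 4) ℂ) (hX : ∀ A,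
    Commute ((pauli A).map (starRingEnd ℂ)) X) : ((lorentz t c).map Complex.ofRealHom)ᵀ *
    (mink * X) * (lorentz t c).map Complex.ofRealHom =
      (quatNorm t c)⁻¹ • (mink * (quat t (-c) * X * quat t c)) := by
  have hc : Commute ((quat t c).map (starRingEnd ℂ)) (quat t (-c) * X * quat t c) := by
    have hX' : Commute ((quat t c).map (starRingEnd ℂ)) X := by
      rw [quat_map_conj]
      exact ((Commute.one_left X).smul_left _).add_left
        ((Commute.sum_left _ _ _ fun A _ ↦ (hX A).smul_left _).smul_left _)
    exact ((quat_commute_conj _ _ _ _).symm.mul_right hX').mul_right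
      (quat_commute_conj _ _ _ _).symm
  have hT : (quat t c * (quat t c).map (starRingEnd ℂ))ᵀ =
      mink * ((quat t (-c)).map (starRingEnd ℂ) * quat t (-c)) * mink := by
    have h : ((quat t c).map (starRingEnd ℂ))ᵀ =
        mink * (quat t (-c)).map (starRingEnd ℂ) * mink := by
      rw [← Matrix.transpose_map, quat_transpose, Matrix.map_mul, Matrix.map_mul, map_conj_mink]
    rw [Matrix.transpose_mul, h, quat_transpose]
    calc _ = mink * (quat t (-c)).map (starRingEnd ℂ) * (mink * mink) * quat t (-c) * mink := by
          simp only [Matrix.mul_assoc]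
      _ = _ := by rw [mink_mul_mink, Matrix.mul_one]; simp only [Matrix.mul_assoc]
  have hconj : (quat t (-c)).map (starRingEnd ℂ) * (quat t c).map (starRingEnd ℂ) =
      starRingEnd ℂ (quatNorm t c) • 1 := by
    rw [← Matrix.map_mul, quat_conj_mul]
    ext i j
    simp [quatNorm, Matrix.one_apply, apply_ite (starRingEnd ℂ)]
  have hs := sqrt_normSq_sq hN
  rw [map_lorentz, Matrix.transpose_smul, hT]
  set n := ((Real.sqrt (Complex.normSq (quatNorm t c)) : ℝ) : ℂ)⁻¹
  have hs' : n ^ 2 * starRingEnd ℂ (quatNorm t c) = (quatNorm t c)⁻¹ := by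
    field_simp
    linear_combination hs
  simp only [Matrix.smul_mul, Matrix.mul_smul, smul_smul]
  rw [← pow_two, ← hs', mul_smul]
  congr 1
  calc _ = mink * (quat t (-c)).map (starRingEnd ℂ) * quat t (-c) * (mink * mink) * X * quat t c *
        (quat t c).map (starRingEnd ℂ) := by simp only [Matrix.mul_assoc]
    _ = mink * (quat t (-c)).map (starRingEnd ℂ) * ((quat t (-c) * X * quat t c) *
        (quat t c).map (starRingEnd ℂ)) := by
      rw [mink_mul_mink, Matrix.mul_one]; simp only [Matrix.mul_assoc]
    _ = mink * ((quat t (-c)).map (starRingEnd ℂ) * (quat t c).map (starRingEnd ℂ)) *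
        (quat t (-c) * X * quat t c) := by rw [← hc.eq]; simp only [Matrix.mul_assoc]
    _ = _ := by rw [hconj, Matrix.mul_smul, Matrix.mul_one, Matrix.smul_mul]

theorem lorentz_transpose_mul_mink_mul : ((lorentz t c).map Complex.ofRealHom)ᵀ *
    mink * (lorentz t c).map Complex.ofRealHom = mink := by
  have h := lorentz_transpose_mul_mul hN 1 fun A ↦ Commute.one_right _
  rw [Matrix.mul_one, Matrix.mul_one, quat_conj_mul, Matrix.mul_smul, smul_smul,
    Matrix.mul_one] at h
  rw [h, ← quatNorm, inv_mul_cancel₀ hN, one_smul]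

theorem lorentz_transpose_mul_sdBasis_mul (A : Fin 3) : ((lorentz t c).map Complex.ofRealHom)ᵀ *
    sdBasis A * (lorentz t c).map Complex.ofRealHom =
      ∑ B, ((quatNorm t c)⁻¹ * quatRot t c A B) • sdBasis B := by
  have hm : ∀ B, mink * pauli B = sdBasis B := fun B ↦ by
    rw [pauli, ← Matrix.mul_assoc, mink_mul_mink, Matrix.one_mul]
  have h := lorentz_transpose_mul_mul hN (pauli A) fun B ↦ (pauli_commute_conj A B).symm
  rw [hm, quat_conj_mul_pauli_mul] at h
  rw [h]
  simp only [Matrix.mul_sum, Matrix.mul_smul, hm, Finset.smul_sum, smul_smul]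

theorem det_lorentz : (lorentz t c).det = 1 := by
  have h1 : ((lorentz t c).map Complex.ofRealHom).det = 1 := by
    have h2 : ((quat t c).map (starRingEnd ℂ)).det = starRingEnd ℂ (quatNorm t c ^ 2) := by
      rw [quatNorm, ← det_quat, RingHom.map_det]; rfl
    rw [map_lorentz, Matrix.det_smul, Matrix.det_mul, det_quat, ← quatNorm, h2, map_pow,
      Fintype.card_fin]
    linear_combination ((((Real.sqrt (Complex.normSq (quatNorm t c)) : ℝ) : ℂ)⁻¹) ^ 2 *
      (quatNorm t c * starRingEnd ℂ (quatNorm t c)) + 1) * sqrt_normSq_sq hN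
  have h3 : Complex.ofRealHom (lorentz t c).det = 1 := by rw [RingHom.map_det]; exact h1
  exact Complex.ofReal_injective (h3.trans Complex.ofReal_one.symm)

end

/-- The frame obtained from `E` by the Lorentz transformation of a quaternion. -/
def boostFrame (t : ℂ) (c : Fin 3 → ℂ) (E : Matrix (Fin 4) (Fin 4) ℝ) : Matrix (Fin 4) (Fin 4) ℝ :=
  Matrix.of minkowski * lorentz t c * Matrix.of minkowski * E

section

variable {t : ℂ} {c : Fin 3 → ℂ} (hN : quatNorm t c ≠ 0) {g : Matrix (Fin 4) (Fin 4) ℝ}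
  {η : Fin 4 → Fin 4 → Fin 4 → Fin 4 → ℝ} {E : Matrix (Fin 4) (Fin 4) ℝ}
include hN

theorem lorentz_mul_minkowski_mul :
    lorentz t c * Matrix.of minkowski * (lorentz t c)ᵀ = Matrix.of minkowski := by
  have h1 : (lorentz t c)ᵀ * Matrix.of minkowski * lorentz t c = Matrix.of minkowski := by
    apply Matrix.map_injective Complex.ofReal_injective
    have := lorentz_transpose_mul_mink_mul hN
    rw [← map_minkowski, ← Matrix.transpose_map, ← Matrix.map_mul, ← Matrix.map_mul] at this
    exact this
  have h2 : (Matrix.of minkowski * (lorentz t c)ᵀ * Matrix.of minkowski) * lorentz t c = 1 := by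
    rw [← minkowski_mul_self]
    nth_rewrite 4 [← h1]
    simp only [Matrix.mul_assoc]
  have h3 := mul_eq_one_comm.mp h2
  calc _ = lorentz t c * (Matrix.of minkowski * (lorentz t c)ᵀ * Matrix.of minkowski) *
        Matrix.of minkowski := by
        simp only [Matrix.mul_assoc, minkowski_mul_self, Matrix.mul_one]
    _ = _ := by rw [h3, Matrix.one_mul]

/-- The conjugation by the Minkowski matrix in `boostFrame` is the inverse transpose of the Lorentz
matrix, chosen so that the dual basis transforms by the Lorentz matrix itself. -/
theorem dualBasis_boostFrame :
    dualBasis (boostFrame t c E) = (lorentz t c).map Complex.ofRealHom * dualBasis E := by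
  have h1 : (Matrix.of minkowski * lorentz t c * Matrix.of minkowski) * (lorentz t c)ᵀ = 1 := by
    rw [Matrix.mul_assoc, Matrix.mul_assoc, ← Matrix.mul_assoc (lorentz t c),
      lorentz_mul_minkowski_mul hN, minkowski_mul_self]
  rw [dualBasis, boostFrame, Matrix.mul_inv_rev, Matrix.inv_eq_right_inv h1, Matrix.transpose_mul,
    Matrix.transpose_transpose, Matrix.map_mul, dualBasis]

theorem IsOrientedFrame.boostFrame (hE : IsOrientedFrame g η E) :
    IsOrientedFrame g η (boostFrame t c E) := by
  obtain ⟨v, hv, hv1⟩ := hE.volume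
  refine ⟨?_, v, hv, ?_⟩
  · calc _ = Matrix.of minkowski * lorentz t c * Matrix.of minkowski * (E * g * Eᵀ) *
          (Matrix.of minkowski * (lorentz t c)ᵀ * Matrix.of minkowski) := by
          simp only [Spacetime.boostFrame, Matrix.transpose_mul, minkowski_transpose,
            Matrix.mul_assoc]
      _ = Matrix.of minkowski * lorentz t c * (Matrix.of minkowski * Matrix.of minkowski) *
          Matrix.of minkowski * (lorentz t c)ᵀ * Matrix.of minkowski := by
          rw [hE.orthonormal]; simp only [Matrix.mul_assoc]
      _ = Matrix.of minkowski * (lorentz t c * Matrix.of minkowski * (lorentz t c)ᵀ) *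
          Matrix.of minkowski := by
          rw [minkowski_mul_self, Matrix.mul_one]; simp only [Matrix.mul_assoc]
      _ = _ := by
          rw [lorentz_mul_minkowski_mul hN, minkowski_mul_self, Matrix.one_mul]
  · have h : (Matrix.of minkowski).det * (Matrix.of minkowski).det = 1 := by
      rw [← Matrix.det_mul, minkowski_mul_self, Matrix.det_one]
    rw [Spacetime.boostFrame, Matrix.det_mul, Matrix.det_mul, Matrix.det_mul, det_lorentz hN]
    linear_combination (v * E.det) * h + hv1

theorem sdBiv_boostFrame (A : Fin 3) : sdBiv (dualBasis (Spacetime.boostFrame t c E)) A =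
    ∑ B, ((quatNorm t c)⁻¹ * quatRot t c A B) • sdBiv (dualBasis E) B := by
  rw [dualBasis_boostFrame hN, sdBiv, Matrix.transpose_mul]
  calc _ = (dualBasis E)ᵀ * (((lorentz t c).map Complex.ofRealHom)ᵀ * sdBasis A *
        (lorentz t c).map Complex.ofRealHom) * dualBasis E := by simp only [Matrix.mul_assoc]
    _ = _ := by
      rw [lorentz_transpose_mul_sdBasis_mul hN]
      simp only [Matrix.mul_sum, Matrix.sum_mul, Matrix.mul_smul, Matrix.smul_mul, sdBiv]

end

/-- A rotation of the self-dual bivectors of a frame is realized by a Lorentz transformation of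
the frame. -/
theorem dbl_boostFrame {P Q R : Matrix (Fin 3) (Fin 3) ℂ} (hP : P * Pᵀ = 1) (hd : P.det = 1)
    (ht : 1 + P.trace ≠ 0) (hR : P * Q * Pᵀ = R) (E : Matrix (Fin 4) (Fin 4) ℝ) :
    dbl (dualBasis E) Q = dbl (dualBasis (boostFrame (1 + P.trace) (axis P) E)) R := by
  obtain ⟨h1, h2⟩ := quatRot_axis hP hd
  have h4 : 4 * (1 + P.trace) ≠ 0 := mul_ne_zero (by norm_num) ht
  have h2' : quatNorm (1 + P.trace) (axis P) = 4 * (1 + P.trace) := h2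
  have hN : quatNorm (1 + P.trace) (axis P) ≠ 0 := h2' ▸ h4
  -- The norm of this quaternion is exactly the factor 4 (1 + tr P) in front of `P`, so the induced
  -- rotation is `P` itself.
  have h3 : ∀ A, sdBiv (dualBasis (boostFrame (1 + P.trace) (axis P) E)) A =
      ∑ B, P A B • sdBiv (dualBasis E) B := fun A ↦ by
    rw [sdBiv_boostFrame hN, h1, h2']
    simp only [Matrix.smul_apply, smul_eq_mul, inv_mul_cancel_left₀ h4]
  have hQ : Q = Pᵀ * R * P := by
    have h' : Pᵀ * P = 1 := mul_eq_one_comm.mp hP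
    rw [← hR]
    calc Q = (Pᵀ * P) * Q * (Pᵀ * P) := by rw [h', Matrix.one_mul, Matrix.mul_one]
      _ = _ := by simp only [Matrix.mul_assoc]
  ext i j k l
  simp only [dbl, h3, hQ, Matrix.mul_apply, Matrix.transpose_apply, Matrix.sum_apply,
    Matrix.smul_apply, smul_eq_mul, Fin.sum_univ_three]
  ring

end

section

open Matrix Filter Topology

/-! ### Existence of principal frames in coordinates -/

theorem SmoothNear.matrix_mul {𝕜 : Type*} [RCLike 𝕜] {n : Type*} [Fintype n]
    {A B : Coord → Matrix n n 𝕜} {y : Coord} (hA : ∀ i j, SmoothNear (fun z ↦ A z i j) y)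
    (hB : ∀ i j, SmoothNear (fun z ↦ B z i j) y) (i j : n) :
    SmoothNear (fun z ↦ (A z * B z) i j) y := by
  simp only [Matrix.mul_apply]
  exact SmoothNear.sum fun k _ ↦ (hA i k).mul (hB k j)

theorem smoothNear_boostFrame {t : Coord → ℂ} {c : Coord → Fin 3 → ℂ}
    {E : Coord → Matrix (Fin 4) (Fin 4) ℝ} {y : Coord} (ht : SmoothNear t y)
    (hc : ∀ A, SmoothNear (fun z ↦ c z A) y) (hE : ∀ a i, SmoothNear (fun z ↦ E z a i) y)
    (hN : quatNorm (t y) (c y) ≠ 0) (a i : Fin 4) :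
    SmoothNear (fun z ↦ boostFrame (t z) (c z) (E z) a i) y := by
  have hq : ∀ i j, SmoothNear (fun z ↦ quat (t z) (c z) i j) y := fun i j ↦ by
    simp only [quat, Matrix.add_apply, Matrix.smul_apply, Matrix.sum_apply, smul_eq_mul]
    exact (ht.mul (SmoothNear.const _)).add ((SmoothNear.const _).mul
      (SmoothNear.sum fun A _ ↦ (hc A).mul (SmoothNear.const _)))
  have hn : SmoothNear (fun z ↦ Complex.normSq (quatNorm (t z) (c z))) y := by
    have h1 : SmoothNear (fun z ↦ quatNorm (t z) (c z)) y :=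
      (((ht.pow 2).add ((hc 0).pow 2)).add ((hc 1).pow 2)).add ((hc 2).pow 2)
    simp only [Complex.normSq_apply]
    exact (h1.re.mul h1.re).add (h1.im.mul h1.im)
  have hn0 : Complex.normSq (quatNorm (t y) (c y)) ≠ 0 := (Complex.normSq_pos.mpr hN).ne'
  have hl : ∀ i j, SmoothNear (fun z ↦ lorentz (t z) (c z) i j) y := fun i j ↦ by
    simp only [lorentz, Matrix.of_apply]
    refine SmoothNear.div (SmoothNear.re (SmoothNear.matrix_mul
      (A := fun z ↦ quat (t z) (c z)) (B := fun z ↦ (quat (t z) (c z)).map (starRingEnd ℂ))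
      hq (fun i j ↦ ?_) i j)) (hn.sqrt hn0) (Real.sqrt_ne_zero'.mpr (Complex.normSq_pos.mpr hN))
    simp only [Matrix.map_apply]
    exact (hq i j).conj
  have hm : ∀ i j, SmoothNear (fun _ ↦ (Matrix.of minkowski) i j) y := fun i j ↦
    SmoothNear.const _
  have h1 := SmoothNear.matrix_mul (A := fun _ ↦ Matrix.of minkowski)
    (B := fun z ↦ lorentz (t z) (c z)) hm hl
  have h2 := SmoothNear.matrix_mul (A := fun z ↦ Matrix.of minkowski * lorentz (t z) (c z))
    (B := fun _ ↦ Matrix.of minkowski) h1 hm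
  exact SmoothNear.matrix_mul (B := E)
    (A := fun z ↦ Matrix.of minkowski * lorentz (t z) (c z) * Matrix.of minkowski) h2 hE a i

variable {g : Coord → Matrix (Fin 4) (Fin 4) ℝ} {η : Coord → Fin 4 → Fin 4 → Fin 4 → Fin 4 → ℝ}
  {U : Set Coord} {y : Coord}

theorem IsSmoothMetricOn.mono (hg : IsSmoothMetricOn g U) {V : Set Coord} (hV : IsOpen V)
    (hVU : V ⊆ U) : IsSmoothMetricOn g V where
  isOpen := hV
  smooth i j := (hg.smooth i j).mono hVU
  symm z hz := hg.symm z (hVU hz)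
  mul_inv z hz := hg.mul_inv z (hVU hz)

theorem exists_isSmoothFrameOn (hg : IsSmoothMetricOn g U) (hy : y ∈ U)
    {E : Coord → Matrix (Fin 4) (Fin 4) ℝ} (hE : ∀ a i, SmoothNear (fun z ↦ E z a i) y)
    (hf : ∀ᶠ z in 𝓝 y, IsOrientedFrame (g z) (η z) (E z)) {p : Coord → Prop}
    (hp : ∀ᶠ z in 𝓝 y, p z) :
    ∃ V ⊆ U, y ∈ V ∧ IsSmoothFrameOn g η V (fun z ↦ E z) ∧ ∀ z ∈ V, p z := by
  have h1 : ∀ᶠ z in 𝓝 y, ∀ a i, ContDiffAt ℝ ∞ (fun z ↦ E z a i) z :=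
    Filter.eventually_all.mpr fun a ↦ Filter.eventually_all.mpr fun i ↦ hE a i
  obtain ⟨V, hV, hVo, hyV⟩ := _root_.eventually_nhds_iff.mp
    ((hg.isOpen.eventually_mem hy).and (h1.and (hf.and hp)))
  exact ⟨V, fun z hz ↦ (hV z hz).1, hyV, ⟨hg.mono hVo fun z hz ↦ (hV z hz).1,
    fun a i z hz ↦ ((hV z hz).2.1 a i).contDiffWithinAt, fun z hz ↦ (hV z hz).2.2.1⟩,
    fun z hz ↦ (hV z hz).2.2.2⟩

/-- Near a point where the Weyl tensor is of type I there is a smooth principal frame. -/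
theorem exists_smooth_principalFrame (hg : IsSmoothMetricOn g U) {v : Coord → ℝ}
    (hv : ContDiffOn ℝ ∞ v U) (hη : ∀ z ∈ U, ∀ i j k l, η z i j k l = v z * levi i j k l)
    (hv1 : ∀ z ∈ U, ∀ E : Matrix (Fin 4) (Fin 4) ℝ, E * g z * Eᵀ = Matrix.of minkowski →
      (v z * E.det) * (v z * E.det) = 1)
    (hy : y ∈ U) (hsig : ∃ E : Matrix (Fin 4) (Fin 4) ℝ, E * g y * Eᵀ = Matrix.of minkowski)
    (hI : IsTypeI g η y) :
    ∃ V ⊆ U, ∃ e, y ∈ V ∧ IsSmoothFrameOn g η V e ∧ ∀ z ∈ V, DiagonalizesWeyl g η e z := by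
  have hU := hg.isOpen.eventually_mem hy
  obtain ⟨E, hE, hf⟩ := exists_smooth_orientedFrame
    (fun i j ↦ SmoothNear.of_contDiffOn hg.isOpen hy (hg.smooth i j))
    (hU.mono fun z hz ↦ Matrix.ext fun i j ↦ hg.symm z hz j i)
    (SmoothNear.of_contDiffOn hg.isOpen hy hv) (hU.mono hη) (hU.mono hv1) hsig
  obtain ⟨V, hVU, hyV, hEV, -⟩ := exists_isSmoothFrameOn hg hy hE hf (p := fun _ ↦ True)
    (Eventually.of_forall fun _ ↦ trivial)
  have hVo := hEV.metric.isOpen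
  have hV := hVo.eventually_mem hyV
  have hΔ := IsTypeI.invDelta_ne_zero (hEV.frame y hyV) hI (hEV.sdWeyl_eq_dbl hyV)
    (hEV.frameWeyl_trace hyV)
  obtain ⟨ha, hb, -⟩ := invDelta_eq (hEV.frame y hyV) (hEV.sdWeyl_eq_dbl hyV)
  rw [invDelta, ha, hb] at hΔ
  -- The discriminant is needed only at `y`; nearby it stays nonzero by continuity.
  obtain ⟨P, α, hP, ht, hPz⟩ := exists_smooth_specialOrthogonal
    (Q := fun z ↦ frameWeyl g z (E z))
    (fun A B ↦ SmoothNear.of_contDiffOn hVo hyV (hEV.metric.contDiffOn_frameWeyl hEV.smooth A B))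
    (hV.mono fun z hz ↦ hEV.frameWeyl_symm hz) (hV.mono fun z hz ↦ hEV.frameWeyl_trace hz) hΔ
  have htr : SmoothNear (fun z ↦ 1 + (P z).trace) y :=
    (SmoothNear.const 1).add (SmoothNear.sum fun i _ ↦ hP i i)
  have haxis : ∀ A, SmoothNear (fun z ↦ axis (P z) A) y := fun A ↦ by
    fin_cases A
    · exact (hP 1 2).sub (hP 2 1)
    · exact (hP 2 0).sub (hP 0 2)
    · exact (hP 0 1).sub (hP 1 0)
  have hN : ∀ z, (P z * (P z)ᵀ = 1 ∧ (P z).det = 1 ∧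
      P z * frameWeyl g z (E z) * (P z)ᵀ = Matrix.diagonal (α z)) → 1 + (P z).trace ≠ 0 →
      quatNorm (1 + (P z).trace) (axis (P z)) ≠ 0 := fun z h h0 ↦ by
    rw [quatNorm, (quatRot_axis h.1 h.2.1).2]
    exact mul_ne_zero (by norm_num) h0
  have ht' := htr.continuousAt.eventually_ne ht
  obtain ⟨W, hWV, hyW, hW, hpW⟩ := exists_isSmoothFrameOn (η := η)
    (E := fun z ↦ boostFrame (1 + (P z).trace) (axis (P z)) (E z)) hEV.metric hyV
    (fun a i ↦ smoothNear_boostFrame htr haxis hE (hN y hPz.self_of_nhds ht) a i)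
    (by filter_upwards [hf, hPz, ht'] with z h1 h2 h3 using h1.boostFrame (hN z h2 h3))
    (hPz.and ht')
  refine ⟨W, hWV.trans hVU, _, hyW, hW, fun z hz ↦ (hW.diagonalizesWeyl_iff hz).mpr ⟨α z, ?_⟩⟩
  obtain ⟨⟨h1, h2, h3⟩, h4⟩ := hpW z hz
  refine eq_of_dbl_eq (dual_mul_ginv_mul (hW.frame z hz)) ((hW.sdWeyl_eq_dbl hz).symm.trans ?_)
  exact (hEV.sdWeyl_eq_dbl (hWV hz)).trans (dbl_boostFrame h1 h2 h4 h3 _)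

end

section

open Matrix Filter Topology

/-! ### From the manifold to coordinates -/

section Manifold

variable {M : Type*} [TopologicalSpace M] [ChartedSpace Coord M]
  {φ : OpenPartialHomeomorph M Coord} (hφ : φ ∈ IsManifold.maximalAtlas (𝓡 4) ∞ M)

/-- The vector at the point with coordinates `y` with components `w` in the chart `φ`. -/
def liftVec (φ : OpenPartialHomeomorph M Coord) (y : Coord) (w : Coord) :
    TangentSpace (𝓡 4) (φ.symm y) :=
  mfderiv (𝓡 4) (𝓡 4) φ.symm y w

theorem liftVec_eq_sum (y w : Coord) : liftVec φ y w = ∑ i, w i • coordVec φ y i := by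
  have h : w = ∑ i, w i • EuclideanSpace.single i (1 : ℝ) := by
    ext j; simp [Finset.sum_apply, Pi.single_apply]
  conv_lhs => rw [h]
  simp only [liftVec, coordVec]
  erw [map_sum]
  exact Finset.sum_congr rfl fun i _ ↦ map_smul _ _ _

include hφ

theorem mdifferentiable_of_mem_maximalAtlas : φ.MDifferentiable (𝓡 4) (𝓡 4) :=
  ⟨(contMDiffOn_of_mem_maximalAtlas hφ).mdifferentiableOn (by simp),
    (contMDiffOn_symm_of_mem_maximalAtlas hφ).mdifferentiableOn (by simp)⟩

theorem mfderiv_liftVec {y : Coord} (hy : y ∈ φ.target) (w : Coord) :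
    (mfderiv (𝓡 4) (𝓡 4) φ (φ.symm y) (liftVec φ y w) : Coord) = w :=
  congrArg (fun L : Coord →L[ℝ] Coord ↦ L w)
    ((mdifferentiable_of_mem_maximalAtlas hφ).comp_symm_deriv hy)

theorem liftVec_vecIn {y : Coord} (hy : y ∈ φ.target) (v : ∀ x : M, TangentSpace (𝓡 4) x) :
    liftVec φ y (vecIn φ v y) = v (φ.symm y) := by
  have h := (mdifferentiable_of_mem_maximalAtlas hφ).symm_comp_deriv (φ.map_target hy)
  rw [φ.right_inv hy] at h
  exact congrArg (fun L : Coord →L[ℝ] Coord ↦ L (v (φ.symm y))) h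

theorem liftVec_surjective {y : Coord} (hy : y ∈ φ.target) (v : TangentSpace (𝓡 4) (φ.symm y)) :
    ∃ w, liftVec φ y w = v := by
  refine ⟨(mfderiv (𝓡 4) (𝓡 4) φ (φ.symm y) v : Coord), ?_⟩
  have h := (mdifferentiable_of_mem_maximalAtlas hφ).symm_comp_deriv (φ.map_target hy)
  rw [φ.right_inv hy] at h
  exact congrArg (fun L : Coord →L[ℝ] Coord ↦ L v) h

variable [IsManifold (𝓡 4) ∞ M]

/-- Lifting is the tangent map of the inverse chart, smooth because the chart belongs to the maximal
atlas. -/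
theorem contMDiffOn_liftVec {V : Set Coord} (hV : V ⊆ φ.target) {w : Coord → Coord}
    (hw : ContDiffOn ℝ ∞ w V) : ContMDiffOn (𝓡 4) (𝓡 4).tangent ∞
      (fun y ↦ (⟨φ.symm y, liftVec φ y (w y)⟩ : TangentBundle (𝓡 4) M)) V := by
  have h1 := (contMDiffOn_symm_of_mem_maximalAtlas hφ).contMDiffOn_tangentMapWithin (m := ∞)
    (by simp) φ.open_target.uniqueMDiffOn
  have h2 : ContMDiffOn (𝓡 4) (𝓡 4).tangent ∞
      (fun y ↦ (⟨y, w y⟩ : TangentBundle (𝓡 4) Coord)) V :=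
    contMDiffOn_vectorSpace_iff_contDiffOn.mpr hw
  refine (h1.comp h2 fun y hy ↦ hV hy).congr fun y hy ↦ ?_
  simp only [Function.comp_apply, tangentMapWithin]
  rw [mfderivWithin_of_isOpen φ.open_target (hV hy)]
  rfl

theorem contDiffOn_vecIn {V : Set M} (hV : V ⊆ φ.source) {v : ∀ x : M, TangentSpace (𝓡 4) x}
    (hv : ContMDiffOn (𝓡 4) (𝓡 4).tangent ∞
      (fun x ↦ (⟨x, v x⟩ : TangentBundle (𝓡 4) M)) V) :
    ContDiffOn ℝ ∞ (vecIn φ v) (φ.target ∩ φ.symm ⁻¹' V) := by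
  have h1 := (contMDiffOn_of_mem_maximalAtlas hφ).contMDiffOn_tangentMapWithin (m := ∞)
    (by simp) φ.open_source.uniqueMDiffOn
  have h2 := (h1.comp hv fun x hx ↦ hV hx).comp ((contMDiffOn_symm_of_mem_maximalAtlas hφ).mono
    Set.inter_subset_left) (s := φ.target ∩ φ.symm ⁻¹' V) fun y hy ↦ hy.2
  refine contMDiffOn_vectorSpace_iff_contDiffOn.mp (h2.congr fun y hy ↦ ?_)
  simp only [Function.comp_apply, tangentMapWithin]
  rw [mfderivWithin_of_isOpen φ.open_source (φ.map_target hy.1)]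
  -- The base point produced by the composition is φ (φ.symm y), only propositionally equal to `y`;
  -- it is generalised so that the fibres can be identified.
  have : ∀ p : Coord, p = y → (⟨y, vecIn φ v y⟩ : TangentBundle (𝓡 4) Coord) =
      ⟨p, (vecIn φ v y : Coord)⟩ := by
    rintro p rfl; rfl
  exact this _ (φ.right_inv hy.1)

namespace LorentzStructure

variable (S : LorentzStructure M)

omit hφ in
theorem metric_liftVec (y : Coord) (E : Matrix (Fin 4) (Fin 4) ℝ) (a b : Fin 4) :
    S.metric (φ.symm y) (∑ i, E a i • coordVec φ y i) (∑ j, E b j • coordVec φ y j) =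
      (E * S.metricIn φ y * Eᵀ) a b := by
  simp only [map_sum, map_smul, _root_.sum_apply, _root_.smul_apply,
    smul_eq_mul, Matrix.mul_apply, Matrix.transpose_apply, metricIn, Matrix.of_apply,
    Finset.sum_mul, Finset.mul_sum]
  exact Finset.sum_congr rfl fun _ _ ↦ Finset.sum_congr rfl fun _ _ ↦ by ring

omit hφ in
-- An alternating form of top degree is its value on a basis times the determinant.
theorem vol_liftVec (y : Coord) (E : Matrix (Fin 4) (Fin 4) ℝ) :
    S.vol (φ.symm y) (fun a ↦ ∑ i, E a i • coordVec φ y i) =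
      S.vol (φ.symm y) (coordVec φ y) * E.det := by
  have h := ((S.vol (φ.symm y)).compLinearMap
    (Fintype.linearCombination ℝ (coordVec φ y))).eq_smul_basis_det (Pi.basisFun ℝ (Fin 4))
  have hd : (Pi.basisFun ℝ (Fin 4)).det (fun a i ↦ E a i) = E.det :=
    Pi.basisFun_det_apply fun a i ↦ E a i
  have hb : ((S.vol (φ.symm y)).compLinearMap (Fintype.linearCombination ℝ (coordVec φ y)))
      (Pi.basisFun ℝ (Fin 4)) = S.vol (φ.symm y) (coordVec φ y) := by
    rw [AlternatingMap.compLinearMap_apply]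
    congr 1
    funext i
    simp [Fintype.linearCombination_apply, Pi.single_apply]
  rw [hb] at h
  rw [← hd]
  exact DFunLike.congr_fun h fun a i ↦ E a i

omit hφ in
theorem volIn_eq (y : Coord) (i j k l : Fin 4) :
    S.volIn φ y i j k l = S.vol (φ.symm y) (coordVec φ y) * levi i j k l := by
  rw [← levi_eq_det, ← vol_liftVec, volIn]
  congr 1
  funext a
  fin_cases a <;> simp [Matrix.one_apply]

theorem contDiffOn_metricIn (i j : Fin 4) :
    ContDiffOn ℝ ∞ (fun y ↦ S.metricIn φ y i j) φ.target := by
  have hc : ∀ i, ContMDiffOn (𝓡 4) (𝓡 4).tangent ∞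
      (fun y ↦ (⟨φ.symm y, coordVec φ y i⟩ : TangentBundle (𝓡 4) M)) φ.target := fun i ↦
    contMDiffOn_liftVec hφ subset_rfl (contDiffOn_const (c := EuclideanSpace.single i (1 : ℝ)))
  have h := ContMDiffOn.clm_bundle_apply₂ (F₁ := Coord) (F₂ := Coord) (F₃ := ℝ)
    (E₁ := fun x : M ↦ TangentSpace (𝓡 4) x) (E₂ := fun x : M ↦ TangentSpace (𝓡 4) x)
    (E₃ := Bundle.Trivial M ℝ) (b := φ.symm) (ψ := fun y ↦ S.metric (φ.symm y))
    (S.metric_smooth.comp_contMDiffOn (contMDiffOn_symm_of_mem_maximalAtlas hφ)) (hc i) (hc j)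
  intro y hy
  have h1 := h y hy
  simp only [Bundle.contMDiffWithinAt_totalSpace] at h1
  exact h1.2.contDiffWithinAt

theorem exists_orthonormal {y : Coord} (hy : y ∈ φ.target) :
    ∃ E : Matrix (Fin 4) (Fin 4) ℝ, E * S.metricIn φ y * Eᵀ = Matrix.of minkowski := by
  obtain ⟨e, he⟩ := S.signature (φ.symm y)
  choose w hw using fun a ↦ liftVec_surjective hφ hy (e a)
  refine ⟨Matrix.of fun a i ↦ w a i, ?_⟩
  ext a b
  rw [← metric_liftVec, Matrix.of_apply, ← he, ← hw, ← hw, liftVec_eq_sum, liftVec_eq_sum]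
  rfl

theorem isSmoothMetricOn : IsSmoothMetricOn (S.metricIn φ) φ.target where
  isOpen := φ.open_target
  smooth := S.contDiffOn_metricIn hφ
  symm _ _ _ _ := S.symm _ _ _
  mul_inv y hy := by
    obtain ⟨E, hE⟩ := S.exists_orthonormal hφ hy
    -- The right inverse is the inverse metric rebuilt from an orthonormal basis; nondegeneracy thus
    -- follows from the signature.
    refine Matrix.mul_nonsing_inv _ (Matrix.isUnit_det_of_right_inverse
      (B := Eᵀ * Matrix.of minkowski * E) ?_)
    have h1 : E * (S.metricIn φ y * Eᵀ * Matrix.of minkowski) = 1 := by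
      rw [← Matrix.mul_assoc, ← Matrix.mul_assoc, hE, minkowski_mul_self]
    rw [← mul_eq_one_comm.mp h1]; simp only [Matrix.mul_assoc]

omit hφ in
theorem vol_mul_det_sq {y : Coord} {E : Matrix (Fin 4) (Fin 4) ℝ}
    (hE : E * S.metricIn φ y * Eᵀ = Matrix.of minkowski) :
    (S.vol (φ.symm y) (coordVec φ y) * E.det) * (S.vol (φ.symm y) (coordVec φ y) * E.det) = 1 := by
  rw [← vol_liftVec]
  rcases S.vol_unit (φ.symm y) (fun a ↦ ∑ i, E a i • coordVec φ y i) fun a b ↦ by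
    rw [metric_liftVec, hE, Matrix.of_apply] with h | h <;> rw [h] <;> norm_num

omit hφ in
theorem isOrientedFrame_iff {y : Coord} {E : Matrix (Fin 4) (Fin 4) ℝ} :
    IsOrientedFrame (S.metricIn φ y) (S.volIn φ y) E ↔
      (∀ a b, S.metric (φ.symm y) (liftVec φ y (WithLp.toLp 2 (E a)))
        (liftVec φ y (WithLp.toLp 2 (E b))) = minkowski a b) ∧
      S.vol (φ.symm y) (fun a ↦ liftVec φ y (WithLp.toLp 2 (E a))) = 1 := by
  simp only [liftVec_eq_sum, vol_liftVec, metric_liftVec]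
  refine ⟨fun h ↦ ⟨fun a b ↦ by rw [h.orthonormal, Matrix.of_apply], ?_⟩,
    fun h ↦ ⟨Matrix.ext h.1, _, S.volIn_eq y, h.2⟩⟩
  obtain ⟨v, hv, hv1⟩ := h.volume
  -- Evaluating at the one place where the symbol is 1 identifies the scale `v` with the volume of
  -- the coordinate frame.
  have h0 := hv 0 1 2 3
  rw [volIn_eq] at h0
  have h1 : levi 0 1 2 3 = 1 := by norm_num [levi]
  rw [h1, mul_one, mul_one] at h0
  rw [h0, hv1]

end LorentzStructure

variable (S : LorentzStructure M)

theorem IsWeylPrincipalFrameOn.isSmoothFrameOn {V : Set M}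
    {e : Fin 4 → ∀ x : M, TangentSpace (𝓡 4) x} (he : IsWeylPrincipalFrameOn S φ V e) :
    IsSmoothFrameOn (S.metricIn φ) (S.volIn φ) (φ.target ∩ φ.symm ⁻¹' V) (frameIn φ e) where
  metric := (S.isSmoothMetricOn hφ).mono (φ.symm.isOpen_inter_preimage he.isOpen)
    Set.inter_subset_left
  smooth a := contDiffOn_euclidean.mp (contDiffOn_vecIn hφ he.subset (he.smooth a))
  frame y hy := by
    have h : ∀ a, liftVec φ y (WithLp.toLp 2 ((Matrix.of (frameIn φ e y)) a)) = e a (φ.symm y) :=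
      fun a ↦ liftVec_vecIn hφ hy.1 (e a)
    rw [S.isOrientedFrame_iff]
    simp only [h]
    exact ⟨he.orthonormal _ hy.2, he.oriented _ hy.2⟩

omit hφ in
theorem DiagonalizesWeyl.congr {g : Coord → Matrix (Fin 4) (Fin 4) ℝ}
    {η : Coord → Fin 4 → Fin 4 → Fin 4 → Fin 4 → ℝ} {e e' : Coord → Fin 4 → Fin 4 → ℝ} {y : Coord}
    (h : DiagonalizesWeyl g η e y) (he : e' y = e y) : DiagonalizesWeyl g η e' y := by
  simp only [DiagonalizesWeyl, sdFrameBivector, frameBivector, he]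
  exact h

/-- The frame with given components in the chart `φ`. -/
def liftFrame (φ : OpenPartialHomeomorph M Coord) (e : Coord → Fin 4 → Fin 4 → ℝ) (a : Fin 4)
    (x : M) : TangentSpace (𝓡 4) x :=
  (liftVec φ (φ x) (WithLp.toLp 2 (e (φ x) a)) : Coord)

omit hφ [IsManifold (𝓡 4) ∞ M] in
theorem liftFrame_symm {e : Coord → Fin 4 → Fin 4 → ℝ} {y : Coord} (hy : y ∈ φ.target)
    (a : Fin 4) : liftFrame φ e a (φ.symm y) = liftVec φ y (WithLp.toLp 2 (e y a)) := by
  have : ∀ p : Coord, p = y → (liftVec φ p (WithLp.toLp 2 (e p a)) : Coord) =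
    liftVec φ y (WithLp.toLp 2 (e y a)) := by rintro p rfl; rfl
  exact this _ (φ.right_inv hy)

theorem isWeylPrincipalFrameOn_liftFrame {V : Set Coord} (hV : V ⊆ φ.target)
    {e : Coord → Fin 4 → Fin 4 → ℝ} (he : IsSmoothFrameOn (S.metricIn φ) (S.volIn φ) V e)
    (hd : ∀ y ∈ V, DiagonalizesWeyl (S.metricIn φ) (S.volIn φ) e y) :
    IsWeylPrincipalFrameOn S φ (φ.source ∩ φ ⁻¹' V) (liftFrame φ e) := by
  have hx : ∀ x ∈ φ.source ∩ φ ⁻¹' V, ∃ y ∈ V, φ.symm y = x := fun x hx ↦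
    ⟨φ x, hx.2, φ.left_inv hx.1⟩
  refine ⟨φ.isOpen_inter_preimage he.metric.isOpen, Set.inter_subset_left, fun a ↦ ?_, ?_, ?_, ?_⟩
  · have h1 := contMDiffOn_liftVec hφ hV (w := fun y ↦ WithLp.toLp 2 (e y a))
      (contDiffOn_euclidean.mpr (he.smooth a))
    refine (h1.comp ((contMDiffOn_of_mem_maximalAtlas hφ).mono Set.inter_subset_left)
      (s := φ.source ∩ φ ⁻¹' V) fun x hx ↦ hx.2).congr fun x hx ↦ ?_
    have : ∀ p : M, p = x → (⟨x, liftFrame φ e a x⟩ : TangentBundle (𝓡 4) M) =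
        ⟨p, (liftFrame φ e a x : Coord)⟩ := by
      rintro p rfl; rfl
    exact this _ (φ.left_inv hx.1)
  · intro x h
    obtain ⟨y, hy, rfl⟩ := hx x h
    intro a b
    rw [liftFrame_symm (hV hy), liftFrame_symm (hV hy)]
    exact (S.isOrientedFrame_iff.mp (he.frame y hy)).1 a b
  · intro x h
    obtain ⟨y, hy, rfl⟩ := hx x h
    simp only [liftFrame_symm (hV hy)]
    exact (S.isOrientedFrame_iff.mp (he.frame y hy)).2
  · intro x h
    obtain ⟨y, hy, rfl⟩ := hx x h
    rw [φ.right_inv (hV hy)]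
    refine (hd y hy).congr ?_
    funext a i
    rw [frameIn, vecIn, liftFrame_symm (hV hy), mfderiv_liftVec hφ (hV hy)]

end Manifold

end

end Spacetime

end

/-! ### The theorem on the manifold -/

theorem proposition3 {M : Type*} [TopologicalSpace M]
    [ChartedSpace (EuclideanSpace ℝ (Fin 4)) M] [IsManifold (𝓡 4) ∞ M]
    (S : Spacetime.LorentzStructure M)
    (φ : OpenPartialHomeomorph M (EuclideanSpace ℝ (Fin 4)))
    (hφ : φ ∈ IsManifold.maximalAtlas (𝓡 4) ∞ M)
    (hI : ∀ x ∈ φ.source, Spacetime.IsTypeI (S.metricIn φ) (S.volIn φ) (φ x)) :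
    (∀ x ∈ φ.source, Spacetime.invDelta (S.metricIn φ) (S.volIn φ) (φ x) ≠ 0) ∧
    (∀ x ∈ φ.source, ∃ (V : Set M) (e : Fin 4 → ∀ x : M, TangentSpace (𝓡 4) x),
      x ∈ V ∧ Spacetime.IsWeylPrincipalFrameOn S φ V e) ∧
    (∀ (V : Set M) (e : Fin 4 → ∀ x : M, TangentSpace (𝓡 4) x),
      Spacetime.IsWeylPrincipalFrameOn S φ V e →
      ∀ x ∈ V, ∀ l m n : Fin 4,
        (Spacetime.connectionTensor (S.metricIn φ) (Spacetime.frameIn φ e) (φ x) l m n : ℂ) =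
          (1 / (Real.sqrt 2 : ℂ)) *
            (Spacetime.sdConnection (S.metricIn φ) (S.volIn φ) (φ x) l m n +
              (starRingEnd ℂ)
                (Spacetime.sdConnection (S.metricIn φ) (S.volIn φ) (φ x) l m n))) := by
  have hS := fun y hy ↦ Spacetime.LorentzStructure.exists_orthonormal hφ S (y := y) hy
  have hΔ : ∀ y ∈ φ.target, Spacetime.IsTypeI (S.metricIn φ) (S.volIn φ) y →
      Spacetime.invDelta (S.metricIn φ) (S.volIn φ) y ≠ 0 ∧ ∃ V ⊆ φ.target, ∃ e, y ∈ V ∧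
        Spacetime.IsSmoothFrameOn (S.metricIn φ) (S.volIn φ) V e ∧
        ∀ z ∈ V, Spacetime.DiagonalizesWeyl (S.metricIn φ) (S.volIn φ) e z := fun y hy h ↦ by
    obtain ⟨V, hV, e, hyV, he, hd⟩ := Spacetime.exists_smooth_principalFrame
      (S.isSmoothMetricOn hφ) (S.vol_smooth φ hφ) (fun z _ ↦ S.volIn_eq z)
      (fun z _ E hE ↦ S.vol_mul_det_sq hE) hy (hS y hy) h
    exact ⟨Spacetime.IsTypeI.invDelta_ne_zero (he.frame y hyV) h (he.sdWeyl_eq_dbl hyV)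
      (he.frameWeyl_trace hyV), V, hV, e, hyV, he, hd⟩
  refine ⟨fun x hx ↦ (hΔ _ (φ.map_source hx) (hI x hx)).1, fun x hx ↦ ?_,
    fun V e he x hx l m n ↦ ?_⟩
  · obtain ⟨-, V, hV, e, hyV, he, hd⟩ := hΔ _ (φ.map_source hx) (hI x hx)
    exact ⟨φ.source ∩ φ ⁻¹' V, Spacetime.liftFrame φ e, ⟨hx, hyV⟩,
      Spacetime.isWeylPrincipalFrameOn_liftFrame hφ S hV he hd⟩
  · have hxs := he.subset hx
    have h := Spacetime.IsWeylPrincipalFrameOn.isSmoothFrameOn hφ S he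
    have hφx : φ x ∈ φ.target ∩ φ.symm ⁻¹' V :=
      ⟨φ.map_source hxs, by rwa [Set.mem_preimage, φ.left_inv hxs]⟩
    refine h.connectionTensor_eq_sdConnection (fun z hz ↦ ?_) hφx
      (hΔ _ (φ.map_source hxs) (hI x hxs)).1 l m n
    -- Principality is given at points of the form φ x, so the coordinate point is rewritten as the
    -- image of its preimage.
    rw [← φ.right_inv hz.1]
    exact he.principal _ hz.2
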